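/- Given two vectors $A=(A[i])_{i=0}^{n}$ and $B=(B[j])_{j=0}^{n}$ of non-negative integers, the $(\max,\min)$-Skewed-Convolution problem is to compute the vector $C=(C[k])_{k=0}^{2n}$ with \[ C[k]=\max_{\substack{0\le i,j\le n\\ i+j=k}}\min\{A[i],\,B[j]+k\}\qquad (0\le k\le 2n). \] This problem can be solved by a deterministic algorithm in $\tilde O(n^{7/4})$ time. That is, there are a program for the word RAM (unit-cost load, store, copy, addition, subtraction, multiplication, integer division, remainder, comparison and jump on $w$-bit words, with arithmetic modulo $2^w$), constants $c,d\in\mathbb N$ and a function $T:\mathbb N\to\mathbb N$ with $T(n)=O(n^{7/4}\log^{d} n)$ as $n\to\infty$ such that the following holds. For all $n\ge 0$, all $A$, $B$ as above, every $N\ge\max\{n,\max_i A[i],\max_j B[j]\}$ and every word length $w$ with $(N+2)^c\le 2^w$, the program, started with $n$, $A$, $B$ in consecutive memory cells, halts after at most $T(n)$ steps with $C[0],\dots,C[2n]$ in the first $2n+1$ memory cells. -/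

import Mathlib

/-! The random access machine with `w`-bit words and unit-cost instructions. -/

namespace WordRAM

/-- The arithmetic operations of the machine. -/
inductive Op where
  | add | sub | mul | div | mod

/-- Arithmetic on words, modulo `2 ^ w`; `div` and `mod` are the unsigned integer quotient and
remainder. -/
def Op.eval (w : ℕ) : Op → ℕ → ℕ → ℕ
  | .add, x, y => (x + y) % 2 ^ w
  | .sub, x, y => (x + (2 ^ w - y)) % 2 ^ w
  | .mul, x, y => (x * y) % 2 ^ w
  | .div, x, y => x / y
  | .mod, x, y => x % y

/-- Instructions. Registers are named by fixed natural numbers, jump targets are positions in the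
program, and memory is addressed indirectly through registers. -/
inductive Instr where
  /-- `reg d := v` (as a word) -/
  | const (d v : ℕ)
  /-- `reg d := reg a` -/
  | copy (d a : ℕ)
  /-- `reg d := reg a o reg b` -/
  | arith (o : Op) (d a b : ℕ)
  /-- `reg d := mem (reg a)` -/
  | load (d a : ℕ)
  /-- `mem (reg d) := reg a` -/
  | store (d a : ℕ)
  /-- go to position `t` -/
  | jump (t : ℕ)
  /-- go to position `t` if `reg a < reg b` -/
  | jumpLt (a b t : ℕ)
  /-- stop -/
  | halt

/-- A program is a finite list of instructions; it mentions only finitely many registers. -/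
abbrev Program := List Instr

/-- A configuration: program counter, registers, memory. -/
structure Config where
  pc : ℕ
  reg : ℕ → ℕ
  mem : ℕ → ℕ

/-- Write the value `v` into register `d` and go on to the next instruction. -/
def Config.setReg (s : Config) (d v : ℕ) : Config :=
  { s with pc := s.pc + 1, reg := Function.update s.reg d v }

/-- The effect of one instruction on a machine with `w`-bit words; `none` if it is `halt`. -/
def Instr.exec (w : ℕ) (s : Config) : Instr → Option Config
  | .const d v => some (s.setReg d (v % 2 ^ w))
  | .copy d a => some (s.setReg d (s.reg a))
  | .arith o d a b => some (s.setReg d (o.eval w (s.reg a) (s.reg b)))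
  | .load d a => some (s.setReg d (s.mem (s.reg a)))
  | .store d a =>
      some { s with pc := s.pc + 1, mem := Function.update s.mem (s.reg d) (s.reg a) }
  | .jump t => some { s with pc := t }
  | .jumpLt a b t => some { s with pc := if s.reg a < s.reg b then t else s.pc + 1 }
  | .halt => none

/-- One step of the program `P`; `none` if the machine has halted, that is, the current instruction
is `halt` or the program counter has left the program. -/
def step (w : ℕ) (P : Program) (s : Config) : Option Config :=
  match P[s.pc]? with
  | some i => i.exec w s
  | none => none

/-- From `s`, the program `P` makes `t` steps and is then in configuration `s'`. -/
def RunsTo (w : ℕ) (P : Program) : ℕ → Config → Config → Prop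
  | 0, s, s' => s = s'
  | t + 1, s, s' => ∃ u, step w P s = some u ∧ RunsTo w P t u s'

/-- Started from `s`, the program `P` halts after at most `T` steps, in configuration `s'`. -/
def HaltsWithin (w : ℕ) (P : Program) (T : ℕ) (s s' : Config) : Prop :=
  ∃ t ≤ T, RunsTo w P t s s' ∧ step w P s' = none

/-- The initial configuration with the given memory contents: first instruction, registers zero. -/
def start (mem : ℕ → ℕ) : Config where
  pc := 0
  reg := fun _ => 0
  mem := mem

end WordRAM

/-- `f = Õ(g)` for functions of a natural number `n`: `f n = O(g n * (log n) ^ d)` as `n → ∞`, for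
some constant `d`. -/
def IsSoftO (f g : ℕ → ℝ) : Prop :=
  ∃ d : ℕ, Asymptotics.IsBigO Filter.atTop f (fun n => g n * Real.log n ^ d)

/-- The pairs of indices `(i, j)` with `i, j ∈ {0, …, n}` and `i + j = k`. -/
def indexPairs (n k : ℕ) : Finset (Fin (n + 1) × Fin (n + 1)) :=
  Finset.univ.filter fun p => (p.1 : ℕ) + (p.2 : ℕ) = k

theorem indexPairs_nonempty (n : ℕ) (k : Fin (2 * n + 1)) : (indexPairs n k).Nonempty := by
  refine ⟨(⟨min (k : ℕ) n, by omega⟩, ⟨(k : ℕ) - min (k : ℕ) n, by omega⟩), ?_⟩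
  simp only [indexPairs, Finset.mem_filter, Finset.mem_univ, true_and]
  omega

/-- The `(max, min)`-skewed-convolution of `A = (A[0], …, A[n])` and `B = (B[0], …, B[n])`:
the vector with entries `C[k] = max_{i + j = k} min {A[i], B[j] + k}` for `k = 0, …, 2 n`. -/
def skewedConv {n : ℕ} (A B : Fin (n + 1) → ℕ) (k : Fin (2 * n + 1)) : ℕ :=
  (indexPairs n k).sup' (indexPairs_nonempty n k) fun p => min (A p.1) (B p.2 + k)

/-- The input of the problem in memory: `n` in cell `0`, then `A[0], …, A[n]` in the cells
`1, …, n + 1`, then `B[0], …, B[n]` in the cells `n + 2, …, 2 n + 2`; all other cells are zero. -/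
def inputMem {n : ℕ} (A B : Fin (n + 1) → ℕ) (a : ℕ) : ℕ :=
  if a = 0 then n
  else if h : a - 1 < n + 1 then A ⟨a - 1, h⟩
  else if h : a - (n + 2) < n + 1 then B ⟨a - (n + 2), h⟩
  else 0

/-- The program `P` solves the `(max, min)`-skewed-convolution problem in time `T`, where `T` is a
function of the length `n` alone. Words are of logarithmic length: for a constant `c`, the machine
may have any word length `w` such that numbers up to `(N + 2) ^ c` fit into a word, where `N` bounds
`n` and all entries of the input. The output `C[0], …, C[2 n]` is in the cells `0, …, 2 n`. -/
def SolvesSkewedConvIn (P : WordRAM.Program) (T : ℕ → ℕ) : Prop :=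
  ∃ c : ℕ, ∀ (n : ℕ) (A B : Fin (n + 1) → ℕ) (N w : ℕ),
    n ≤ N → (∀ i, A i ≤ N) → (∀ j, B j ≤ N) → (N + 2) ^ c ≤ 2 ^ w →
    ∃ s : WordRAM.Config,
      WordRAM.HaltsWithin w P (T n) (WordRAM.start (inputMem A B)) s ∧
      ∀ k : Fin (2 * n + 1), s.mem k = skewedConv A B k

/-! Put all $2n+2$ entries into one list, `A` before `B`, with keys `Z` (the entries themselves) and
skewed keys `X`: $A[i]+n-i$ and $B[j]+n+j$. Then $A[i]\le B[j]+i+j$ holds iff the skewed key of $i$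
is at most that of $j$. The side attaining the minimum is thus decided by a comparison that no
longer depends on $i+j$.

Let $d$ be least with $16^d\ge n+1$. Sort by each key and cut both orders into at most $2\cdot2^d$
buckets of at most $8^d$ elements, about $n^{1/4}$ buckets of size $n^{3/4}$. Pairs with equal
skewed buckets are tried directly (`tri_same`), at cost $n\cdot8^d$.

If the skewed bucket of $i$ is strictly below that of $j$, the value of the pair is that of $i$. For
each sum $k$ it is therefore enough to find the highest key bucket $q$ containing an $i$ that occurs
in such a pair with sum $k$ (`tri_best`), and to try every member of that bucket with its partner
$k-i$ (`tri_search`). Tried pairs that do not satisfy the bucket condition are harmless, as the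
value of every pair is a lower bound for $C[k]$. A pair in a lower key bucket is dominated by the
witness in bucket $q$ (`tri_side`). Exchanging the two sides treats the opposite inequality, so
every pair is covered (`tri_main`).

The best buckets come from $4\cdot4^d$ convolutions: for each key bucket $q$ and skewed bucket $p$,
the indicator of the $i$ in both is convolved with the indicator of the $j$ in skewed buckets above
$p$ (`tri_pass`). Indices are written in base 16 and read in base 32, so that adding two of them
digitwise in $(\mathbb Z/32)^d$ produces no carry (`phin_eq_add`). The transform on this group works
modulo $2^{16d}+1$ with the root $2^d$, whose 16th power is $-1$; neither a prime modulus nor a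
division is needed. Two transforms, a pointwise product and a third transform give $32^d$ times the
number of pairs, at negated positions (`dft_product`). This number is smaller than the modulus, so
its positivity is visible (`tri_hit`). A transform costs $32^d d$ up to constants, hence all of them
cost $4^d32^dd=2^{7d}d$, which is $O(n^{7/4}\log n)$.

Sorting is selection with block maxima: each extraction scans the maxima and one block, $O(8^d)$
steps (`tri_extract`, `SortInv.step`).

To reach the machine, the algorithm is written in a small language of assignments, branches and
counted loops. Correctness is proved there over exact naturals, together with the absence of
overflow (`Tri`), and a compiler is shown to simulate the language within a syntactic time bound
(`reach_cmd`). The exponents of $2^d$ and $d+1$ in that bound are computed from the syntax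
(`time_le`, `deg_main`). -/

namespace WordRAM

/-! ### A structured language over named variables and arrays -/

/-- Expressions over variables and arrays. -/
inductive Expr where
  | lit (v : ℕ)
  | var (x : ℕ)
  | get (a : ℕ) (e : Expr)
  | bin (o : Op) (e f : Expr)

/-- Commands; `loop x b c` runs `c` for `x = 0, …, b - 1`. -/
inductive Cmd where
  | skip
  | set (x : ℕ) (e : Expr)
  | put (a : ℕ) (e f : Expr)
  | seq (c d : Cmd)
  | ifLt (e f : Expr) (c d : Cmd)
  | loop (x b : ℕ) (c : Cmd)

/-- The values of the variables and of the arrays. -/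
structure State where
  var : ℕ → ℕ
  arr : ℕ → ℕ → ℕ

namespace State

/-- Assign a variable. -/
def set (s : State) (x v : ℕ) : State := { s with var := Function.update s.var x v }

/-- Assign an array entry. -/
def put (s : State) (a i v : ℕ) : State :=
  { s with arr := Function.update s.arr a (Function.update (s.arr a) i v) }

theorem set_var (s : State) (x v y : ℕ) :
    (s.set x v).var y = if y = x then v else s.var y := by
  simp [set, Function.update_apply]

@[simp] theorem set_arr (s : State) (x v : ℕ) : (s.set x v).arr = s.arr := rfl

@[simp] theorem put_var (s : State) (a i v : ℕ) : (s.put a i v).var = s.var := rfl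

theorem put_arr (s : State) (a i v b : ℕ) :
    (s.put a i v).arr b = if b = a then Function.update (s.arr a) i v else s.arr b := by
  by_cases h : b = a
  · subst h; simp [put]
  · simp [put, h]

end State

/-- The operations on natural numbers, without overflow. -/
def Op.ideal : Op → ℕ → ℕ → ℕ
  | .add, x, y => x + y
  | .sub, x, y => x - y
  | .mul, x, y => x * y
  | .div, x, y => x / y
  | .mod, x, y => x % y

/-- The operation is exact on words below `W`. -/
def Op.Safe (W : ℕ) : Op → ℕ → ℕ → Prop
  | .add, x, y => x + y < W
  | .sub, x, y => y ≤ x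
  | .mul, x, y => x * y < W
  | .div, _, _ => True
  | .mod, _, _ => True

/-- Entry `i` of array `a` can be addressed: array `0` is the memory below `off`, and the arrays
`1, …, 31` are interleaved above `off`. -/
def AddrOk (W off a i : ℕ) : Prop :=
  if a = 0 then i < off else a < 32 ∧ off + 32 * i + 32 < W

/-- The address of entry `i` of array `a`. -/
def addr (off a i : ℕ) : ℕ := if a = 0 then i else off + 32 * i + a

namespace Expr

/-- The value of an expression. -/
def val (s : State) : Expr → ℕ
  | lit v => v
  | var x => s.var x
  | get a e => s.arr a (e.val s)
  | bin o e f => o.ideal (e.val s) (f.val s)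

/-- No overflow occurs in the evaluation. -/
def Ok (W off : ℕ) (s : State) : Expr → Prop
  | lit v => v < W
  | var _ => True
  | get a e => e.Ok W off s ∧ AddrOk W off a (e.val s)
  | bin o e f => e.Ok W off s ∧ f.Ok W off s ∧ o.Safe W (e.val s) (f.val s)

end Expr

namespace Cmd

/-- The effect of a command. -/
def run : Cmd → State → State
  | skip, s => s
  | set x e, s => s.set x (e.val s)
  | put a e f, s => s.put a (e.val s) (f.val s)
  | seq c d, s => d.run (c.run s)
  | ifLt e f c d, s => if e.val s < f.val s then c.run s else d.run s
  | loop x b c, s => Nat.rec (motive := fun _ => State) s (fun i t => c.run (t.set x i)) (s.var b)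

/-- No overflow occurs in the execution. -/
def Ok (W off : ℕ) : Cmd → State → Prop
  | skip, _ => True
  | set _ e, s => e.Ok W off s
  | put a e f, s => e.Ok W off s ∧ f.Ok W off s ∧ AddrOk W off a (e.val s)
  | seq c d, s => c.Ok W off s ∧ d.Ok W off (c.run s)
  | ifLt e f c d, s => e.Ok W off s ∧ f.Ok W off s ∧
      if e.val s < f.val s then c.Ok W off s else d.Ok W off s
  | loop x b c, s => ∀ i < s.var b, c.Ok W off
      ((Nat.rec (motive := fun _ => State) s (fun i t => c.run (t.set x i)) i : State).set x i)

/-- The variables that a command may change. -/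
def wv : Cmd → List ℕ
  | skip => []
  | set x _ => [x]
  | put _ _ _ => []
  | seq c d => c.wv ++ d.wv
  | ifLt _ _ c d => c.wv ++ d.wv
  | loop x _ c => x :: c.wv

/-- The arrays that a command may change. -/
def wa : Cmd → List ℕ
  | skip => []
  | set _ _ => []
  | put a _ _ => [a]
  | seq c d => c.wa ++ d.wa
  | ifLt _ _ c d => c.wa ++ d.wa
  | loop _ _ c => c.wa

/-- The variables that bound loops. -/
def bv : Cmd → List ℕ
  | skip => []
  | set _ _ => []
  | put _ _ _ => []
  | seq c d => c.bv ++ d.bv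
  | ifLt _ _ c d => c.bv ++ d.bv
  | loop _ b c => b :: c.bv

end Cmd

/-- The states differ only in variables and arrays that `c` may change. -/
structure Same (c : Cmd) (s t : State) : Prop where
  var : ∀ y, y ∉ c.wv → t.var y = s.var y
  arr : ∀ a, a ∉ c.wa → t.arr a = s.arr a

/-- The frame property. The lists of written variables and arrays are syntactic, so for a concrete
command a preserved component is usually found by `decide`. -/
theorem same_run (c : Cmd) (s : State) : Same c s (c.run s) := by
  induction c generalizing s with
  | skip => exact ⟨fun _ _ => rfl, fun _ _ => rfl⟩
  | set x e =>
    refine ⟨fun y hy => ?_, fun _ _ => rfl⟩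
    simp only [Cmd.wv, List.mem_singleton] at hy
    simp [Cmd.run, State.set_var, hy]
  | put a e f =>
    refine ⟨fun _ _ => rfl, fun b hb => ?_⟩
    simp only [Cmd.wa, List.mem_singleton] at hb
    simp [Cmd.run, State.put_arr, hb]
  | seq c d hc hd =>
    refine ⟨fun y hy => ?_, fun y hy => ?_⟩
    · simp only [Cmd.wv, List.mem_append, not_or] at hy
      simp only [Cmd.run]
      rw [(hd _).var y hy.2, (hc _).var y hy.1]
    · simp only [Cmd.wa, List.mem_append, not_or] at hy
      simp only [Cmd.run]
      rw [(hd _).arr y hy.2, (hc _).arr y hy.1]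
  | ifLt e f c d hc hd =>
    refine ⟨fun y hy => ?_, fun y hy => ?_⟩
    · simp only [Cmd.wv, List.mem_append, not_or] at hy
      simp only [Cmd.run]
      split_ifs
      · exact (hc _).var y hy.1
      · exact (hd _).var y hy.2
    · simp only [Cmd.wa, List.mem_append, not_or] at hy
      simp only [Cmd.run]
      split_ifs
      · exact (hc _).arr y hy.1
      · exact (hd _).arr y hy.2
  | loop x b c hc =>
    refine ⟨fun y hy => ?_, fun y hy => ?_⟩
    · simp only [Cmd.wv, List.mem_cons, not_or] at hy
      simp only [Cmd.run]
      induction s.var b with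
      | zero => rfl
      | succ n ih => simp only; rw [(hc _).var y hy.2, State.set_var, if_neg hy.1, ih]
    · simp only [Cmd.wa] at hy
      simp only [Cmd.run]
      induction s.var b with
      | zero => rfl
      | succ n ih => simp only; rw [(hc _).arr y hy, State.set_arr, ih]

/-! ### Total correctness -/

/-- From `s`, the command runs without overflow and ends in a state with `Q`. -/
def Tri (W off : ℕ) (c : Cmd) (s : State) (Q : State → Prop) : Prop :=
  c.Ok W off s ∧ Q (c.run s)

section Tri

variable {W off : ℕ} {s : State} {Q : State → Prop}

theorem tri_skip : Tri W off .skip s Q ↔ Q s := by simp [Tri, Cmd.Ok, Cmd.run]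

theorem tri_set {x : ℕ} {e : Expr} :
    Tri W off (.set x e) s Q ↔ e.Ok W off s ∧ Q (s.set x (e.val s)) := by
  simp [Tri, Cmd.Ok, Cmd.run]

theorem tri_put {a : ℕ} {e f : Expr} :
    Tri W off (.put a e f) s Q ↔ (e.Ok W off s ∧ f.Ok W off s ∧ AddrOk W off a (e.val s)) ∧
      Q (s.put a (e.val s) (f.val s)) := by
  simp [Tri, Cmd.Ok, Cmd.run]

theorem tri_seq {c d : Cmd} :
    Tri W off (.seq c d) s Q ↔ Tri W off c s (fun t => Tri W off d t Q) := by
  simp [Tri, Cmd.Ok, Cmd.run, and_assoc]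

theorem tri_ifLt {e f : Expr} {c d : Cmd} :
    Tri W off (.ifLt e f c d) s Q ↔ (e.Ok W off s ∧ f.Ok W off s) ∧
      if e.val s < f.val s then Tri W off c s Q else Tri W off d s Q := by
  simp only [Tri, Cmd.Ok, Cmd.run]
  split_ifs <;> tauto

theorem Tri.mono {c : Cmd} {R : State → Prop} (h : Tri W off c s Q)
    (hQ : ∀ t, Same c s t → Q t → R t) : Tri W off c s R :=
  ⟨h.1, hQ _ (same_run c s) h.2⟩

theorem Tri.seq {c d : Cmd} {R : State → Prop} (h : Tri W off c s R)
    (hd : ∀ t, Same c s t → R t → Tri W off d t Q) : Tri W off (.seq c d) s Q :=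
  tri_seq.2 (h.mono hd)

/-- The frame `Same` relates each intermediate state to the state before the loop, so invariants
need to mention only what the body changes. The bound is the value of `b` on entry. -/
theorem Tri.loop {x b : ℕ} {c : Cmd} (I : ℕ → State → Prop) (h0 : I 0 s)
    (hs : ∀ i < s.var b, ∀ t, Same (.loop x b c) s t → I i t →
      Tri W off c (t.set x i) (I (i + 1)))
    (hQ : ∀ t, Same (.loop x b c) s t → I (s.var b) t → Q t) :
    Tri W off (.loop x b c) s Q := by
  have same : ∀ i, Same (.loop x b c) s
      (Nat.rec (motive := fun _ => State) s (fun i t => c.run (t.set x i)) i : State) := by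
    intro i
    refine ⟨fun y hy => ?_, fun y hy => ?_⟩
    · simp only [Cmd.wv, List.mem_cons, not_or] at hy
      induction i with
      | zero => rfl
      | succ n ih => simp only; rw [(same_run c _).var y hy.2, State.set_var, if_neg hy.1, ih]
    · simp only [Cmd.wa] at hy
      induction i with
      | zero => rfl
      | succ n ih => simp only; rw [(same_run c _).arr y hy, State.set_arr, ih]
  have key : ∀ i ≤ s.var b, I i
      (Nat.rec (motive := fun _ => State) s (fun i t => c.run (t.set x i)) i : State) := by
    intro i hi
    induction i with
    | zero => exact h0
    | succ n ih => exact (hs n hi _ (same n) (ih (by omega))).2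
  refine ⟨?_, hQ _ (same _) (key _ le_rfl)⟩
  intro i hi
  exact (hs i hi _ (same i) (key i hi.le)).1

end Tri

/-! ### The compiler -/

/-- The register of a variable. -/
def rv (x : ℕ) : ℕ := 2 * x

/-- The register of a temporary value; temporary `0` holds the offset of the arrays. -/
def rt (k : ℕ) : ℕ := 2 * k + 1

/-- Replace the index in temporary `k` by its address in array `a`, using temporary `l`. -/
def addrCode (a k l : ℕ) : List Instr :=
  if a = 0 then [] else
    [.const (rt l) 32, .arith .mul (rt k) (rt k) (rt l), .arith .add (rt k) (rt 0) (rt k),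
      .const (rt l) a, .arith .add (rt k) (rt k) (rt l)]

/-- Evaluate an expression into temporary `k`. -/
def Expr.code (k : ℕ) : Expr → List Instr
  | lit v => [.const (rt k) v]
  | var x => [.copy (rt k) (rv x)]
  | get a e => e.code k ++ (addrCode a k (k + 1) ++ [.load (rt k) (rt k)])
  | bin o e f => e.code k ++ (f.code (k + 1) ++ [.arith o (rt k) (rt k) (rt (k + 1))])

/-- The size of the code of an expression. -/
def Expr.size : Expr → ℕ
  | lit _ => 1
  | var _ => 1
  | get a e => e.size + ((addrCode a 0 0).length + 1)
  | bin _ e f => e.size + (f.size + 1)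

theorem length_addrCode (a k l : ℕ) : (addrCode a k l).length = (addrCode a 0 0).length := by
  unfold addrCode; split_ifs <;> rfl

@[simp] theorem Expr.length_code (e : Expr) (k : ℕ) : (e.code k).length = e.size := by
  induction e generalizing k with
  | lit v => rfl
  | var x => rfl
  | get a e ih => simp [code, size, ih, length_addrCode a k]
  | bin o e f he hf => simp [code, size, he, hf]

/-- The size of the code of a command. -/
def Cmd.size : Cmd → ℕ
  | skip => 0
  | set _ e => e.size + 1
  | put a e f => e.size + (f.size + ((addrCode a 0 0).length + 1))
  | seq c d => c.size + d.size
  | ifLt e f c d => e.size + (f.size + (1 + (d.size + (1 + c.size))))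
  | loop _ _ c => 5 + (c.size + 3)

/-- The code of a command for program position `p`, with temporaries from `k` on. -/
def Cmd.code (p k : ℕ) : Cmd → List Instr
  | skip => []
  | set x e => e.code k ++ [.copy (rv x) (rt k)]
  | put a e f => e.code k ++ (f.code (k + 1) ++
      (addrCode a k (k + 2) ++ [.store (rt k) (rt (k + 1))]))
  | seq c d => c.code p k ++ d.code (p + c.size) k
  | ifLt e f c d => e.code k ++ (f.code (k + 1) ++
      ([.jumpLt (rt k) (rt (k + 1)) (p + e.size + f.size + 1 + d.size + 1)] ++
      (d.code (p + e.size + f.size + 1) k ++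
      ([.jump (p + e.size + f.size + 1 + d.size + 1 + c.size)] ++
      c.code (p + e.size + f.size + 1 + d.size + 1) k))))
  | loop x b c =>
      [.const (rt k) 0, .copy (rt (k + 1)) (rv b), .jumpLt (rt k) (rt (k + 1)) (p + 4),
        .jump (p + 5 + c.size + 3), .copy (rv x) (rt k)] ++
      (c.code (p + 5) (k + 2) ++
      [.const (rt (k + 2)) 1, .arith .add (rt k) (rt k) (rt (k + 2)), .jump (p + 2)])

@[simp] theorem Cmd.length_code (c : Cmd) (p k : ℕ) : (c.code p k).length = c.size := by
  induction c generalizing p k with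
  | skip => rfl
  | set x e => simp [code, size]
  | put a e f => simp [code, size, length_addrCode a k]
  | seq c d hc hd => simp [code, size, hc, hd]
  | ifLt e f c d hc hd => simp [code, size, hc, hd]; ring
  | loop x b c hc => simp [code, size, hc]; ring

/-- A bound for the number of steps, where `β` gives the numbers of iterations. -/
def Cmd.time (β : ℕ → ℕ) : Cmd → ℕ
  | skip => 0
  | set _ e => e.size + 1
  | put a e f => e.size + (f.size + ((addrCode a 0 0).length + 1))
  | seq c d => c.time β + d.time β
  | ifLt e f c d => e.size + (f.size + (2 + max (c.time β) (d.time β)))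
  | loop _ b c => 4 + β b * (c.time β + 5)

/-! ### Code placement and bounded execution -/

/-- The list `c` occurs in the program at position `p`. -/
def CodeAt (P : Program) (p : ℕ) (l : List Instr) : Prop :=
  ∀ i < l.length, P[p + i]? = l[i]?

theorem codeAt_append {P : Program} {p : ℕ} {c d : List Instr} :
    CodeAt P p (c ++ d) ↔ CodeAt P p c ∧ CodeAt P (p + c.length) d := by
  constructor
  · intro h
    refine ⟨fun i hi => ?_, fun i hi => ?_⟩
    · rw [h i (by simp; omega), List.getElem?_append_left hi]
    · rw [add_assoc, h _ (by simp; omega), List.getElem?_append_right (by omega)]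
      simp
  · rintro ⟨h1, h2⟩ i hi
    by_cases hc : i < c.length
    · rw [h1 i hc, List.getElem?_append_left hc]
    · rw [List.getElem?_append_right (by omega), ← h2 _ (by simp at hi; omega)]
      congr 1; omega

theorem codeAt_cons {P : Program} {p : ℕ} {i : Instr} {c : List Instr} :
    CodeAt P p (i :: c) ↔ P[p]? = some i ∧ CodeAt P (p + 1) c := by
  rw [← List.singleton_append, codeAt_append]
  refine and_congr ⟨fun h => by simpa using h 0 (by simp), fun h j hj => ?_⟩ Iff.rfl
  obtain rfl : j = 0 := by simpa using hj
  simpa using h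

/-- From `m`, within `T` steps, the program reaches a configuration with `Q`. -/
def Reach (w : ℕ) (P : Program) (T : ℕ) (m : Config) (Q : Config → Prop) : Prop :=
  ∃ t ≤ T, ∃ m', RunsTo w P t m m' ∧ Q m'

section Reach

variable {w : ℕ} {P : Program} {T U : ℕ} {m u : Config} {Q R : Config → Prop}

theorem RunsTo.trans {a b : ℕ} {x y z : Config} (h : RunsTo w P a x y) (h' : RunsTo w P b y z) :
    RunsTo w P (a + b) x z := by
  induction a generalizing x with
  | zero => cases h; simpa using h'
  | succ a ih =>
    obtain ⟨v, hv, h⟩ := h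
    rw [Nat.add_right_comm]
    exact ⟨v, hv, ih h⟩

theorem Reach.done (h : Q m) : Reach w P 0 m Q := ⟨0, le_rfl, m, rfl, h⟩

theorem Reach.step {i : Instr} (hi : P[m.pc]? = some i) (he : i.exec w m = some u)
    (h : Reach w P T u Q) : Reach w P (T + 1) m Q := by
  obtain ⟨t, ht, m', hr, hq⟩ := h
  exact ⟨t + 1, by omega, m', ⟨u, by simp [WordRAM.step, hi, he], hr⟩, hq⟩

theorem Reach.bind (h : Reach w P T m R) (h' : ∀ m', R m' → Reach w P U m' Q) :
    Reach w P (T + U) m Q := by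
  obtain ⟨t, ht, m', hr, hq⟩ := h
  obtain ⟨t', ht', m'', hr', hq'⟩ := h' m' hq
  exact ⟨t + t', by omega, m'', hr.trans hr', hq'⟩

theorem Reach.mono (h : Reach w P T m R) (hT : T ≤ U) (h' : ∀ m', R m' → Q m') :
    Reach w P U m Q := by
  obtain ⟨t, ht, m', hr, hq⟩ := h
  exact ⟨t, by omega, m', hr, h' _ hq⟩

end Reach

/-! ### Correctness of the compiler -/

/-- The configuration represents the state. -/
structure Rel (w off : ℕ) (s : State) (m : Config) : Prop where
  var : ∀ x, m.reg (rv x) = s.var x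
  base : m.reg (rt 0) = off
  mem : ∀ a i, AddrOk (2 ^ w) off a i → m.mem (addr off a i) = s.arr a i
  var_lt : ∀ x, s.var x < 2 ^ w
  arr_lt : ∀ a i, s.arr a i < 2 ^ w

/-- The configurations have the same memory, variables, and temporaries below `k`. -/
structure Keeps (k : ℕ) (m m' : Config) : Prop where
  mem : m'.mem = m.mem
  var : ∀ x, m'.reg (rv x) = m.reg (rv x)
  tmp : ∀ t < k, m'.reg (rt t) = m.reg (rt t)

theorem Keeps.rel {w off k : ℕ} {s : State} {m m' : Config} (h : Keeps (k + 1) m m')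
    (hr : Rel w off s m) : Rel w off s m' where
  var x := by rw [h.var, hr.var]
  base := by rw [h.tmp 0 (by omega), hr.base]
  mem a i ha := by rw [h.mem, hr.mem a i ha]
  var_lt := hr.var_lt
  arr_lt := hr.arr_lt

theorem Keeps.trans {k : ℕ} {m m' m'' : Config} (h : Keeps k m m') (h' : Keeps k m' m'') :
    Keeps k m m'' where
  mem := by rw [h'.mem, h.mem]
  var x := by rw [h'.var, h.var]
  tmp t ht := by rw [h'.tmp t ht, h.tmp t ht]

theorem Keeps.weaken {k l : ℕ} {m m' : Config} (h : Keeps k m m') (hl : l ≤ k) :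
    Keeps l m m' where
  mem := h.mem
  var := h.var
  tmp t ht := h.tmp t (by omega)

theorem rt_ne_rv (k x : ℕ) : rt k ≠ rv x := by unfold rt rv; omega

theorem rv_ne_rt (k x : ℕ) : rv x ≠ rt k := by unfold rt rv; omega

@[simp] theorem rt_inj {k l : ℕ} : rt k = rt l ↔ k = l := by unfold rt; omega

@[simp] theorem rv_inj {k l : ℕ} : rv k = rv l ↔ k = l := by unfold rv; omega

theorem keeps_setReg (k l v : ℕ) (m : Config) (hl : k ≤ l) : Keeps k m (m.setReg (rt l) v) where
  mem := rfl
  var x := by simp [Config.setReg, rv_ne_rt]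
  tmp t ht := by simp [Config.setReg, Function.update_apply]; omega

@[simp] theorem setReg_pc (m : Config) (r v : ℕ) : (m.setReg r v).pc = m.pc + 1 := rfl

@[simp] theorem setReg_mem (m : Config) (r v : ℕ) : (m.setReg r v).mem = m.mem := rfl

theorem setReg_reg (m : Config) (r v q : ℕ) :
    (m.setReg r v).reg q = if q = r then v else m.reg q := by
  simp [Config.setReg, Function.update_apply]

theorem Op.eval_eq {w : ℕ} {o : Op} {x y : ℕ} (h : o.Safe (2 ^ w) x y) (hx : x < 2 ^ w)
    (hy : y < 2 ^ w) : o.eval w x y = o.ideal x y := by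
  cases o with
  | add => exact Nat.mod_eq_of_lt h
  | sub =>
    simp only [Op.Safe] at h
    simp only [Op.eval, Op.ideal]
    rw [show x + (2 ^ w - y) = (x - y) + 2 ^ w by omega, Nat.add_mod_right,
      Nat.mod_eq_of_lt (by omega)]
  | mul => exact Nat.mod_eq_of_lt h
  | div => rfl
  | mod => rfl

theorem Op.ideal_lt {W : ℕ} {o : Op} {x y : ℕ} (h : o.Safe W x y) (hx : x < W) :
    o.ideal x y < W := by
  cases o with
  | add => exact h
  | sub => simp only [Op.ideal]; omega
  | mul => exact h
  | div => exact lt_of_le_of_lt (Nat.div_le_self _ _) hx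
  | mod => exact lt_of_le_of_lt (Nat.mod_le _ _) hx

/-- The slack in `AddrOk` keeps the product, both sums and the constants below $2^w$, so each
modular operation is exact. -/
theorem reach_addrCode {w off : ℕ} {P : Program} {a k l : ℕ} {m : Config} (hkl : k < l)
    (hk : 0 < k) (hc : CodeAt P m.pc (addrCode a k l)) (hoff : m.reg (rt 0) = off)
    (ha : AddrOk (2 ^ w) off a (m.reg (rt k))) :
    Reach w P (addrCode a 0 0).length m fun m' =>
      m'.pc = m.pc + (addrCode a 0 0).length ∧ m'.mem = m.mem ∧
      m'.reg (rt k) = addr off a (m.reg (rt k)) ∧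
      ∀ r, r ≠ rt k → r ≠ rt l → m'.reg r = m.reg r := by
  unfold addrCode at hc ⊢
  unfold AddrOk at ha
  unfold addr
  split_ifs at hc ha ⊢ with h0
  · exact Reach.done (by simp)
  · simp only [codeAt_cons] at hc
    obtain ⟨h1, h2, h3, h4, h5, -⟩ := hc
    have e1 : ¬ k = l := by omega
    have e2 : ¬ 0 = k := by omega
    have e3 : ¬ 0 = l := by omega
    refine Reach.step h1 rfl (Reach.step (by simpa using h2) rfl (Reach.step (by simpa using h3) rfl
      (Reach.step (by simpa using h4) rfl (Reach.step (by simpa using h5) rfl (Reach.done ?_)))))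
    have c1 : 32 % 2 ^ w = 32 := Nat.mod_eq_of_lt (by omega)
    have c2 : a % 2 ^ w = a := Nat.mod_eq_of_lt (by omega)
    refine ⟨by simp, by simp, ?_, ?_⟩
    · simp only [setReg_reg, Op.eval, rt_inj, e1, e2, e3, if_true, if_false, hoff, c1, c2]
      rw [Nat.mod_eq_of_lt (a := m.reg (rt k) * 32) (by omega),
        Nat.mod_eq_of_lt (a := off + m.reg (rt k) * 32) (by omega), Nat.mod_eq_of_lt (by omega)]
      ring
    · intro r hr hr'
      simp [setReg_reg, hr, hr']

theorem Expr.val_lt {w off : ℕ} {s : State} {m : Config} (hr : Rel w off s m) {e : Expr}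
    (h : e.Ok (2 ^ w) off s) : e.val s < 2 ^ w := by
  induction e with
  | lit v => exact h
  | var x => exact hr.var_lt x
  | get a e _ => exact hr.arr_lt _ _
  | bin o e f he hf => exact Op.ideal_lt h.2.2 (he h.1)

/-- Temporaries act as a stack: evaluation at level `k` leaves lower levels alone, so a first
operand at level `k` survives the second one at level `k + 1`. The condition `0 < k` protects the
array offset. -/
theorem reach_expr {w off : ℕ} {P : Program} {s : State} (e : Expr) (k : ℕ) (hk : 0 < k)
    (m : Config) (hr : Rel w off s m) (h : e.Ok (2 ^ w) off s) (hc : CodeAt P m.pc (e.code k)) :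
    Reach w P e.size m fun m' =>
      m'.pc = m.pc + e.size ∧ Keeps k m m' ∧ m'.reg (rt k) = e.val s := by
  induction e generalizing k m with
  | lit v =>
    simp only [Expr.code, codeAt_cons] at hc
    refine Reach.step hc.1 rfl (Reach.done ⟨rfl, keeps_setReg _ _ _ _ le_rfl, ?_⟩)
    rw [setReg_reg, if_pos rfl]
    exact Nat.mod_eq_of_lt h
  | var x =>
    simp only [Expr.code, codeAt_cons] at hc
    refine Reach.step hc.1 rfl (Reach.done ⟨rfl, keeps_setReg _ _ _ _ le_rfl, ?_⟩)
    rw [setReg_reg, if_pos rfl]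
    exact hr.var x
  | get a e ih =>
    simp only [Expr.code, codeAt_append, Expr.length_code, codeAt_cons] at hc
    obtain ⟨h1, h2, h3, -⟩ := hc
    refine (ih k hk m hr h.1 h1).bind fun m1 ⟨p1, k1, v1⟩ => ?_
    have hr1 : Rel w off s m1 := by
      obtain ⟨k', rfl⟩ : ∃ k', k = k' + 1 := ⟨k - 1, by omega⟩
      exact k1.rel hr
    refine Reach.bind (reach_addrCode (l := k + 1) (by omega) hk (by rw [p1]; exact h2) hr1.base
      (by rw [v1]; exact h.2)) fun m2 ⟨p2, q2, v2, r2⟩ => ?_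
    refine Reach.step (by rw [p2, p1]; rw [length_addrCode] at h3; exact h3) rfl (Reach.done ?_)
    refine ⟨by simp [p2, p1, Expr.size]; ring, ⟨by simp [q2, k1.mem], fun x => ?_,
      fun t ht => ?_⟩, ?_⟩
    · rw [setReg_reg, if_neg (rv_ne_rt _ _), r2 _ (rv_ne_rt _ _) (rv_ne_rt _ _), k1.var]
    · rw [setReg_reg, if_neg (by simp; omega), r2 _ (by simp; omega) (by simp; omega), k1.tmp t ht]
    · rw [setReg_reg, if_pos rfl, v2, q2, v1, hr1.mem _ _ h.2]
      rfl
  | bin o e f he hf =>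
    simp only [Expr.code, codeAt_append, Expr.length_code, codeAt_cons] at hc
    obtain ⟨h1, h2, h3, -⟩ := hc
    refine (he k hk m hr h.1 h1).bind fun m1 ⟨p1, k1, v1⟩ => ?_
    have hr1 : Rel w off s m1 := by
      obtain ⟨k', rfl⟩ : ∃ k', k = k' + 1 := ⟨k - 1, by omega⟩
      exact k1.rel hr
    refine (hf (k + 1) (by omega) m1 hr1 h.2.1 (by rw [p1]; exact h2)).bind
      fun m2 ⟨p2, k2, v2⟩ => ?_
    refine Reach.step (by rw [p2, p1]; exact h3) rfl (Reach.done ?_)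
    refine ⟨by simp [p2, p1, Expr.size]; ring, (k1.trans (k2.weaken (by omega))).trans
      (keeps_setReg _ _ _ _ le_rfl), ?_⟩
    rw [setReg_reg, if_pos rfl, k2.tmp k (by omega), v1, v2]
    exact Op.eval_eq h.2.2 (Expr.val_lt hr h.1) (Expr.val_lt hr h.2.1)

/-- Above `off` the residue modulo 32 identifies the array and the quotient the index; array `0`
lies below `off`. Hence a store changes exactly one array entry. -/
theorem addr_inj {W off a i b j : ℕ} (ha : AddrOk W off a i) (hb : AddrOk W off b j)
    (h : addr off a i = addr off b j) : a = b ∧ i = j := by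
  unfold addr at h
  unfold AddrOk at ha hb
  split_ifs at h ha hb <;> omega

/-- Simulation with a time bound. As loop bounds are never written, a single function `β` gives
every iteration count, also for inner loops reached after other variables have changed. -/
theorem reach_cmd {w off : ℕ} {P : Program} (β : ℕ → ℕ) (hw : 1 < 2 ^ w) (c : Cmd) (p k : ℕ)
    (hk : 0 < k) (s : State)
    (m : Config) (hp : m.pc = p) (hr : Rel w off s m) (h : c.Ok (2 ^ w) off s)
    (hc : CodeAt P p (c.code p k)) (hb : ∀ b ∈ c.bv, b ∉ c.wv) (hβ : ∀ b ∈ c.bv, s.var b = β b) :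
    Reach w P (c.time β) m fun m' =>
      m'.pc = p + c.size ∧ Rel w off (c.run s) m' ∧ ∀ t < k, m'.reg (rt t) = m.reg (rt t) := by
  induction c generalizing p k s m with
  | skip => exact Reach.done ⟨hp, hr, fun _ _ => rfl⟩
  | set x e =>
    subst hp
    simp only [Cmd.code, codeAt_append, Expr.length_code, codeAt_cons] at hc
    refine (reach_expr e k hk m hr h hc.1).bind fun m1 ⟨p1, k1, v1⟩ => ?_
    obtain ⟨k', rfl⟩ : ∃ k', k = k' + 1 := ⟨k - 1, by omega⟩
    have hr1 := k1.rel hr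
    refine Reach.step (by rw [p1]; exact hc.2.1) rfl (Reach.done
      ⟨by simp [p1, Cmd.size, add_assoc], ⟨fun y => ?_, ?_, fun a i ha => ?_, fun y => ?_,
        fun a i => ?_⟩, fun t ht => ?_⟩)
    · simp only [setReg_reg, rv_inj, Cmd.run, State.set_var, hr1.var, v1]
    · rw [setReg_reg, if_neg (rt_ne_rv _ _), hr1.base]
    · exact hr1.mem a i ha
    · simp only [Cmd.run, State.set_var]
      split_ifs
      · exact Expr.val_lt hr h
      · exact hr.var_lt y
    · exact hr.arr_lt a i
    · rw [setReg_reg, if_neg (rt_ne_rv _ _), k1.tmp t ht]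
  | put a e f =>
    subst hp
    simp only [Cmd.code, codeAt_append, Expr.length_code, codeAt_cons] at hc
    obtain ⟨c1, c2, c3, c4, -⟩ := hc
    refine (reach_expr e k hk m hr h.1 c1).bind fun m1 ⟨p1, k1, v1⟩ => ?_
    have hr1 : Rel w off s m1 := by
      obtain ⟨k', rfl⟩ : ∃ k', k = k' + 1 := ⟨k - 1, by omega⟩
      exact k1.rel hr
    refine (reach_expr f (k + 1) (by omega) m1 hr1 h.2.1 (by rw [p1]; exact c2)).bind
      fun m2 ⟨p2, k2, v2⟩ => ?_
    have hr2 : Rel w off s m2 := k2.rel hr1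
    have w2 : m2.reg (rt k) = e.val s := by rw [k2.tmp k (by omega), v1]
    refine Reach.bind (reach_addrCode (l := k + 2) (by omega) hk (by rw [p2, p1]; exact c3) hr2.base
      (by rw [w2]; exact h.2.2)) fun m3 ⟨p3, q3, v3, r3⟩ => ?_
    refine Reach.step (by rw [p3, p2, p1]; rw [length_addrCode] at c4; exact c4) rfl (Reach.done
      ⟨by simp [p3, p2, p1, Cmd.size]; ring, ⟨fun y => ?_, ?_, fun b i hb => ?_, fun y => ?_,
        fun b i => ?_⟩, fun t ht => ?_⟩)
    · exact (r3 _ (rv_ne_rt _ _) (rv_ne_rt _ _)).trans (hr2.var y)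
    · exact (r3 _ (by simp; omega) (by simp)).trans hr2.base
    · have e3 : m3.reg (rt (k + 1)) = f.val s := by rw [r3 _ (by simp) (by simp), v2]
      simp only [v3, w2, e3, q3, Cmd.run, Function.update_apply]
      by_cases hab : b = a ∧ i = e.val s
      · obtain ⟨rfl, rfl⟩ := hab
        simp [State.put_arr]
      · rw [if_neg (fun hh => hab (addr_inj hb h.2.2 hh)), hr2.mem _ _ hb, State.put_arr]
        split_ifs with hba
        · rw [hba, Function.update_apply, if_neg (fun hi => hab ⟨hba, hi⟩)]
        · rfl
    · exact hr.var_lt y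
    · simp only [Cmd.run, State.put_arr]
      split_ifs
      · rw [Function.update_apply]
        split_ifs
        · exact Expr.val_lt hr h.2.1
        · exact hr.arr_lt _ _
      · exact hr.arr_lt _ _
    · refine (r3 _ (by simp; omega) (by simp; omega)).trans ?_
      rw [k2.tmp t (by omega), k1.tmp t ht]
  | seq c d ihc ihd =>
    simp only [Cmd.code, codeAt_append, Cmd.length_code] at hc
    simp only [Cmd.bv, Cmd.wv, List.mem_append, not_or] at hb hβ
    refine (ihc p k hk s m hp hr h.1 hc.1 (fun b h => (hb b (.inl h)).1)
      (fun b h => hβ b (.inl h))).bind fun m1 ⟨p1, r1, t1⟩ => ?_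
    refine (ihd _ k hk _ m1 p1 r1 h.2 hc.2 (fun b h => (hb b (.inr h)).2)
      (fun b h => ?_)).mono le_rfl fun m2 ⟨p2, r2, t2⟩ => ?_
    · rw [(same_run c s).var b (hb b (.inr h)).1, hβ b (.inr h)]
    · exact ⟨by rw [p2, Cmd.size, add_assoc], r2, fun t ht => (t2 t ht).trans (t1 t ht)⟩
  | ifLt e f c d ihc ihd =>
    subst hp
    simp only [Cmd.code, codeAt_append, Expr.length_code, Cmd.length_code, codeAt_cons,
      List.length_singleton] at hc
    simp only [Cmd.bv, Cmd.wv, List.mem_append, not_or] at hb hβ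
    obtain ⟨c1, c2, ⟨c3, -⟩, c4, ⟨c5, -⟩, c6⟩ := hc
    refine (reach_expr e k hk m hr h.1 c1).bind fun m1 ⟨p1, k1, v1⟩ => ?_
    have hr1 : Rel w off s m1 := by
      obtain ⟨k', rfl⟩ : ∃ k', k = k' + 1 := ⟨k - 1, by omega⟩
      exact k1.rel hr
    refine (reach_expr f (k + 1) (by omega) m1 hr1 h.2.1 (by rw [p1]; exact c2)).bind
      fun m2 ⟨p2, k2, v2⟩ => ?_
    have hr2 : Rel w off s m2 := k2.rel hr1
    have w2 : m2.reg (rt k) = e.val s := by rw [k2.tmp k (by omega), v1]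
    have hs : ∀ t < k, m2.reg (rt t) = m.reg (rt t) := fun t ht => by
      rw [k2.tmp t (by omega), k1.tmp t ht]
    have h3 := h.2.2
    have step3 : P[m2.pc]? = some (.jumpLt (rt k) (rt (k + 1))
        (m.pc + e.size + f.size + 1 + d.size + 1)) := by rw [p2, p1]; exact c3
    by_cases hlt : e.val s < f.val s
    · rw [if_pos hlt] at h3
      refine Reach.mono (Reach.step (T := c.time β)
        (u := { m2 with pc := m.pc + e.size + f.size + 1 + d.size + 1 }) step3
        (by simp [Instr.exec, w2, v2, hlt]) ?_) (U := _) (T := _)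
        (by have := le_max_left (c.time β) (d.time β); omega) (fun _ h => h)
      refine (ihc _ k hk s { m2 with pc := m.pc + e.size + f.size + 1 + d.size + 1 } rfl ⟨hr2.var, hr2.base, hr2.mem, hr2.var_lt, hr2.arr_lt⟩ h3 c6
        (fun b h => (hb b (.inl h)).1) (fun b h => hβ b (.inl h))).mono le_rfl
        fun m3 ⟨p3, r3, t3⟩ => ⟨?_, ?_, fun t ht => (t3 t ht).trans (hs t ht)⟩
      · rw [p3, Cmd.size]; ring
      · simpa only [Cmd.run, hlt, if_true] using r3
    · rw [if_neg hlt] at h3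
      refine Reach.mono (Reach.step (T := d.time β + 1)
        (u := { m2 with pc := m.pc + e.size + f.size + 1 }) step3
        (by simp [Instr.exec, w2, v2, hlt, p1, p2]) ?_) (U := _) (T := _)
        (by have := le_max_right (c.time β) (d.time β); omega) (fun _ h => h)
      refine (ihd _ k hk s { m2 with pc := m.pc + e.size + f.size + 1 } rfl ⟨hr2.var, hr2.base, hr2.mem, hr2.var_lt,
        hr2.arr_lt⟩ h3 c4 (fun b h => (hb b (.inr h)).2) (fun b h => hβ b (.inr h))).bind
        fun m3 ⟨p3, r3, t3⟩ => ?_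
      refine Reach.step
        (u := { m3 with pc := m.pc + e.size + f.size + 1 + d.size + 1 + c.size })
        (by rw [p3]; exact c5) rfl (Reach.done ⟨?_, ?_, fun t ht => (t3 t ht).trans (hs t ht)⟩)
      · simp only [Cmd.size]; ring
      · have : (Cmd.ifLt e f c d).run s = d.run s := by simp only [Cmd.run, hlt, if_false]
        rw [this]
        exact ⟨r3.var, r3.base, r3.mem, r3.var_lt, r3.arr_lt⟩
  | loop x b c ih =>
    subst hp
    simp only [Cmd.code, codeAt_append, codeAt_cons, List.length_cons, List.length_nil,
      Cmd.length_code] at hc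
    simp only [Cmd.bv, Cmd.wv, List.mem_cons, not_or] at hb hβ
    obtain ⟨⟨c1, c2, c3, c4, c5, -⟩, c6, c7, c8, c9, -⟩ := hc
    set N := s.var b with hN
    set S : ℕ → State := fun i =>
      Nat.rec (motive := fun _ => State) s (fun i t => c.run (t.set x i)) i with hS
    have hvar : ∀ i, ∀ y, ¬ y = x → y ∉ c.wv → (S i).var y = s.var y := by
      intro i y hy hy'
      induction i with
      | zero => rfl
      | succ n ihn =>
        change (c.run ((S n).set x n)).var y = _
        rw [(same_run c _).var y hy', State.set_var, if_neg hy, ihn]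
    -- Induction on the number `j` of remaining iterations, started at the loop test. Each iteration
    -- costs five instructions besides the body; the failing test and the exit jump cost two.
    have main : ∀ j i, i + j = N → ∀ m1 : Config, m1.pc = m.pc + 2 → Rel w off (S i) m1 →
        m1.reg (rt k) = i → m1.reg (rt (k + 1)) = N →
        Reach w P (j * (c.time β + 5) + 2) m1 fun m' =>
          m'.pc = m.pc + (5 + (c.size + 3)) ∧ Rel w off (S N) m' ∧
          ∀ t < k, m'.reg (rt t) = m1.reg (rt t) := by
      intro j
      induction j with
      | zero =>
        intro i hi m1 p1 r1 v1 w1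
        obtain rfl : i = N := by omega
        refine Reach.mono (T := 2) (Reach.step (u := { m1 with pc := m.pc + 3 })
          (by rw [p1]; exact c3) (by simp [Instr.exec, v1, w1, p1])
          (Reach.step c4 rfl (Reach.done
          ⟨by simp only; ring, ⟨r1.var, r1.base, r1.mem, r1.var_lt, r1.arr_lt⟩,
          fun t _ => rfl⟩))) (by omega) (fun _ h => h)
      | succ j ihj =>
        intro i hi m1 p1 r1 v1 w1
        have hiN : i < N := by omega
        refine Reach.mono (T := 2 + (c.time β + (3 + (j * (c.time β + 5) + 2)))) ?_
          (by ring_nf; omega) (fun _ h => h)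
        have r2 : Rel w off ((S i).set x i)
            ({ m1 with pc := m.pc + 4 }.setReg (rv x) i : Config) := by
          refine ⟨fun y => ?_, ?_, fun a l ha => ?_, fun y => ?_, r1.arr_lt⟩
          · simp only [setReg_reg, rv_inj, State.set_var, r1.var]
          · rw [setReg_reg, if_neg (rt_ne_rv _ _)]; exact r1.base
          · exact r1.mem a l ha
          · rw [State.set_var]
            have := hr.var_lt b
            split_ifs
            · omega
            · exact r1.var_lt y
        rw [add_comm 2]
        refine Reach.step (u := { m1 with pc := m.pc + 4 }) (by rw [p1]; exact c3) ?_
          (Reach.step c5 (u := ({ m1 with pc := m.pc + 4 }.setReg (rv x) i : Config)) ?_ ?_)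
        · simp only [Instr.exec, v1, w1, hiN, if_true]
        · simp only [Instr.exec, v1]
        refine Reach.mono (Reach.bind (ih (m.pc + 5) (k + 2) (by omega) _ _ rfl r2 (h i hiN) c6
          (fun b' h => (hb b' (.inr h)).2) fun b' h' => ?_) (U := 3 + (j * (c.time β + 5) + 2))
          fun m2 ⟨p2, r2', t2⟩ => ?_) (by omega) (fun _ h => h)
        · rw [State.set_var, if_neg (hb b' (.inr h')).1,
            hvar i b' (hb b' (.inr h')).1 (hb b' (.inr h')).2, hβ b' (.inr h')]
        have q2 : m2.reg (rt k) = i := by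
          rw [t2 k (by omega), setReg_reg, if_neg (rt_ne_rv _ _)]; exact v1
        have q2' : m2.reg (rt (k + 1)) = N := by
          rw [t2 (k + 1) (by omega), setReg_reg, if_neg (rt_ne_rv _ _)]; exact w1
        have e1 : (1 : ℕ) % 2 ^ w = 1 := Nat.mod_eq_of_lt hw
        -- The counter cannot wrap, because it is at most the bound, which is the value of a
        -- variable and hence a word.
        have e2 : (i + 1) % 2 ^ w = i + 1 :=
          Nat.mod_eq_of_lt (by have := hr.var_lt b; omega)
        rw [add_comm 3]
        refine Reach.step (u := m2.setReg (rt (k + 2)) 1) (by rw [p2]; exact c7) ?_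
          (Reach.step (u := (m2.setReg (rt (k + 2)) 1).setReg (rt k) (i + 1))
            (by rw [setReg_pc, p2]; exact c8) ?_
          (Reach.step (u := { (m2.setReg (rt (k + 2)) 1).setReg (rt k) (i + 1) with
            pc := m.pc + 2 }) (by rw [setReg_pc, setReg_pc, p2]; exact c9) rfl ?_))
        · simp only [Instr.exec, e1]
        · simp [Instr.exec, setReg_reg, q2, Op.eval, e2]
        · have kk : Keeps k m2 { (m2.setReg (rt (k + 2)) 1).setReg (rt k) (i + 1) with
              pc := m.pc + 2 } := by
            refine ⟨rfl, fun y => ?_, fun t ht => ?_⟩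
            · simp [setReg_reg, rv_ne_rt]
            · have : ¬ t = k := by omega
              have : ¬ t = k + 2 := by omega
              simp [setReg_reg, *]
          refine (ihj (i + 1) (by omega) _ rfl ?_ ?_ ?_).mono le_rfl
            fun m3 ⟨p3, r3, t3⟩ => ⟨p3, r3, fun t ht => ?_⟩
          · obtain ⟨k', rfl⟩ : ∃ k', k = k' + 1 := ⟨k - 1, by omega⟩
            exact kk.rel r2'
          · simp [setReg_reg]
          · simp [setReg_reg, q2']
          · rw [t3 t ht, kk.tmp t ht, t2 t (by omega), setReg_reg, if_neg (rt_ne_rv _ _)]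
    have k2 : Keeps k m ((m.setReg (rt k) 0).setReg (rt (k + 1)) N) :=
      (keeps_setReg _ _ _ _ le_rfl).trans (keeps_setReg _ _ _ _ (by omega))
    refine Reach.mono (T := N * (c.time β + 5) + 2 + 1 + 1)
      (Reach.step (u := m.setReg (rt k) 0) c1 (by simp [Instr.exec])
      (Reach.step (u := (m.setReg (rt k) 0).setReg (rt (k + 1)) N) (by simpa using c2) ?_
        ((main N 0 (by omega) ((m.setReg (rt k) 0).setReg (rt (k + 1)) N) rfl ?_ ?_ ?_).mono le_rfl
          fun m3 ⟨p3, r3, t3⟩ => ⟨by rw [p3, Cmd.size], r3, fun t ht =>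
            (t3 t ht).trans (k2.tmp t ht)⟩))) ?_ (fun _ h => h)
    · simp [Instr.exec, setReg_reg, rv_ne_rt, hr.var, hN]
    · obtain ⟨k', rfl⟩ : ∃ k', k = k' + 1 := ⟨k - 1, by omega⟩
      exact k2.rel hr
    · simp [setReg_reg]
    · simp [setReg_reg]
    · simp only [Cmd.time]
      rw [← hβ b (.inl rfl), ← hN]
      omega

end WordRAM

namespace SkewConv

/-! ### The discrete Fourier transform over a power of `ℤ / 32` -/

open Finset

/-- Digit `t` of `x` in base `32`. -/
def dig (t x : ℕ) : ℕ := x / 32 ^ t % 32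

/-- The inner product of the last `T` digits. -/
def ip (T x y : ℕ) : ℕ := ∑ t ∈ range T, dig t x * dig t y

theorem dig_lt (t x : ℕ) : dig t x < 32 := Nat.mod_lt _ (by norm_num)

theorem dig_add_mul {t T y : ℕ} (h : t < T) (c : ℕ) : dig t (y + 32 ^ T * c) = dig t y := by
  unfold dig
  obtain ⟨e, rfl⟩ : ∃ e, T = t + 1 + e := ⟨T - (t + 1), by omega⟩
  rw [show y + 32 ^ (t + 1 + e) * c = y + 32 ^ t * (32 * (32 ^ e * c)) by ring,
    Nat.add_mul_div_left _ _ (by positivity), Nat.add_mul_mod_self_left]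

theorem dig_top {T y u : ℕ} (hy : y < 32 ^ T) (hu : u < 32) : dig T (y + 32 ^ T * u) = u := by
  unfold dig
  rw [Nat.add_mul_div_left _ _ (by positivity), Nat.div_eq_of_lt hy, zero_add, Nat.mod_eq_of_lt hu]

theorem dig_succ (t x : ℕ) : dig (t + 1) x = dig t (x / 32) := by
  unfold dig
  rw [Nat.div_div_eq_div_mul, pow_succ']

theorem ip_comm (T x y : ℕ) : ip T x y = ip T y x := by
  simp [ip, mul_comm]

theorem sum_range_mul_add {R : Type*} [AddCommMonoid R] (a b : ℕ) (g : ℕ → R) :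
    ∑ x ∈ range (a * b), g x = ∑ u ∈ range b, ∑ y ∈ range a, g (y + a * u) := by
  induction b with
  | zero => simp
  | succ b ih => rw [mul_add_one, sum_range_add, ih, sum_range_succ]; simp [add_comm]

/-! ### Partial transforms and orthogonality of characters -/

section Ring

variable {R : Type*} [CommRing R] (ω : R)

/-- The transform with respect to the last `T` digits. -/
def partialDFT (f : ℕ → R) (T x : ℕ) : R :=
  ∑ y ∈ range (32 ^ T), f (y + 32 ^ T * (x / 32 ^ T)) * ω ^ ip T x y

theorem partialDFT_zero (f : ℕ → R) (x : ℕ) : partialDFT ω f 0 x = f x := by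
  simp [partialDFT, ip]

theorem partialDFT_of_lt (f : ℕ → R) {d x : ℕ} (hx : x < 32 ^ d) :
    partialDFT ω f d x = ∑ y ∈ range (32 ^ d), f y * ω ^ ip d x y := by
  simp [partialDFT, Nat.div_eq_of_lt hx]

/-- The number in question is `x` with digit `T` replaced by `u`: the higher and the lower digits
are those of `x`. -/
theorem sub_dig_div (T x u : ℕ) :
    (x - dig T x * 32 ^ T + u * 32 ^ T) / 32 ^ T = 32 * (x / 32 ^ (T + 1)) + u ∧
    ∀ t < T, dig t (x - dig T x * 32 ^ T + u * 32 ^ T) = dig t x := by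
  have h1 : x = x % 32 ^ T + 32 ^ T * (32 * (x / 32 ^ (T + 1)) + dig T x) := by
    unfold dig
    rw [pow_succ, ← Nat.div_div_eq_div_mul, Nat.div_add_mod, Nat.mod_add_div]
  have h2 : x - dig T x * 32 ^ T + u * 32 ^ T =
      x % 32 ^ T + 32 ^ T * (32 * (x / 32 ^ (T + 1)) + u) := by
    have : x - dig T x * 32 ^ T = x % 32 ^ T + 32 ^ T * (32 * (x / 32 ^ (T + 1))) := by
      rw [Nat.sub_eq_iff_eq_add]
      · linarith
      · have : 0 ≤ 32 ^ T * (32 * (x / 32 ^ (T + 1))) := Nat.zero_le _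
        nlinarith [Nat.zero_le (x % 32 ^ T)]
    rw [this]; ring
  constructor
  · rw [h2, Nat.add_mul_div_left _ _ (by positivity),
      Nat.div_eq_of_lt (Nat.mod_lt _ (by positivity)), zero_add]
  · intro t ht
    rw [h2, dig_add_mul ht]
    conv_rhs => rw [h1, dig_add_mul ht]

/-- The radix-32 butterfly. Splitting off the top digit `u` of the summation index leaves the
previous partial transform at `x` with digit `T` set to `u`, times the character value for that
digit. -/
theorem partialDFT_succ (f : ℕ → R) (T x : ℕ) :
    partialDFT ω f (T + 1) x = ∑ u ∈ range 32,
      partialDFT ω f T (x - dig T x * 32 ^ T + u * 32 ^ T) * ω ^ (u * dig T x) := by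
  rw [partialDFT, pow_succ, sum_range_mul_add]
  refine sum_congr rfl fun u hu => ?_
  rw [mem_range] at hu
  rw [partialDFT, sum_mul, (sub_dig_div T x u).1]
  refine sum_congr rfl fun y hy => ?_
  rw [mem_range] at hy
  rw [mul_assoc (f _), ← pow_add]
  congr 2
  · rw [pow_succ, add_assoc]; congr 1; ring
  · rw [ip, sum_range_succ, dig_top hy hu, mul_comm u (dig T x)]
    congr 1
    refine sum_congr rfl fun t ht => ?_
    rw [mem_range] at ht
    rw [dig_add_mul ht, (sub_dig_div T x u).2 t ht]

variable {ω}

theorem pow_thirtyTwo (h : ω ^ 16 = -1) : ω ^ 32 = 1 := by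
  rw [show 32 = 16 * 2 by norm_num, pow_mul, h]; norm_num

theorem pow_mod_thirtyTwo (h : ω ^ 16 = -1) (k : ℕ) : ω ^ (k % 32) = ω ^ k := by
  conv_rhs => rw [← Nat.mod_add_div k 32, pow_add, pow_mul, pow_thirtyTwo h, one_pow, mul_one]

/-- Orthogonality in an arbitrary commutative ring. The usual cancellation of $\omega^c-1$ is
unavailable; instead the geometric sum factors as $\prod_{e<5}(1+y^{2^e})$ and one factor vanishes.
-/
theorem sum_pow (h : ω ^ 16 = -1) (c : ℕ) :
    ∑ u ∈ range 32, ω ^ (u * c) = if 32 ∣ c then 32 else 0 := by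
  have h1 : ∀ u, ω ^ (u * c) = (ω ^ c) ^ u := fun u => by rw [mul_comm, pow_mul]
  simp only [h1]
  split_ifs with hc
  · obtain ⟨k, rfl⟩ := hc
    simp [pow_mul, pow_thirtyTwo h]
  · have h2 : ∀ y : R, ∑ u ∈ range 32, y ^ u =
        (1 + y) * (1 + y ^ 2) * (1 + y ^ 4) * (1 + y ^ 8) * (1 + y ^ 16) := by
      intro y; simp only [sum_range_succ, sum_range_zero]; ring
    have h3 : ∀ e o, 2 ^ e * 16 = 2 ^ e * 16 → c * 2 ^ e = 16 * (2 * o + 1) →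
        1 + (ω ^ c) ^ 2 ^ e = 0 := by
      intro e o _ ho
      rw [← pow_mul, ho, pow_mul, h, pow_succ, pow_mul]; simp
    rw [h2]
    -- As 32 does not divide `c`, its 2-adic valuation is some $a\le4$. Then $c\,2^{4-a}$ is an odd
    -- multiple of 16, and the factor with $e=4-a$ is $1+(-1)=0$.
    have cases : (∃ o, c = 2 * o + 1) ∨ (∃ o, c = 2 * (2 * o + 1)) ∨ (∃ o, c = 4 * (2 * o + 1)) ∨
      (∃ o, c = 8 * (2 * o + 1)) ∨ ∃ o, c = 16 * (2 * o + 1) := by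
      by_contra! hh
      obtain ⟨a1, a2, a3, a4, a5⟩ := hh
      have := a1 (c / 2); have := a2 (c / 4); have := a3 (c / 8); have := a4 (c / 16)
      have := a5 (c / 32)
      omega
    rcases cases with ⟨o, ho⟩ | ⟨o, ho⟩ | ⟨o, ho⟩ | ⟨o, ho⟩ | ⟨o, ho⟩
    · have := h3 4 o rfl (by omega); norm_num at this; rw [this]; ring
    · have := h3 3 o rfl (by omega); norm_num at this; rw [this]; ring
    · have := h3 2 o rfl (by omega); norm_num at this; rw [this]; ring
    · have := h3 1 o rfl (by omega); norm_num at this; rw [this]; ring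
    · have := h3 0 o rfl (by omega); norm_num at this; rw [this]; ring

/-- The sum factors over the digits of `x`, which range independently, into one-digit sums. -/
theorem sum_pow_digits (h : ω ^ 16 = -1) (d : ℕ) (c : ℕ → ℕ) :
    ∑ x ∈ range (32 ^ d), ω ^ (∑ t ∈ range d, dig t x * c t) =
      if ∀ t < d, 32 ∣ c t then 32 ^ d else 0 := by
  induction d with
  | zero => simp
  | succ d ih =>
    rw [pow_succ, sum_range_mul_add]
    have : ∀ u ∈ range 32, ∑ y ∈ range (32 ^ d),
        ω ^ (∑ t ∈ range (d + 1), dig t (y + 32 ^ d * u) * c t) =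
        ω ^ (u * c d) * ∑ y ∈ range (32 ^ d), ω ^ (∑ t ∈ range d, dig t y * c t) := by
      intro u hu
      rw [mem_range] at hu
      rw [mul_sum]
      refine sum_congr rfl fun y hy => ?_
      rw [mem_range] at hy
      rw [sum_range_succ, dig_top hy hu, ← pow_add, add_comm]
      congr 2
      refine sum_congr rfl fun t ht => ?_
      rw [dig_add_mul (mem_range.1 ht)]
    rw [sum_congr rfl this, ← sum_mul, ih, sum_pow h]
    by_cases h1 : 32 ∣ c d
    · by_cases h2 : ∀ t < d, 32 ∣ c t
      · rw [if_pos h1, if_pos h2, if_pos, pow_succ']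
        intro t ht
        rcases Nat.lt_succ_iff_lt_or_eq.1 ht with h | rfl
        exacts [h2 t h, h1]
      · have h4 : ¬ ∀ t < d + 1, 32 ∣ c t := fun h3 => h2 fun t ht => h3 t (by omega)
        rw [if_neg h2, if_neg h4, mul_zero]
    · have h4 : ¬ ∀ t < d + 1, 32 ∣ c t := fun h3 => h1 (h3 d (by omega))
      rw [if_neg h1, if_neg h4, zero_mul]

end Ring

/-! ### Convolution on the group of digit vectors -/

/-- The digitwise sums of `v`, `y` and `z` are divisible by `32`. -/
def Cancel (d v y z : ℕ) : Prop := ∀ t < d, 32 ∣ dig t v + dig t y + dig t z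

instance decidableCancel (d v y z : ℕ) : Decidable (Cancel d v y z) := by unfold Cancel; infer_instance

/-- The number of cancelling pairs, with weights. -/
def cancelCount (d : ℕ) (a b : ℕ → ℕ) (v : ℕ) : ℕ :=
  ∑ y ∈ range (32 ^ d), ∑ z ∈ range (32 ^ d), if Cancel d v y z then a y * b z else 0

/-- Applying the forward transform once more, instead of the inverse, returns the convolution at the
negated argument and scaled by $32^d$. This is why triples with digitwise sum zero are counted. -/
theorem dft_product {R : Type*} [CommRing R] {ω : R} (h : ω ^ 16 = -1) (d : ℕ) (a b : ℕ → ℕ)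
    (v : ℕ) :
    ∑ x ∈ range (32 ^ d), ((∑ y ∈ range (32 ^ d), (a y : R) * ω ^ ip d x y) *
      (∑ z ∈ range (32 ^ d), (b z : R) * ω ^ ip d x z)) * ω ^ ip d v x =
    ((32 ^ d * cancelCount d a b v : ℕ) : R) := by
  have h1 : ∀ x, ((∑ y ∈ range (32 ^ d), (a y : R) * ω ^ ip d x y) *
      (∑ z ∈ range (32 ^ d), (b z : R) * ω ^ ip d x z)) * ω ^ ip d v x =
      ∑ y ∈ range (32 ^ d), ∑ z ∈ range (32 ^ d), ((a y : R) * b z) *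
        ω ^ (∑ t ∈ range d, dig t x * (dig t v + dig t y + dig t z)) := by
    intro x
    rw [sum_mul_sum, sum_mul]
    refine sum_congr rfl fun y _ => ?_
    rw [sum_mul]
    refine sum_congr rfl fun z _ => ?_
    rw [show (a y : R) * ω ^ ip d x y * ((b z : R) * ω ^ ip d x z) * ω ^ ip d v x =
      (a y : R) * b z * ω ^ (ip d v x + ip d x y + ip d x z) by ring, ip_comm d v x]
    congr 2
    simp only [ip, ← sum_add_distrib, mul_add]
  simp only [h1]
  rw [sum_comm, cancelCount]
  push_cast
  rw [mul_sum]
  refine sum_congr rfl fun y _ => ?_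
  rw [sum_comm, mul_sum]
  refine sum_congr rfl fun z _ => ?_
  rw [← mul_sum, sum_pow_digits h]
  by_cases hc : Cancel d v y z
  · rw [if_pos hc, if_pos (by exact hc)]; ring
  · rw [if_neg hc, if_neg (by exact hc)]; ring

theorem cancelCount_pos {d : ℕ} {a b : ℕ → ℕ} {v : ℕ} :
    0 < cancelCount d a b v ↔
      ∃ y < 32 ^ d, ∃ z < 32 ^ d, Cancel d v y z ∧ 0 < a y ∧ 0 < b z := by
  unfold cancelCount
  simp only [Finset.sum_pos_iff, mem_range]
  constructor
  · rintro ⟨y, hy, z, hz, h⟩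
    by_cases hc : Cancel d v y z
    · rw [if_pos hc] at h
      exact ⟨y, hy, z, hz, hc, Nat.pos_of_mul_pos_right h, Nat.pos_of_mul_pos_left h⟩
    · rw [if_neg hc] at h; omega
  · rintro ⟨y, hy, z, hz, hc, ha, hb⟩
    exact ⟨y, hy, z, hz, by rw [if_pos hc]; positivity⟩

theorem cancelCount_le {d : ℕ} {a b : ℕ → ℕ} (ha : ∀ x < 32 ^ d, a x ≤ 1)
    (hb : ∀ x < 32 ^ d, b x ≤ 1) (v : ℕ) :
    cancelCount d a b v ≤ 32 ^ d * 32 ^ d := by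
  unfold cancelCount
  calc _ ≤ ∑ y ∈ range (32 ^ d), ∑ z ∈ range (32 ^ d), 1 := by
        refine sum_le_sum fun y hy => sum_le_sum fun z hz => ?_
        split_ifs
        · exact Nat.mul_le_mul (ha y (mem_range.1 hy)) (hb z (mem_range.1 hz))
        · simp
    _ = _ := by simp

/-! ### Encoding indices by digits without carries -/

/-- Reinterpret the base-`16` digits in base `32`. -/
def psi (i : ℕ) : ℕ := if i = 0 then 0 else i % 16 + 32 * psi (i / 16)
decreasing_by omega

/-- Negate the base-`32` digits and evaluate in base `16`. -/
def phin (x : ℕ) : ℕ := if x = 0 then 0 else (32 - x % 32) % 32 + 16 * phin (x / 32)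
decreasing_by omega

theorem psi_eq (i : ℕ) : psi i = i % 16 + 32 * psi (i / 16) := by
  by_cases h : i = 0
  · subst h; simp [psi]
  · conv_lhs => rw [psi, if_neg h]

theorem phin_eq (x : ℕ) : phin x = (32 - x % 32) % 32 + 16 * phin (x / 32) := by
  by_cases h : x = 0
  · subst h; simp [phin]
  · conv_lhs => rw [phin, if_neg h]

theorem psi_lt {d i : ℕ} (hi : i < 16 ^ d) : psi i < 32 ^ d := by
  induction d generalizing i with
  | zero => simp at hi; subst hi; simp [psi]
  | succ d ih =>
    have := ih (i := i / 16) (by rw [pow_succ] at hi; omega)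
    rw [psi_eq, pow_succ]; omega

/-- Each digit is at most $31\le3\cdot15$, so the value is at most $3(16^d-1)$. This is the form
that carries the induction; it bounds the positions addressed in `aBest`. -/
theorem phin_le {d x : ℕ} (hx : x < 32 ^ d) : phin x + 3 ≤ 3 * 16 ^ d := by
  induction d generalizing x with
  | zero => simp at hx; subst hx; simp [phin]
  | succ d ih =>
    have := ih (x := x / 32) (by rw [pow_succ] at hx; omega)
    rw [phin_eq, pow_succ]; omega

theorem dig_mul_le (T x : ℕ) : dig T x * 32 ^ T ≤ x :=
  (Nat.mul_le_mul_right _ (Nat.mod_le _ _)).trans (Nat.div_mul_le_self _ _)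

theorem sub_dig_lt {T d x u : ℕ} (hT : T < d) (hx : x < 32 ^ d) (hu : u < 32) :
    x - dig T x * 32 ^ T + u * 32 ^ T < 32 ^ d := by
  obtain ⟨e, rfl⟩ : ∃ e, d = T + 1 + e := ⟨d - (T + 1), by omega⟩
  have h1 : x / 32 ^ (T + 1) < 32 ^ e := by
    rw [Nat.div_lt_iff_lt_mul (by positivity), ← pow_add, add_comm]; exact hx
  have h2 : (x - dig T x * 32 ^ T + u * 32 ^ T) / 32 ^ T < 32 * 32 ^ e := by
    rw [(sub_dig_div T x u).1]; omega
  rw [Nat.div_lt_iff_lt_mul (by positivity)] at h2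
  calc _ < 32 * 32 ^ e * 32 ^ T := h2
    _ = 32 ^ (T + 1 + e) := by ring

theorem cancel_succ {d v y z : ℕ} : Cancel (d + 1) v y z ↔
    32 ∣ v % 32 + y % 32 + z % 32 ∧ Cancel d (v / 32) (y / 32) (z / 32) := by
  unfold Cancel
  constructor
  · intro h
    refine ⟨by simpa [dig] using h 0 (by omega), fun t ht => ?_⟩
    simpa only [dig_succ] using h (t + 1) (by omega)
  · rintro ⟨h0, h⟩ t ht
    rcases t with _ | t
    · simpa [dig] using h0
    · simpa only [dig_succ] using h t (by omega)

theorem psi_mod_div (i : ℕ) : psi i % 32 = i % 16 ∧ psi i / 32 = psi (i / 16) := by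
  rw [psi_eq]; omega

/-- Two base-16 digits add up to at most 30, so their sum is determined modulo 32. The negated
digits of `v` are exactly these sums, and evaluating them in base 16 performs the carries. -/
theorem phin_eq_add {d i j v : ℕ} (hi : i < 16 ^ d) (hj : j < 16 ^ d) (hv : v < 32 ^ d)
    (h : Cancel d v (psi i) (psi j)) : phin v = i + j := by
  induction d generalizing i j v with
  | zero => simp at hi hj hv; subst hi; subst hj; subst hv; simp [phin]
  | succ d ih =>
    rw [cancel_succ, (psi_mod_div i).1, (psi_mod_div i).2, (psi_mod_div j).1,
      (psi_mod_div j).2] at h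
    rw [pow_succ] at hi hj hv
    rw [phin_eq, ih (by omega) (by omega) (by omega) h.2]
    omega

theorem exists_cancel (d y z : ℕ) : ∃ v < 32 ^ d, Cancel d v y z := by
  induction d generalizing y z with
  | zero => exact ⟨0, by simp, fun t ht => by omega⟩
  | succ d ih =>
    obtain ⟨v, hv, hc⟩ := ih (y / 32) (z / 32)
    refine ⟨(64 - y % 32 - z % 32) % 32 + 32 * v, ?_, ?_⟩
    · rw [pow_succ]; omega
    · rw [cancel_succ]
      refine ⟨by omega, ?_⟩
      have : ((64 - y % 32 - z % 32) % 32 + 32 * v) / 32 = v := by omega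
      rwa [this]

end SkewConv

namespace SkewConv

open WordRAM WordRAM.Expr WordRAM.Cmd

/-! ### The program -/

instance : Add Expr := ⟨Expr.bin .add⟩
instance : Sub Expr := ⟨Expr.bin .sub⟩
instance : Mul Expr := ⟨Expr.bin .mul⟩
instance : Div Expr := ⟨Expr.bin .div⟩
instance : Mod Expr := ⟨Expr.bin .mod⟩

theorem val_add (s : State) (e f : Expr) : (e + f).val s = e.val s + f.val s := rfl
theorem val_sub (s : State) (e f : Expr) : (e - f).val s = e.val s - f.val s := rfl
theorem val_mul (s : State) (e f : Expr) : (e * f).val s = e.val s * f.val s := rfl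
theorem val_div (s : State) (e f : Expr) : (e / f).val s = e.val s / f.val s := rfl
theorem val_mod (s : State) (e f : Expr) : (e % f).val s = e.val s % f.val s := rfl

section Ok

variable {W off : ℕ} {s : State} {e f : Expr}

theorem ok_add : (e + f).Ok W off s ↔ e.Ok W off s ∧ f.Ok W off s ∧ e.val s + f.val s < W :=
  Iff.rfl
theorem ok_sub : (e - f).Ok W off s ↔ e.Ok W off s ∧ f.Ok W off s ∧ f.val s ≤ e.val s := Iff.rfl
theorem ok_mul : (e * f).Ok W off s ↔ e.Ok W off s ∧ f.Ok W off s ∧ e.val s * f.val s < W :=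
  Iff.rfl
theorem ok_div : (e / f).Ok W off s ↔ e.Ok W off s ∧ f.Ok W off s ∧ True := Iff.rfl
theorem ok_mod : (e % f).Ok W off s ↔ e.Ok W off s ∧ f.Ok W off s ∧ True := Iff.rfl

end Ok

infixr:60 " ;; " => Cmd.seq

notation "vN1" => 0
notation "vEl" => 1
notation "vDim" => 2
notation "vDD" => 3
notation "vSz" => 4
notation "vNB" => 5
notation "vP16" => 6
notation "vP2" => 7
notation "vMod" => 8
notation "v32" => 9
notation "vK2" => 10
notation "vT" => 11
notation "vX" => 12
notation "vU" => 13
notation "vSt" => 14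
notation "vDg" => 15
notation "vAcc" => 16
notation "vLo" => 17
notation "vY" => 18
notation "vBv" => 19
notation "vBe" => 20
notation "vE" => 21
notation "vB" => 22
notation "vR" => 23
notation "vBlk" => 24
notation "vOU" => 25
notation "vOV" => 26
notation "vFU" => 27
notation "vFV" => 28
notation "vQ" => 29
notation "vPb" => 30
notation "vI" => 31
notation "vK" => 32
notation "vJ" => 33
notation "vV" => 34
notation "vRk" => 35

notation "aRaw" => 0
notation "aZ" => 1
notation "aX" => 2
notation "aK" => 3
notation "aMx" => 4
notation "aOrdZ" => 5
notation "aBucZ" => 6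
notation "aOrdX" => 7
notation "aBucX" => 8
notation "aPsi" => 9
notation "aPhin" => 10
notation "aW" => 11
notation "aA" => 12
notation "aB" => 13
notation "aT" => 14
notation "aBest" => 15
notation "aC" => 16

/-- Read the length. -/
def readCmd : Cmd := set vN1 (get aRaw (lit 0) + lit 1)

/-- Compute `d` and the parameters that depend on it. -/
def paramCmd : Cmd :=
  set vDim (lit 0) ;; set vP16 (lit 1) ;; set vP2 (lit 1) ;; set vSz (lit 1) ;;
  set vDD (lit 1) ;;
  loop vX vN1 (ifLt (var vP16) (var vN1)
    (set vDim (var vDim + lit 1) ;; set vP16 (var vP16 * lit 16) ;; set vP2 (var vP2 * lit 2) ;;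
      set vSz (var vSz * lit 8) ;; set vDD (var vDD * lit 32)) skip) ;;
  set vEl (var vN1 + var vN1) ;; set vK2 (var vEl - lit 1) ;; set vNB (var vP2 + var vP2) ;;
  set vMod (var vP16 * var vP16 * (var vP16 * var vP16) + lit 1) ;; set v32 (lit 32)

/-- Copy the keys and compute the skewed keys. -/
def keysCmd : Cmd :=
  loop vE vEl (
    put aZ (var vE) (get aRaw (var vE + lit 1)) ;;
    ifLt (var vE) (var vN1)
      (put aX (var vE) (get aZ (var vE) + (var vN1 - (var vE + lit 1))))
      (put aX (var vE) (get aZ (var vE) + (var vE - lit 1))))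

/-- Tabulate `psi`, `phin` and the roots of unity. -/
def tablesCmd : Cmd :=
  loop vX vN1 (put aPsi (var vX) (var vX % lit 16 + lit 32 * get aPsi (var vX / lit 16))) ;;
  loop vX vDD (put aPhin (var vX)
    ((lit 32 - var vX % lit 32) % lit 32 + lit 16 * get aPhin (var vX / lit 32))) ;;
  set vAcc (lit 1) ;;
  loop vU v32 (put aW (var vU) (var vAcc) ;; set vAcc (var vAcc * var vP2 % var vMod))

/-- Find the maximum of `len` entries of array `a` from `vLo` on, and its position. -/
def scanCmd (a len : ℕ) : Cmd :=
  set vBv (lit 0) ;;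
  loop vY len (ifLt (var vBv) (get a (var vLo + var vY))
    (set vBv (get a (var vLo + var vY)) ;; set vBe (var vLo + var vY)) skip)

/-- Initialize the remaining keys and the maxima of the blocks. -/
def sortInitCmd (key : ℕ) : Cmd :=
  loop vE vEl (put aK (var vE) (get key (var vE) + lit 1)) ;;
  loop vB vNB (set vLo (var vB * var vSz) ;; scanCmd aK vSz ;; put aMx (var vB) (var vBv))

/-- Extract the largest remaining element. -/
def extractCmd (ord buc : ℕ) : Cmd :=
  set vLo (lit 0) ;; scanCmd aMx vNB ;; set vBlk (var vBe) ;;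
  set vLo (var vBlk * var vSz) ;; scanCmd aK vSz ;; set vE (var vBe) ;;
  put aK (var vE) (lit 0) ;;
  scanCmd aK vSz ;; put aMx (var vBlk) (var vBv) ;;
  put ord (var vEl - (var vR + lit 1)) (var vE) ;;
  put buc (var vE) ((var vEl - (var vR + lit 1)) / var vSz)

/-- Sort the elements by their keys and divide them into buckets. -/
def sortCmd (key ord buc : ℕ) : Cmd :=
  sortInitCmd key ;; loop vR vEl (extractCmd ord buc)

/-- Try the pair of indices in `vI` and `vJ`. -/
def visitCmd : Cmd :=
  set vK (var vI + var vJ) ;;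
  set vV (get aZ (var vOU + var vI) + var vK * var vFU) ;;
  ifLt (get aZ (var vOV + var vJ) + var vK * var vFV) (var vV)
    (set vV (get aZ (var vOV + var vJ) + var vK * var vFV)) skip ;;
  ifLt (get aC (var vK)) (var vV) (put aC (var vK) (var vV)) skip

/-- Try all pairs in a common bucket of skewed keys. -/
def sameCmd : Cmd :=
  loop vI vN1 (loop vR vSz (
    set vRk (get aBucX (var vI) * var vSz + var vR) ;;
    ifLt (var vRk) (var vEl)
      (set vE (get aOrdX (var vRk)) ;;
       ifLt (var vE) (var vN1) skip (set vJ (var vE - var vN1) ;; visitCmd))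
      skip))

/-- Transform array `a`. -/
def dftCmd (a : ℕ) : Cmd :=
  set vSt (lit 1) ;;
  loop vT vDim (
    loop vX vDD (
      set vDg (var vX / var vSt % lit 32) ;;
      set vAcc (lit 0) ;;
      loop vU v32 (set vAcc ((var vAcc +
        get a (var vX - var vDg * var vSt + var vU * var vSt) *
          get aW (var vU * var vDg % lit 32)) % var vMod)) ;;
      put aT (var vX) (var vAcc)) ;;
    loop vX vDD (put a (var vX) (get aT (var vX))) ;;
    set vSt (var vSt * lit 32))

/-- The indicator arrays of the elements in bucket `vQ` of keys and bucket `vPb` of skewed keys,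
and of the elements in higher buckets of skewed keys. -/
def indicatorCmd : Cmd :=
  loop vX vDD (put aA (var vX) (lit 0) ;; put aB (var vX) (lit 0)) ;;
  loop vI vN1 (
    ifLt (get aBucZ (var vOU + var vI)) (var vQ) skip (
    ifLt (var vQ) (get aBucZ (var vOU + var vI)) skip (
    ifLt (get aBucX (var vOU + var vI)) (var vPb) skip (
    ifLt (var vPb) (get aBucX (var vOU + var vI)) skip (
      put aA (get aPsi (var vI)) (lit 1))))) ;;
    ifLt (var vPb) (get aBucX (var vOV + var vI)) (put aB (get aPsi (var vI)) (lit 1)) skip)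

/-- Convolve the indicator arrays and record the sums that occur. -/
def hitCmd : Cmd :=
  dftCmd aA ;; dftCmd aB ;;
  loop vX vDD (put aA (var vX) (get aA (var vX) * get aB (var vX) % var vMod)) ;;
  dftCmd aA ;;
  loop vX vDD (ifLt (lit 0) (get aA (var vX))
    (put aBest (get aPhin (var vX)) (var vQ + lit 1)) skip)

/-- Find the best bucket for each sum. -/
def bestCmd : Cmd :=
  loop vK vK2 (put aBest (var vK) (lit 0)) ;;
  loop vQ vNB (loop vPb vNB (indicatorCmd ;; hitCmd))

/-- Try all pairs with the first element in the best bucket. -/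
def searchCmd : Cmd :=
  loop vX vK2 (ifLt (lit 0) (get aBest (var vX))
    (loop vR vSz (
      set vRk ((get aBest (var vX) - lit 1) * var vSz + var vR) ;;
      ifLt (var vRk) (var vEl)
        (set vE (get aOrdZ (var vRk)) ;;
         ifLt (var vE) (var vOU) skip (
         ifLt (var vE) (var vOU + var vN1)
          (set vI (var vE - var vOU) ;;
           ifLt (var vX) (var vI) skip (
             set vJ (var vX - var vI) ;; ifLt (var vJ) (var vN1) visitCmd skip))
          skip))
        skip)) skip)

/-- The elements `i` of one side against the elements `j` of the other side. -/
def sideCmd : Cmd := bestCmd ;; searchCmd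

/-- Copy the result to the output. -/
def outCmd : Cmd := loop vK vK2 (put aRaw (var vK) (get aC (var vK)))

/-- The main part of the program. -/
def mainCmd : Cmd :=
  keysCmd ;; tablesCmd ;; sortCmd aZ aOrdZ aBucZ ;; sortCmd aX aOrdX aBucX ;;
  set vOU (lit 0) ;; set vOV (var vN1) ;; set vFU (lit 0) ;; set vFV (lit 1) ;;
  sameCmd ;; sideCmd ;;
  set vOU (var vN1) ;; set vOV (lit 0) ;; set vFU (lit 1) ;; set vFV (lit 0) ;;
  sideCmd ;; outCmd

attribute [simp] Expr.val Expr.Ok Op.ideal Op.Safe State.set_var State.put_arr tri_skip tri_set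
  tri_put tri_seq tri_ifLt val_add val_sub val_mul val_div val_mod ok_add ok_sub ok_mul ok_div
  ok_mod

/-! ### Sorting -/

section Sorting

variable {W off : ℕ}

theorem addrOk_of_pos {a i : ℕ} (ha : 0 < a) (ha' : a < 32) (h : off + 32 * i + 32 < W) :
    AddrOk W off a i := by
  unfold AddrOk; rw [if_neg (by omega)]; omega

/-- The running maximum starts at 0 and is replaced only by strictly larger entries, so the recorded
position is meaningful only when the maximum is positive; hence the alternative in the conclusion.
-/
theorem tri_scan {a len : ℕ} (s : State) (ha : 0 < a) (ha' : a < 32) (h1 : len ≠ vBv)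
    (hW : off + 32 * (s.var vLo + s.var len) + 32 ≤ W) (h0 : 0 < W) :
    Tri W off (scanCmd a len) s fun t =>
      (∀ y < s.var len, s.arr a (s.var vLo + y) ≤ t.var vBv) ∧
      (t.var vBv = 0 ∨ ∃ y < s.var len, t.var vBe = s.var vLo + y ∧
        s.arr a (s.var vLo + y) = t.var vBv) := by
  unfold scanCmd
  rw [tri_seq, tri_set]
  refine ⟨h0, ?_⟩
  have hlen : (s.set vBv ((lit 0).val s)).var len = s.var len := by simp [h1]
  refine Tri.loop (fun i t => (∀ y < i, s.arr a (s.var vLo + y) ≤ t.var vBv) ∧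
      (t.var vBv = 0 ∨ ∃ y < i, t.var vBe = s.var vLo + y ∧
        s.arr a (s.var vLo + y) = t.var vBv)) ⟨by simp, by simp⟩ ?_ ?_
  · intro i hi t hS ⟨hu, hv⟩
    rw [hlen] at hi
    have e1 : t.var vLo = s.var vLo := by
      rw [hS.var _ (by simp [Cmd.wv])]; simp
    have e2 : t.arr a = s.arr a := by rw [hS.arr _ (by simp [Cmd.wa])]; rfl
    have hok : AddrOk W off a (s.var vLo + i) := addrOk_of_pos ha ha' (by omega)
    have hok' : s.var vLo + i < W := by omega
    rw [tri_ifLt]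
    refine ⟨by simp [e1, hok, hok'], ?_⟩
    split_ifs with hc
    · simp [e1, e2, hok, hok'] at hc ⊢
      intro y hy
      rcases Nat.lt_or_eq_of_le hy with h | rfl
      · exact (hu y h).trans hc.le
      · exact le_rfl
    · simp [e1, e2] at hc ⊢
      refine ⟨?_, ?_⟩
      · intro y hy
        rcases Nat.lt_or_eq_of_le hy with h | rfl
        · exact hu y h
        · omega
      · rcases hv with h | ⟨y, hy, h⟩
        · exact .inl h
        · exact .inr ⟨y, by omega, h⟩
  · intro t _ h
    rwa [hlen] at h

/-- The elements are in the order `ord`, with their positions divided by `S` in `buc`. -/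
structure IsSorted (m S : ℕ) (key ord buc : ℕ → ℕ) : Prop where
  ord_lt : ∀ r < m, ord r < m
  surj : ∀ e < m, ∃ r < m, ord r = e ∧ buc e = r / S
  mono : ∀ e < m, ∀ e' < m, key e < key e' → buc e ≤ buc e'

/-- The block maxima. -/
def IsMax (NB S : ℕ) (K mx : ℕ → ℕ) : Prop :=
  ∀ b < NB, (∀ y < S, K (b * S + y) ≤ mx b) ∧ (mx b = 0 ∨ ∃ y < S, K (b * S + y) = mx b)

/-- The `r` largest elements have been extracted, the others remain in `K`. -/
structure SortInv (m S r : ℕ) (key K ord buc : ℕ → ℕ) : Prop where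
  rem : ∀ e < m, K e = 0 ∨ K e = key e + 1
  out : ∀ e, m ≤ e → K e = 0
  ext : ∀ q, m - r ≤ q → q < m → ord q < m ∧ K (ord q) = 0 ∧ buc (ord q) = q / S
  inj : ∀ q, m - r ≤ q → q < m → ∀ q', m - r ≤ q' → q' < m → ord q = ord q' → q = q'
  surj : ∀ e < m, K e = 0 → ∃ q, m - r ≤ q ∧ q < m ∧ ord q = e
  le : ∀ e < m, ∀ e' < m, K e' = 0 → K e ≠ 0 → key e ≤ key e'
  mono : ∀ e < m, ∀ e' < m, K e = 0 → K e' = 0 → key e < key e' → buc e ≤ buc e'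

/-- Otherwise all `m` elements would appear among the `r < m` occupied ranks. -/
theorem SortInv.exists_pos {m S r : ℕ} {key K ord buc : ℕ → ℕ}
    (h : SortInv m S r key K ord buc) (hr : r < m) : ∃ e < m, K e ≠ 0 := by
  by_contra! hc
  have : (Finset.range m).card ≤ (Finset.Ico (m - r) m).card := by
    refine Finset.card_le_card_of_surjOn ord fun e he => ?_
    have he : e < m := by simpa using he
    obtain ⟨q, h1, h2, h3⟩ := h.surj e he (hc e he)
    exact ⟨q, by simp; omega, h3⟩
  simp at this
  omega

/-- A remaining element, together with the `m` distinct extracted ones, would give `m + 1` numbers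
below `m`. -/
theorem SortInv.isSorted {m S : ℕ} {key K ord buc : ℕ → ℕ}
    (h : SortInv m S m key K ord buc) : IsSorted m S key ord buc := by
  have h0 : ∀ e < m, K e = 0 := by
    by_contra! hc
    obtain ⟨e, he, hk⟩ := hc
    have : (insert e ((Finset.range m).image ord)).card ≤ (Finset.range m).card := by
      refine Finset.card_le_card fun x hx => ?_
      simp only [Finset.mem_insert, Finset.mem_image, Finset.mem_range] at hx ⊢
      rcases hx with rfl | ⟨q, hq, rfl⟩
      · exact he
      · exact (h.ext q (by omega) hq).1
    rw [Finset.card_insert_of_notMem, Finset.card_image_of_injOn] at this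
    · omega
    · intro q hq q' hq' hqq
      simp only [Finset.coe_range, Set.mem_Iio] at hq hq'
      exact h.inj q (by omega) hq q' (by omega) hq' hqq
    · simp only [Finset.mem_image, Finset.mem_range, not_exists, not_and]
      rintro q hq rfl
      exact hk (h.ext q (by omega) hq).2.1
  refine ⟨fun q hq => (h.ext q (by omega) hq).1, fun e he => ?_,
    fun e he e' he' => h.mono e he e' he' (h0 e he) (h0 e' he')⟩
  obtain ⟨q, h1, h2, h3⟩ := h.surj e he (h0 e he)
  exact ⟨q, h2, h3, h3 ▸ (h.ext q h1 h2).2.2⟩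

/-- Ranks are filled from the top: the largest remaining element takes the highest free rank, below
all ranks already given away. -/
theorem SortInv.step {m S r e : ℕ} {key K ord buc : ℕ → ℕ}
    (h : SortInv m S r key K ord buc) (hr : r < m) (he : e < m) (hK : K e ≠ 0)
    (hmax : ∀ e' < m, K e' ≤ K e) :
    SortInv m S (r + 1) key (Function.update K e 0) (Function.update ord (m - (r + 1)) e)
      (Function.update buc e ((m - (r + 1)) / S)) := by
  have hne : ∀ q, m - r ≤ q → q < m → ord q ≠ e := fun q h1 h2 h3 =>
    hK (h3 ▸ (h.ext q h1 h2).2.1)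
  have hkey : ∀ e' < m, K e' ≠ 0 → key e' ≤ key e := fun e' he' hk => by
    have := hmax e' he'
    have h1 := h.rem e he
    have h2 := h.rem e' he'
    omega
  refine ⟨fun x hx => ?_, fun x hx => ?_, fun q h1 h2 => ?_, fun q h1 h2 q' h1' h2' hq => ?_,
    fun x hx hk => ?_, fun x hx y hy hy0 hx0 => ?_, fun x hx y hy hx0 hy0 hxy => ?_⟩
  · rw [Function.update_apply]
    split_ifs
    · exact .inl rfl
    · exact h.rem x hx
  · rw [Function.update_apply, if_neg (by omega), h.out x hx]
  · by_cases hq : q = m - (r + 1)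
    · subst hq; simp [he]
    · have hq' := hne q (by omega) h2
      simpa [Function.update_apply, hq, hq'] using h.ext q (by omega) h2
  · by_cases hq1 : q = m - (r + 1)
    · by_cases hq2 : q' = m - (r + 1)
      · rw [hq1, hq2]
      · have := hne q' (by omega) h2'
        simp [hq1, hq2] at hq
        exact absurd hq.symm this
    · by_cases hq2 : q' = m - (r + 1)
      · have := hne q (by omega) h2
        simp [hq1, hq2] at hq
        exact absurd hq this
      · simp only [Function.update_apply, hq1, hq2, if_false] at hq
        exact h.inj q (by omega) h2 q' (by omega) h2' hq
  · by_cases hxe : x = e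
    · exact ⟨m - (r + 1), le_rfl, by omega, by simp [hxe]⟩
    · rw [Function.update_apply, if_neg hxe] at hk
      obtain ⟨q, h1, h2, h3⟩ := h.surj x hx hk
      exact ⟨q, by omega, h2, by rw [Function.update_apply, if_neg (by omega), h3]⟩
  · rw [Function.update_apply] at hx0 hy0
    split_ifs at hx0 with hxe
    · exact absurd rfl hx0
    · split_ifs at hy0 with hye
      · exact hye ▸ hkey x hx hx0
      · exact h.le x hx y hy hy0 hx0
  · by_cases hxe : x = e
    · by_cases hye : y = e
      · rw [hxe, hye]
      · rw [Function.update_apply, if_neg hye] at hy0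
        obtain ⟨q, h1, h2, h3⟩ := h.surj y hy hy0
        have h4 := (h.ext q h1 h2).2.2
        rw [h3] at h4
        rw [hxe, Function.update_self, Function.update_apply, if_neg hye, h4]
        exact Nat.div_le_div_right (by omega)
    · rw [Function.update_apply, if_neg hxe] at hx0
      by_cases hye : y = e
      · subst hye
        -- An element extracted earlier has a key at least as large as that of the new one, so it
        -- cannot be the strictly smaller of the two.
        exact absurd (h.le y hy x hx hx0 hK) (by omega)
      · rw [Function.update_apply, if_neg hye] at hy0
        rw [Function.update_apply, if_neg hxe, Function.update_apply, if_neg hye]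
        exact h.mono x hx y hy hx0 hy0 hxy

theorem IsMax.exists_max {m NB S : ℕ} {K mx : ℕ → ℕ} (h : IsMax NB S K mx) (hm : m ≤ NB * S)
    {e : ℕ} (he : e < m) : e / S < NB ∧ K e ≤ mx (e / S) := by
  have hS : 0 < S := by
    rcases Nat.eq_zero_or_pos S with rfl | h
    · omega
    · exact h
  have h1 : e / S < NB := (Nat.div_lt_iff_lt_mul hS).2 (by omega)
  refine ⟨h1, ?_⟩
  have := (h _ h1).1 (e % S) (Nat.mod_lt _ hS)
  rwa [mul_comm, Nat.div_add_mod] at this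

theorem block_ne {S b b' y y' : ℕ} (hy : y < S) (hy' : y' < S) (h : b ≠ b') :
    b * S + y ≠ b' * S + y' := by
  intro hh
  apply h
  have hS : 0 < S := by omega
  have := congrArg (· / S) hh
  simpa [mul_comm _ S, Nat.mul_add_div hS, Nat.div_eq_of_lt, hy, hy'] using this

/-- Blocks are disjoint, so deleting one entry affects only the maximum of its own block. -/
theorem IsMax.step {NB S b y v : ℕ} {K mx : ℕ → ℕ} (h : IsMax NB S K mx) (hy : y < S)
    (h1 : ∀ z < S, Function.update K (b * S + y) 0 (b * S + z) ≤ v)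
    (h2 : v = 0 ∨ ∃ z < S, Function.update K (b * S + y) 0 (b * S + z) = v) :
    IsMax NB S (Function.update K (b * S + y) 0) (Function.update mx b v) := by
  intro b' hb'
  by_cases hbb : b' = b
  · subst hbb
    simpa using ⟨h1, h2⟩
  · have : ∀ z < S, Function.update K (b * S + y) 0 (b' * S + z) = K (b' * S + z) := fun z hz =>
      by rw [Function.update_apply, if_neg (block_ne hz hy hbb)]
    rw [Function.update_apply, if_neg hbb]
    refine ⟨fun z hz => by rw [this z hz]; exact (h b' hb').1 z hz, ?_⟩
    rcases (h b' hb').2 with h | ⟨z, hz, h⟩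
    · exact .inl h
    · exact .inr ⟨z, hz, by rw [this z hz, h]⟩

/-- The arrays of `sortCmd` are distinct. -/
structure ArrOk (key ord buc : ℕ) : Prop where
  key_ok : key ≠ aK ∧ key ≠ aMx ∧ 0 < key ∧ key < 32
  ord_ok : ord ≠ aK ∧ ord ≠ aMx ∧ 0 < ord ∧ ord < 32
  buc_ok : buc ≠ aK ∧ buc ≠ aMx ∧ 0 < buc ∧ buc < 32
  ne : key ≠ ord ∧ key ≠ buc ∧ ord ≠ buc

theorem tri_sortInit {key ord buc m NB S B : ℕ} (s : State) (ha : ArrOk key ord buc)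
    (hm : s.var vEl = m) (hNB : s.var vNB = NB) (hS : s.var vSz = S)
    (hB : m ≤ NB * S) (hW : off + 32 * (NB * S + NB) + 64 + B ≤ W)
    (hk : ∀ e < m, s.arr key e ≤ B) (hK : ∀ e, m ≤ e → s.arr aK e = 0) :
    Tri W off (sortInitCmd key) s fun t =>
      SortInv m S 0 (s.arr key) (t.arr aK) (t.arr ord) (t.arr buc) ∧
      IsMax NB S (t.arr aK) (t.arr aMx) := by
  obtain ⟨k1, k2, k3, k4⟩ := ha.key_ok
  unfold sortInitCmd
  refine Tri.seq (R := fun t => (∀ e < m, t.arr aK e = s.arr key e + 1) ∧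
    ∀ e, m ≤ e → t.arr aK e = 0) ?_ ?_
  · refine Tri.loop (fun i t => (∀ e < i, t.arr aK e = s.arr key e + 1) ∧
      ∀ e, m ≤ e → t.arr aK e = 0) ⟨by simp, hK⟩ ?_ (fun t _ h => by rwa [hm] at h)
    intro i hi t hS' ⟨h1, h2⟩
    rw [hm] at hi
    have e1 : t.arr key = s.arr key := hS'.arr _ (by simp [Cmd.wa, k1])
    have := hk i hi
    simp [addrOk_of_pos k3 k4 (show off + 32 * i + 32 < W by omega), e1,
      addrOk_of_pos (a := 3) (by simp) (by simp) (show off + 32 * i + 32 < W by omega)]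
    refine ⟨by omega, fun e he => ?_, fun e he => ?_⟩
    · rw [Function.update_apply]
      split_ifs with h
      · rw [h]
      · exact h1 e (by omega)
    · rw [Function.update_apply, if_neg (by omega), h2 e he]
  · intro u hu ⟨hu1, hu2⟩
    have v2 : u.var vNB = NB := by rw [hu.var _ (by simp [Cmd.wv]), hNB]
    have v3 : u.var vSz = S := by rw [hu.var _ (by simp [Cmd.wv]), hS]
    refine Tri.loop (fun i t => IsMax i S (u.arr aK) (t.arr aMx)) (fun b hb => by omega) ?_ ?_
    · intro i hi t hS' h
      rw [v2] at hi
      have w3 : t.var vSz = S := by rw [hS'.var _ (by decide), v3]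
      have w4 : t.arr aK = u.arr aK := hS'.arr _ (by decide)
      have hiS : i * S + S ≤ NB * S := by nlinarith
      have hS2 : S ≤ NB * S := by nlinarith
      rw [tri_seq, tri_set]
      refine ⟨by simp [w3]; omega, Tri.seq (tri_scan _ (by simp) (by simp) (by simp) ?_ (by omega))
        ?_⟩
      · simp [w3]; omega
      · intro v hv hvv
        simp [w3] at hvv
        have x1 : v.var vB = i := by rw [hv.var _ (by decide)]; simp
        have x2 : v.arr aMx = t.arr aMx := by rw [hv.arr _ (by decide)]; simp
        simp [x1, x2, addrOk_of_pos (a := 4) (by simp) (by simp)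
          (show off + 32 * i + 32 < W by omega)]
        rw [w4] at hvv
        intro b hb
        rw [Function.update_apply]
        split_ifs with hbi
        · subst hbi
          refine ⟨hvv.1, ?_⟩
          rcases hvv.2 with h | ⟨y, hy, -, h⟩
          · exact .inl h
          · exact .inr ⟨y, hy, h⟩
        · exact h b (by omega)
    · intro t ht h
      rw [v2] at h
      have w4 : t.arr aK = u.arr aK := ht.arr _ (by decide)
      rw [w4]
      refine ⟨⟨fun e he => .inr (hu1 e he), hu2, fun q h1 h2 => by omega,
        fun q h1 h2 => by omega, fun e he h => ?_, fun e he e' he' h => ?_,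
        fun e he e' he' h => ?_⟩, h⟩
      · rw [hu1 e he] at h; omega
      · rw [hu1 e' he'] at h; omega
      · rw [hu1 e he] at h; omega

/-- Three scans: the block maxima give the block, the block gives the element, and after its
deletion the same block is scanned again for its new maximum. -/
theorem tri_extract {k ord buc m NB S r : ℕ} {key : ℕ → ℕ} (s : State) (ha : ArrOk k ord buc)
    (hm : s.var vEl = m) (hNB : s.var vNB = NB) (hS : s.var vSz = S) (hr : s.var vR = r)
    (hrm : r < m) (hB : m ≤ NB * S) (hW : off + 32 * (NB * S + NB) + 64 ≤ W)
    (h : SortInv m S r key (s.arr aK) (s.arr ord) (s.arr buc))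
    (hx : IsMax NB S (s.arr aK) (s.arr aMx)) :
    Tri W off (extractCmd ord buc) s fun t =>
      SortInv m S (r + 1) key (t.arr aK) (t.arr ord) (t.arr buc) ∧
      IsMax NB S (t.arr aK) (t.arr aMx) := by
  obtain ⟨o1, o2, o3, o4⟩ := ha.ord_ok
  obtain ⟨b1, b2, b3, b4⟩ := ha.buc_ok
  have hob := ha.ne.2.2
  have hok : ∀ a i, 0 < a → a < 32 → i ≤ NB * S → AddrOk W off a i := fun a i h1 h2 h3 =>
    addrOk_of_pos h1 h2 (by omega)
  obtain ⟨e0, he0, hK0⟩ := h.exists_pos hrm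
  unfold extractCmd
  rw [tri_seq, tri_set]
  refine ⟨by simp; omega, Tri.seq (tri_scan _ (by simp) (by simp) (by simp) ?_ (by omega))
    fun s1 hs1 h1 => ?_⟩
  · simp [hNB]; omega
  simp [hNB] at h1
  have x1 : s1.arr = s.arr := by
    funext a; rw [hs1.arr a (by simp [scanCmd, Cmd.wa])]; simp
  have y1 : ∀ x, x ≠ vLo → x ≠ vBv → x ≠ vBe → x ≠ vY → s1.var x = s.var x := by
    intro x q1 q2 q3 q4
    rw [hs1.var x (by simp [scanCmd, Cmd.wv, q2, q3, q4])]; simp [q1]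
  obtain ⟨blk, hblk, hbe, hbv⟩ : ∃ b < NB, s1.var vBe = b ∧ s.arr aMx b = s1.var vBv := by
    rcases h1.2 with h | ⟨hy, h3⟩
    · have := hx.exists_max hB he0
      have := h1.1 _ this.1
      omega
    · exact ⟨_, hy, rfl, h3⟩
  have hmx : ∀ e < m, s.arr aK e ≤ s.arr aMx blk := fun e he => by
    have h2 := hx.exists_max hB he
    have := h1.1 _ h2.1
    omega
  have hbS : blk * S + S ≤ NB * S := by nlinarith
  have hSB : S ≤ NB * S := by nlinarith
  rw [tri_seq, tri_set]
  refine ⟨trivial, ?_⟩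
  rw [tri_seq, tri_set]
  have z1 : s1.var vSz = S := by rw [y1 _ (by simp) (by simp) (by simp) (by simp), hS]
  refine ⟨by simp [hbe, z1]; omega, Tri.seq (tri_scan _ (by simp) (by simp) (by simp) ?_ (by omega))
    fun s2 hs2 h2 => ?_⟩
  · simp [hbe, z1]; omega
  simp [hbe, z1, x1] at h2
  have x2 : s2.arr = s.arr := by
    funext a; rw [hs2.arr a (by simp [scanCmd, Cmd.wa])]; simp [x1]
  have y2 : ∀ x, x ≠ vLo → x ≠ vBv → x ≠ vBe → x ≠ vY → x ≠ vBlk → s2.var x = s.var x := by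
    intro x q1 q2 q3 q4 q5
    rw [hs2.var x (by simp [scanCmd, Cmd.wv, q2, q3, q4])]; simp [q1, q5]; exact y1 x q1 q2 q3 q4
  have u1 : s2.var vBlk = blk := by rw [hs2.var _ (by decide)]; simp [hbe]
  have u2 : s2.var vLo = blk * S := by rw [hs2.var _ (by decide)]; simp [hbe, z1]
  -- Stored keys are increased by one, so 0 means "deleted"; since an element remains, the overall
  -- maximum is positive and the scans return genuine positions.
  have hpos : s.arr aMx blk ≠ 0 := by have := hmx e0 he0; omega
  obtain ⟨y, hy, he, hKe⟩ : ∃ y < S, s2.var vBe = blk * S + y ∧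
      s.arr aK (blk * S + y) = s.arr aMx blk := by
    have h3 := hx _ hblk
    rcases h3.2 with h4 | ⟨z, hz, h4⟩
    · exact absurd h4 hpos
    · have h5 := h2.1 z hz
      rcases h2.2 with h6 | ⟨y, hy, h6, h7⟩
      · omega
      · have := h3.1 y hy
        exact ⟨y, hy, h6, by omega⟩
  set e := blk * S + y with hedef
  -- The last blocks may reach beyond the `m` elements; entries there are 0 and cannot be the
  -- positive maximum.
  have hem : e < m := by
    by_contra hc
    have := h.out e (by omega)
    omega
  rw [tri_seq, tri_set]
  refine ⟨trivial, ?_⟩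
  rw [tri_seq, tri_put]
  refine ⟨by simp [he]; exact ⟨by omega, hok _ _ (by simp) (by simp) (by omega)⟩,
    Tri.seq (tri_scan _ (by simp) (by simp) (by simp) ?_ (by omega)) fun s3 hs3 h3 => ?_⟩
  · simp [u2, y2, hS]; omega
  simp [u2, y2, hS, he, x2] at h3
  have x3 : ∀ a, s3.arr a = if a = aK then Function.update (s.arr aK) e 0 else s.arr a := by
    intro a; rw [hs3.arr a (by simp [scanCmd, Cmd.wa])]; simp [x2, he]
  have y3 : ∀ x, x ≠ vLo → x ≠ vBv → x ≠ vBe → x ≠ vY → x ≠ vBlk → x ≠ vE →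
      s3.var x = s.var x := by
    intro x q1 q2 q3 q4 q5 q6
    rw [hs3.var x (by simp [scanCmd, Cmd.wv, q2, q3, q4])]; simp [q6]; exact y2 x q1 q2 q3 q4 q5
  have u3 : s3.var vBlk = blk := by rw [hs3.var _ (by decide)]; simp [u1]
  have u4 : s3.var vE = e := by rw [hs3.var _ (by decide)]; simp [he]
  have step1 := h.step hrm hem (by omega) (fun e' he' => hKe ▸ hmx e' he')
  have step2 := hx.step (b := blk) (v := s3.var vBv) hy h3.1
    (h3.2.imp_right fun ⟨z, hz, _, h⟩ => ⟨z, hz, h⟩)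
  have t1 := hok aMx blk (by simp) (by simp) (by nlinarith)
  have t2 := hok ord (m - (r + 1)) o3 o4 (by omega)
  have t3 := hok buc e b3 b4 (by omega)
  have ob := hob.symm
  simp [u3, u4, y3, hm, hr, hS, x3, t1, t2, t3, o1, o2, b1, b2, hob, ob, o1.symm, o2.symm,
    b1.symm, b2.symm]
  exact ⟨⟨by omega, by omega⟩, step1, step2⟩

/-- The zero tail of `aK` is returned as well as assumed, so that the second sort can reuse the
array. -/
theorem tri_sort {key ord buc m NB S B : ℕ} (s : State) (ha : ArrOk key ord buc)
    (hm : s.var vEl = m) (hNB : s.var vNB = NB) (hS : s.var vSz = S)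
    (hB : m ≤ NB * S) (hW : off + 32 * (NB * S + NB) + 64 + B ≤ W)
    (hk : ∀ e < m, s.arr key e ≤ B) (hK : ∀ e, m ≤ e → s.arr aK e = 0) :
    Tri W off (sortCmd key ord buc) s fun t =>
      IsSorted m S (s.arr key) (t.arr ord) (t.arr buc) ∧ ∀ e, m ≤ e → t.arr aK e = 0 := by
  refine Tri.seq (tri_sortInit s ha hm hNB hS hB hW hk hK) fun u hu ⟨h1, h2⟩ => ?_
  have v1 : u.var vEl = m := by rw [hu.var _ (by simp [sortInitCmd, scanCmd, Cmd.wv]), hm]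
  have v2 : u.var vNB = NB := by rw [hu.var _ (by simp [sortInitCmd, scanCmd, Cmd.wv]), hNB]
  have v3 : u.var vSz = S := by rw [hu.var _ (by simp [sortInitCmd, scanCmd, Cmd.wv]), hS]
  refine Tri.loop (fun r t => SortInv m S r (s.arr key) (t.arr aK) (t.arr ord) (t.arr buc) ∧
      IsMax NB S (t.arr aK) (t.arr aMx)) ⟨h1, h2⟩ ?_ ?_
  · intro r hr t ht ⟨h3, h4⟩
    rw [v1] at hr
    have hv : ∀ x, x ∉ (Cmd.loop vR vEl (extractCmd 0 0)).wv → t.var x = u.var x :=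
      fun x hx => ht.var x hx
    have w1 := hv vEl (by decide)
    have w2 := hv vNB (by decide)
    have w3 := hv vSz (by decide)
    exact tri_extract (t.set vR r) ha (by simp [w1, v1]) (by simp [w2, v2]) (by simp [w3, v3])
      (by simp) hr hB (by omega) (by simpa using h3) (by simpa using h4)
  · rw [v1]
    intro t _ h
    exact ⟨h.1.isSorted, h.1.out⟩

end Sorting

end SkewConv

namespace SkewConv

open WordRAM WordRAM.Expr WordRAM.Cmd

/-! ### Parameters, keys and tables -/

/-- The modulus of the transform. -/
def modulus (d : ℕ) : ℕ := 2 ^ (16 * d) + 1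

/-- The variables that stay constant in the main part of the program. -/
structure Par (n d : ℕ) (s : State) : Prop where
  n1 : s.var vN1 = n + 1
  el : s.var vEl = 2 * n + 2
  dim : s.var vDim = d
  dd : s.var vDD = 32 ^ d
  sz : s.var vSz = 8 ^ d
  nb : s.var vNB = 2 * 2 ^ d
  p2 : s.var vP2 = 2 ^ d
  mo : s.var vMod = modulus d
  c32 : s.var v32 = 32
  k2 : s.var vK2 = 2 * n + 1

theorem Par.same {n d : ℕ} {s t : State} {c : Cmd} (h : Par n d s) (hc : Same c s t)
    (hw : ∀ x ∈ c.wv, 10 < x) : Par n d t := by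
  have : ∀ x ≤ 10, t.var x = s.var x := fun x hx => hc.var x fun h => by
    have := hw x h; omega
  constructor
  · rw [this _ (by norm_num), h.n1]
  · rw [this _ (by norm_num), h.el]
  · rw [this _ (by norm_num), h.dim]
  · rw [this _ (by norm_num), h.dd]
  · rw [this _ (by norm_num), h.sz]
  · rw [this _ (by norm_num), h.nb]
  · rw [this _ (by norm_num), h.p2]
  · rw [this _ (by norm_num), h.mo]
  · rw [this _ (by norm_num), h.c32]
  · rw [this _ (by norm_num), h.k2]

theorem Par.set {n d : ℕ} {s : State} (h : Par n d s) {x v : ℕ} (hx : 10 < x) :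
    Par n d (s.set x v) := by
  refine h.same (c := .set x (.lit v)) ?_ (by simpa [Cmd.wv] using hx)
  exact same_run (.set x (.lit v)) s

/-- The word length suffices for the computation. -/
structure Env (W off n d N : ℕ) : Prop where
  off_eq : off = 2 * n + 3
  le : n + 1 ≤ 16 ^ d
  small : 2000 * (32 ^ d + N + 1) ≤ W
  mod : modulus d * modulus d ≤ W

section

variable {W off n d N : ℕ}

theorem pow_facts (d : ℕ) : 8 ^ d * 2 ^ d = 16 ^ d ∧ 16 ^ d ≤ 32 ^ d ∧ 8 ^ d ≤ 16 ^ d ∧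
    2 ^ d ≤ 8 ^ d ∧ 0 < 2 ^ d := by
  refine ⟨by rw [← mul_pow]; norm_num, ?_, ?_, ?_, by positivity⟩ <;>
    exact Nat.pow_le_pow_left (by norm_num) d

theorem Env.facts (h : Env W off n d N) : off = 2 * n + 3 ∧ n + 1 ≤ 16 ^ d ∧ 16 ^ d ≤ 32 ^ d ∧
    2000 * (32 ^ d + N + 1) ≤ W ∧ 8 ^ d ≤ 16 ^ d ∧ 2 ^ d ≤ 8 ^ d ∧ 0 < 2 ^ d :=
  ⟨h.off_eq, h.le, (pow_facts d).2.1, h.small, (pow_facts d).2.2.1, (pow_facts d).2.2.2.1,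
    (pow_facts d).2.2.2.2⟩

/-- A generous uniform bound that covers every index used: transform positions below $32^d$, element
numbers, ranks and sums of order $16^d$. -/
theorem Env.addrOk (h : Env W off n d N) {a i : ℕ} (ha : 0 < a) (ha' : a < 32)
    (hi : i ≤ 10 * 32 ^ d + 32) : AddrOk W off a i := by
  have := h.facts
  exact addrOk_of_pos ha ha' (by omega)

theorem tri_read (h : Env W off n d N) (s : State) (hs : s.arr aRaw 0 = n) :
    Tri W off readCmd s fun t => t.var vN1 = n + 1 := by
  have := h.facts
  simp [readCmd, hs, AddrOk]
  omega

theorem tri_param (h : Env W off n d N) (hd : d = Nat.clog 16 (n + 1)) (s : State)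
    (hs : s.var vN1 = n + 1) :
    Tri W off paramCmd s fun t => Par n d t := by
  have hf := h.facts
  unfold paramCmd
  simp only [tri_seq, tri_set]
  refine ⟨by simp; omega, by simp; omega, by simp; omega, by simp; omega, by simp; omega, ?_⟩
  refine Tri.mono (Tri.loop (fun i t => t.var vDim = min i d ∧ t.var vP16 = 16 ^ min i d ∧
    t.var vP2 = 2 ^ min i d ∧ t.var vSz = 8 ^ min i d ∧ t.var vDD = 32 ^ min i d)
    (by simp) ?_ (Q := fun t => t.var vN1 = n + 1 ∧ t.var vDim = d ∧ t.var vP16 = 16 ^ d ∧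
    t.var vP2 = 2 ^ d ∧ t.var vSz = 8 ^ d ∧ t.var vDD = 32 ^ d) ?_) ?_
  · intro i hi t hS ⟨h1, h2, h3, h4, h5⟩
    have hn : t.var vN1 = n + 1 := by rw [hS.var _ (by decide)]; simp [hs]
    -- By the choice of `d` as a ceiling logarithm the test succeeds in exactly the first `d`
    -- rounds; afterwards all parameters stay fixed.
    have key : 16 ^ min i d < n + 1 ↔ i < d := by
      rw [hd, ← Nat.lt_clog_iff_pow_lt (by norm_num)]; omega
    by_cases hid : i < d
    · have e1 : min i d = i := by omega
      have e2 : min (i + 1) d = i + 1 := by omega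
      have p1 : 16 ^ i * 16 ≤ 16 ^ d := by
        rw [← pow_succ]; exact Nat.pow_le_pow_right (by norm_num) hid
      have p2 : 32 ^ i * 32 ≤ 32 ^ d := by
        rw [← pow_succ]; exact Nat.pow_le_pow_right (by norm_num) hid
      have p3 : 8 ^ i * 8 ≤ 8 ^ d := by
        rw [← pow_succ]; exact Nat.pow_le_pow_right (by norm_num) hid
      have p4 : 2 ^ i * 2 ≤ 2 ^ d := by
        rw [← pow_succ]; exact Nat.pow_le_pow_right (by norm_num) hid
      have p5 : i < 2 ^ i := Nat.lt_two_pow_self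
      rw [e1] at h1 h2 h3 h4 h5 key
      rw [e2]
      simp [hn, h1, h2, h3, h4, h5, key, hid, pow_succ]
      omega
    · have e1 : min i d = d := by omega
      have e2 : min (i + 1) d = d := by omega
      rw [e1] at h1 h2 h3 h4 h5 key
      rw [e2]
      simp [hn, h1, h2, h3, h4, h5, key, hid]
  · intro t hS ht
    have e : min (n + 1) d = d := by
      have : d ≤ n + 1 := by
        rw [hd, Nat.clog_le_iff_le_pow (by norm_num)]
        exact (Nat.lt_pow_self (by norm_num)).le
      omega
    simp [hs, e] at ht
    refine ⟨by rw [hS.var _ (by decide)]; simp [hs], ht⟩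
  · intro t _ ⟨h0, h1, h2, h3, h4, h5⟩
    have e1 : 16 ^ d * 16 ^ d * (16 ^ d * 16 ^ d) + 1 = modulus d := by
      rw [modulus, show (16 : ℕ) = 2 ^ 4 by norm_num, ← pow_mul, ← pow_add, ← pow_add]
      ring_nf
    have e2 : modulus d < W := by
      have := h.mod
      have : 1 < modulus d := by unfold modulus; have : 0 < 2 ^ (16 * d) := by positivity
                                 omega
      nlinarith
    have e3 : 16 ^ d * 16 ^ d ≤ 16 ^ d * 16 ^ d * (16 ^ d * 16 ^ d) :=
      Nat.le_mul_of_pos_right _ (by positivity)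
    simp [h0, h2, h3, e1]
    refine ⟨by omega, by omega, by omega, ⟨⟨by omega, by omega⟩, by omega⟩, by omega, ?_⟩
    constructor <;> simp [h0, h1, h3, h4, h5] <;> omega

theorem tri_keys (h : Env W off n d N) (s : State) (hp : Par n d s)
    (hs : ∀ e, s.arr aRaw e ≤ N) :
    Tri W off keysCmd s fun t => (∀ e < 2 * n + 2, t.arr aZ e = s.arr aRaw (e + 1)) ∧
      ∀ e < 2 * n + 2, t.arr aX e = s.arr aRaw (e + 1) + if e < n + 1 then n - e else e - 1 := by
  have hf := h.facts
  refine Tri.loop (fun i t => (∀ e < i, t.arr aZ e = s.arr aRaw (e + 1)) ∧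
      ∀ e < i, t.arr aX e = s.arr aRaw (e + 1) + if e < n + 1 then n - e else e - 1)
    (by simp) ?_ (by rw [hp.el]; exact fun t _ ht => ht)
  intro i hi t hS ⟨h1, h2⟩
  rw [hp.el] at hi
  have e1 : t.arr aRaw = s.arr aRaw := hS.arr _ (by decide)
  have e2 : t.var vN1 = n + 1 := (hp.same hS (by decide)).n1
  have a0 : AddrOk W off 0 (i + 1) := by unfold AddrOk; simp; omega
  have a1 := h.addrOk (a := 1) (i := i) (by norm_num) (by norm_num) (by omega)
  have a2 := h.addrOk (a := 2) (i := i) (by norm_num) (by norm_num) (by omega)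
  have hN := hs (i + 1)
  have upd : ∀ (f g : ℕ → ℕ) (v : ℕ), (∀ e < i, f e = g e) → v = g i →
      ∀ e < i + 1, Function.update f i v e = g e := by
    intro f g v hfg hv e he
    rw [Function.update_apply]
    split_ifs with hei
    · rw [hei, hv]
    · exact hfg e (by omega)
  by_cases hin : i < n + 1
  · simp only [tri_seq, tri_put, tri_ifLt]
    simp [e1, e2, hin, a0, a1, a2]
    refine ⟨by omega, by omega, ?_, ?_⟩
    · simpa using upd _ (fun e => s.arr aRaw (e + 1)) _ h1 rfl
    · simpa using upd _ _ _ h2 (by simp [hin])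
  · simp only [tri_seq, tri_put, tri_ifLt]
    simp [e1, e2, hin, a0, a1, a2]
    refine ⟨by omega, by omega, ?_, ?_⟩
    · simpa using upd _ (fun e => s.arr aRaw (e + 1)) _ h1 rfl
    · simpa using upd _ _ _ h2 (by simp [hin])

/-- The tables. -/
structure Tables (n d : ℕ) (s : State) : Prop where
  psi : ∀ i < n + 1, s.arr aPsi i = psi i
  phin : ∀ x < 32 ^ d, s.arr aPhin x = phin x
  root : ∀ u < 32, s.arr aW u = (2 ^ d) ^ u % modulus d

theorem Tables.same {n d : ℕ} {s t : State} {c : Cmd} (h : Tables n d s) (hc : Same c s t)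
    (hw : ∀ x ∈ c.wa, x < 9 ∨ 11 < x) : Tables n d t := by
  have : ∀ x, 9 ≤ x → x ≤ 11 → t.arr x = s.arr x := fun x hx hx' => hc.arr x fun h => by
    have := hw x h; omega
  constructor
  · rw [this _ (by norm_num) (by norm_num)]; exact h.psi
  · rw [this _ (by norm_num) (by norm_num)]; exact h.phin
  · rw [this _ (by norm_num) (by norm_num)]; exact h.root

theorem modulus_facts (d : ℕ) : 1 < modulus d ∧ 2 ^ d < modulus d := by
  have h1 : 0 < 2 ^ (16 * d) := by positivity
  have h2 : 2 ^ d ≤ 2 ^ (16 * d) := Nat.pow_le_pow_right (by norm_num) (by omega)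
  unfold modulus
  omega

theorem Env.mul_lt (h : Env W off n d N) {x y : ℕ} (hx : x < modulus d) (hy : y < modulus d) :
    x * y < W := by
  have := h.mod
  have := Nat.mul_lt_mul'' hx hy
  omega

theorem tri_tables (h : Env W off n d N) (s : State) (hp : Par n d s)
    (hs : s.arr aPsi 0 = 0) (hs' : s.arr aPhin 0 = 0) :
    Tri W off tablesCmd s fun t => Tables n d t := by
  have hf := h.facts
  have hm := modulus_facts d
  have hm' : modulus d ≤ W := by have := h.mod; nlinarith
  have hpsi : ∀ i < n + 1, psi i < 32 ^ d := fun i hi => psi_lt (by omega)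
  -- A crude bound, used only to exclude overflow while the table is filled.
  have hphin : ∀ x, phin x ≤ x + 31 * x := by
    intro x
    induction x using Nat.strong_induction_on with
    | _ x ih =>
      by_cases hx : x = 0
      · subst hx; simp [phin]
      · have := ih (x / 32) (by omega)
        rw [phin_eq]; omega
  unfold tablesCmd
  refine Tri.seq (Tri.loop (fun i t => t.arr aPsi 0 = 0 ∧ ∀ e < i, t.arr aPsi e = psi e)
    ⟨hs, by simp⟩ ?_ (Q := fun t => ∀ e < n + 1, t.arr aPsi e = psi e)
    (by rw [hp.n1]; exact fun t _ ht => ht.2)) ?_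
  · intro i hi t hS ⟨h1, h2⟩
    rw [hp.n1] at hi
    have e1 : t.arr aPsi (i / 16) = psi (i / 16) := by
      -- At `i = 0` the recursion reads the very entry being computed; this is why the invariant
      -- keeps the initial zero there.
      by_cases hi0 : i = 0
      · subst hi0; simpa [psi] using h1
      · exact h2 _ (by omega)
    have a1 := h.addrOk (a := 9) (i := i) (by norm_num) (by norm_num) (by omega)
    have a2 := h.addrOk (a := 9) (i := i / 16) (by norm_num) (by norm_num) (by omega)
    have q1 := hpsi i hi
    have q2 := psi_eq i
    simp [e1, a1, a2, ← q2]
    refine ⟨by omega, ?_, ?_⟩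
    · rw [Function.update_apply]; split_ifs with h0
      · rw [← h0]; simp [psi]
      · exact h1
    · intro e he
      rw [Function.update_apply]; split_ifs with h0
      · rw [h0]
      · exact h2 e (by omega)
  intro u hu hu1
  have hpu := hp.same hu (by decide)
  have hu' : u.arr aPhin 0 = 0 := by rw [hu.arr _ (by decide), hs']
  refine Tri.seq (Tri.loop (fun i t => t.arr aPhin 0 = 0 ∧ ∀ e < i, t.arr aPhin e = phin e)
    ⟨hu', by simp⟩ ?_ (Q := fun t => ∀ e < 32 ^ d, t.arr aPhin e = phin e)
    (by rw [hpu.dd]; exact fun t _ ht => ht.2)) ?_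
  · intro i hi t hS ⟨h1, h2⟩
    rw [hpu.dd] at hi
    have e1 : t.arr aPhin (i / 32) = phin (i / 32) := by
      by_cases hi0 : i = 0
      · subst hi0; simpa [phin] using h1
      · exact h2 _ (by omega)
    have a1 := h.addrOk (a := 10) (i := i) (by norm_num) (by norm_num) (by omega)
    have a2 := h.addrOk (a := 10) (i := i / 32) (by norm_num) (by norm_num) (by omega)
    have q1 := hphin i
    have q2 := phin_eq i
    simp [e1, a1, a2, ← q2]
    refine ⟨by omega, ?_, ?_⟩
    · rw [Function.update_apply]; split_ifs with h0
      · rw [← h0]; simp [phin]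
      · exact h1
    · intro e he
      rw [Function.update_apply]; split_ifs with h0
      · rw [h0]
      · exact h2 e (by omega)
  intro v hv hv1
  have hpv := hpu.same hv (by decide)
  have hv0 : v.arr aPsi = u.arr aPsi := hv.arr _ (by decide)
  rw [tri_seq, tri_set]
  refine ⟨by simp; omega, Tri.mono (Tri.loop (fun i t => (t.var vAcc = (2 ^ d) ^ i % modulus d) ∧
    ∀ e < i, t.arr aW e = (2 ^ d) ^ e % modulus d)
    (by simp [Nat.mod_eq_of_lt hm.1]) ?_ (Q := fun t => ∀ e < 32,
      t.arr aW e = (2 ^ d) ^ e % modulus d) ?_) ?_⟩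
  · intro i hi t hS ⟨h1, h2⟩
    simp [hpv.c32] at hi
    have hpt := (hpv.set (x := 16) (v := 1) (by norm_num)).same hS (by decide)
    have a1 := h.addrOk (a := 11) (i := i) (by norm_num) (by norm_num) (by omega)
    have q1 : (2 ^ d) ^ i % modulus d * 2 ^ d < W :=
      h.mul_lt (Nat.mod_lt _ (by omega)) hm.2
    simp [h1, a1, hpt.p2, hpt.mo, q1]
    refine ⟨by rw [pow_succ], ?_⟩
    intro e he
    rw [Function.update_apply]; split_ifs with h0
    · rw [h0]
    · exact h2 e (by omega)
  · simp [hpv.c32]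
  · intro t ht h3
    refine ⟨?_, ?_, h3⟩
    · rw [ht.arr _ (by decide)]
      simp [hv0]; exact fun i hi => hu1 i (by omega)
    · rw [ht.arr _ (by decide)]
      simpa using hv1

end

end SkewConv

namespace SkewConv

open WordRAM WordRAM.Expr WordRAM.Cmd

/-! ### Trying pairs -/

/-- The arrays that the search uses: the keys, and the orders and buckets of keys and skewed keys. -/
structure Data (Z oZ bZ oX bX : ℕ → ℕ) (s : State) : Prop where
  z : s.arr aZ = Z
  oz : s.arr aOrdZ = oZ
  bz : s.arr aBucZ = bZ
  ox : s.arr aOrdX = oX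
  bx : s.arr aBucX = bX

theorem Data.same {Z oZ bZ oX bX : ℕ → ℕ} {s t : State} {c : Cmd} (h : Data Z oZ bZ oX bX s)
    (hc : Same c s t) (hw : ∀ x ∈ c.wa, 8 < x) : Data Z oZ bZ oX bX t := by
  have : ∀ x ≤ 8, t.arr x = s.arr x := fun x hx => hc.arr x fun h => by
    have := hw x h; omega
  constructor
  · rw [this _ (by norm_num), h.z]
  · rw [this _ (by norm_num), h.oz]
  · rw [this _ (by norm_num), h.bz]
  · rw [this _ (by norm_num), h.ox]
  · rw [this _ (by norm_num), h.bx]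

theorem Data.set {Z oZ bZ oX bX : ℕ → ℕ} {s : State} (h : Data Z oZ bZ oX bX s) {x v : ℕ} :
    Data Z oZ bZ oX bX (s.set x v) :=
  ⟨h.z, h.oz, h.bz, h.ox, h.bx⟩

/-- The two sides start at the elements `oU` and `oV`, and the sum of the indices is added to the
keys of the sides whose flag is `1`. -/
structure Side (n oU oV fU fV : ℕ) (s : State) : Prop where
  ou : s.var vOU = oU
  ov : s.var vOV = oV
  fu : s.var vFU = fU
  fv : s.var vFV = fV
  ou_le : oU ≤ n + 1
  ov_le : oV ≤ n + 1
  fu_le : fU ≤ 1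
  fv_le : fV ≤ 1

theorem Side.same {n oU oV fU fV : ℕ} {s t : State} {c : Cmd} (h : Side n oU oV fU fV s)
    (hc : Same c s t) (hw : ∀ x ∈ c.wv, x < 25 ∨ 28 < x) : Side n oU oV fU fV t := by
  have : ∀ x, 25 ≤ x → x ≤ 28 → t.var x = s.var x := fun x hx hx' => hc.var x fun h => by
    have := hw x h; omega
  constructor
  · rw [this _ (by norm_num) (by norm_num), h.ou]
  · rw [this _ (by norm_num) (by norm_num), h.ov]
  · rw [this _ (by norm_num) (by norm_num), h.fu]
  · rw [this _ (by norm_num) (by norm_num), h.fv]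
  · exact h.ou_le
  · exact h.ov_le
  · exact h.fu_le
  · exact h.fv_le

theorem Side.set {n oU oV fU fV : ℕ} {s : State} (h : Side n oU oV fU fV s) {x v : ℕ}
    (hx : x < 25 ∨ 28 < x) : Side n oU oV fU fV (s.set x v) :=
  h.same (same_run (.set x (.lit v)) s) (by simpa [Cmd.wv] using hx)

/-- The value of the pair of element `i` of the first side and element `j` of the second side. -/
def pairVal (Z : ℕ → ℕ) (oU oV fU fV i j : ℕ) : ℕ :=
  min (Z (oU + i) + (i + j) * fU) (Z (oV + j) + (i + j) * fV)

/-- `C` grew from `C₀` and is still at most `R`. -/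
def Between (C₀ C R : ℕ → ℕ) : Prop := ∀ k, C₀ k ≤ C k ∧ C k ≤ R k

theorem Between.update {C₀ C R : ℕ → ℕ} (h : Between C₀ C R) {k v : ℕ} (hv : v ≤ R k) :
    Between C₀ (Function.update C k (max (C k) v)) R := by
  intro l
  have h1 := h l
  rw [Function.update_apply]
  split_ifs with hl
  · subst hl; omega
  · exact h1

theorem le_update_max (C : ℕ → ℕ) (k v l : ℕ) : C l ≤ Function.update C k (max (C k) v) l := by
  rw [Function.update_apply]
  split_ifs with hl
  · subst hl; omega
  · exact le_rfl

section

variable {W off n d N oU oV fU fV : ℕ} {Z oZ bZ oX bX : ℕ → ℕ}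

theorem tri_visit (h : Env W off n d N) (s : State) (hd : Data Z oZ bZ oX bX s)
    (hs : Side n oU oV fU fV s) (hZ : ∀ e < 2 * n + 2, Z e ≤ N) {i j : ℕ} (hi : s.var vI = i)
    (hj : s.var vJ = j) (hin : i ≤ n) (hjn : j ≤ n) :
    Tri W off visitCmd s fun t => t.arr aC =
      Function.update (s.arr aC) (i + j) (max (s.arr aC (i + j)) (pairVal Z oU oV fU fV i j)) := by
  have hf := h.facts
  have b1 := hs.ou_le
  have b2 := hs.ov_le
  have b3 : (i + j) * fU ≤ i + j := by
    simpa using Nat.mul_le_mul_left (i + j) hs.fu_le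
  have b4 : (i + j) * fV ≤ i + j := by
    simpa using Nat.mul_le_mul_left (i + j) hs.fv_le
  have z1 := hZ (oU + i) (by omega)
  have z2 := hZ (oV + j) (by omega)
  have a1 := h.addrOk (a := aZ) (i := oU + i) (by norm_num) (by norm_num) (by omega)
  have a2 := h.addrOk (a := aZ) (i := oV + j) (by norm_num) (by norm_num) (by omega)
  have a3 := h.addrOk (a := aC) (i := i + j) (by norm_num) (by norm_num) (by omega)
  unfold visitCmd pairVal
  simp only [tri_seq, tri_set, tri_ifLt, tri_skip, tri_put]
  by_cases c1 : Z (oV + j) + (i + j) * fV < Z (oU + i) + (i + j) * fU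
  · rw [min_eq_right c1.le]
    by_cases c2 : s.arr aC (i + j) < Z (oV + j) + (i + j) * fV
    · rw [max_eq_right c2.le]
      simp [hi, hj, hs.ou, hs.ov, hs.fu, hs.fv, hd.z, a1, a2, a3, c1, c2]
      omega
    · rw [max_eq_left (by omega)]
      simp [hi, hj, hs.ou, hs.ov, hs.fu, hs.fv, hd.z, a1, a2, a3, c1, c2]
      omega
  · rw [min_eq_left (by omega)]
    by_cases c2 : s.arr aC (i + j) < Z (oU + i) + (i + j) * fU
    · rw [max_eq_right c2.le]
      simp [hi, hj, hs.ou, hs.ov, hs.fu, hs.fv, hd.z, a1, a2, a3, c1, c2]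
      omega
    · rw [max_eq_left (by omega)]
      simp [hi, hj, hs.ou, hs.ov, hs.fu, hs.fv, hd.z, a1, a2, a3, c1, c2]
      omega

theorem IsSorted.buc_lt {m S NB : ℕ} {key ord buc : ℕ → ℕ} (h : IsSorted m S key ord buc)
    (hm : m ≤ NB * S) {e : ℕ} (he : e < m) : buc e < NB ∧ buc e * S < m := by
  obtain ⟨r, hr, -, h2⟩ := h.surj e he
  have hS : 0 < S := by
    rcases Nat.eq_zero_or_pos S with rfl | h
    · omega
    · exact h
  rw [h2]
  exact ⟨(Nat.div_lt_iff_lt_mul hS).2 (by omega), (Nat.div_mul_le_self _ _).trans_lt hr⟩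

theorem IsSorted.exists_pos {m S : ℕ} {key ord buc : ℕ → ℕ} (h : IsSorted m S key ord buc)
    (hS : 0 < S) {e : ℕ} (he : e < m) :
    ∃ r < S, buc e * S + r < m ∧ ord (buc e * S + r) = e := by
  obtain ⟨r, hr, h1, h2⟩ := h.surj e he
  have : buc e * S + r % S = r := by rw [h2, mul_comm]; exact Nat.div_add_mod _ _
  exact ⟨r % S, Nat.mod_lt _ hS, by rw [this]; exact hr, by rw [this, h1]⟩

/-- Contrapositive of `mono`. Equal keys may be split between buckets, so a strict inequality of
buckets gives only a weak one of keys. -/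
theorem IsSorted.key_le {m S : ℕ} {key ord buc : ℕ → ℕ} (h : IsSorted m S key ord buc)
    {e e' : ℕ} (he : e < m) (he' : e' < m) (hb : buc e < buc e') : key e ≤ key e' := by
  by_contra hc
  have := h.mono e' he' e he (by omega)
  omega

theorem block_count (h : n + 1 ≤ 16 ^ d) : 2 * n + 2 ≤ 2 * 2 ^ d * 8 ^ d := by
  have := (pow_facts d).1
  rw [mul_assoc, mul_comm (2 ^ d), this]; omega

/-- For each `i` the at most $8^d$ members of its skewed bucket are tried. `Between` records
soundness (nothing exceeds `R`) and monotonicity, so values found earlier are never lost. -/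
theorem tri_same (h : Env W off n d N) (s : State) (hp : Par n d s)
    (hd : Data Z oZ bZ oX bX s) {X R : ℕ → ℕ} (hX : IsSorted (2 * n + 2) (8 ^ d) X oX bX)
    (hs : Side n 0 (n + 1) fU fV s) (hZ : ∀ e < 2 * n + 2, Z e ≤ N)
    (hR : ∀ i ≤ n, ∀ j ≤ n, pairVal Z 0 (n + 1) fU fV i j ≤ R (i + j))
    (hC : ∀ k, s.arr aC k ≤ R k) :
    Tri W off sameCmd s fun t => Between (s.arr aC) (t.arr aC) R ∧
      ∀ i ≤ n, ∀ j ≤ n, bX i = bX (n + 1 + j) →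
        pairVal Z 0 (n + 1) fU fV i j ≤ t.arr aC (i + j) := by
  have hf := h.facts
  have hb := block_count h.le
  refine Tri.loop (fun a t => Between (s.arr aC) (t.arr aC) R ∧
      ∀ i < a, ∀ j ≤ n, bX i = bX (n + 1 + j) →
        pairVal Z 0 (n + 1) fU fV i j ≤ t.arr aC (i + j)) ⟨fun k => ⟨le_rfl, hC k⟩, by simp⟩ ?_
      (by rw [hp.n1]; exact fun t _ ht => ⟨ht.1, fun i hi => ht.2 i (by omega)⟩)
  intro i hi t hS ⟨h1, h2⟩
  rw [hp.n1] at hi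
  have hpt := (hp.same hS (by decide)).set (x := vI) (v := i) (by norm_num)
  refine Tri.loop (fun a u => Between (t.arr aC) (u.arr aC) R ∧
      ∀ r < a, bX i * 8 ^ d + r < 2 * n + 2 → ∀ j ≤ n, oX (bX i * 8 ^ d + r) = n + 1 + j →
        pairVal Z 0 (n + 1) fU fV i j ≤ u.arr aC (i + j))
        ⟨fun k => ⟨le_rfl, (h1 k).2⟩, by simp⟩ ?_ ?_
  · intro r hr u hSu ⟨h3, h4⟩
    rw [hpt.sz] at hr
    have hpu := hpt.same hSu (by decide)
    have hdu := ((hd.same hS (by decide)).set (x := vI) (v := i)).same hSu (by decide)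
    have hsu := ((hs.same hS (by decide)).set (x := vI) (v := i) (by norm_num)).same hSu (by decide)
    have hui : u.var vI = i := by rw [hSu.var _ (by decide)]; simp
    have q1 := hX.buc_lt hb (e := i) (by omega)
    have a1 := h.addrOk (a := aBucX) (i := i) (by norm_num) (by norm_num) (by omega)
    simp only [tri_seq, tri_set, tri_ifLt, tri_skip]
    have skip : ∀ u' : State, u'.arr = u.arr → (∀ j ≤ n, bX i * 8 ^ d + r < 2 * n + 2 →
        oX (bX i * 8 ^ d + r) = n + 1 + j → False) → Between (t.arr aC) (u'.arr aC) R ∧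
        ∀ q < r + 1, bX i * 8 ^ d + q < 2 * n + 2 → ∀ j ≤ n, oX (bX i * 8 ^ d + q) = n + 1 + j →
        pairVal Z 0 (n + 1) fU fV i j ≤ u'.arr aC (i + j) := by
      intro u' hu' hno
      rw [hu']
      refine ⟨h3, fun q hq hq' j hj hjj => ?_⟩
      by_cases hqr : q = r
      · subst hqr; exact (hno j hj hq' hjj).elim
      · exact h4 q (by omega) hq' j hj hjj
    refine ⟨by simp [hui, hdu.bx, hpu.sz, a1]; omega, by simp, ?_⟩
    by_cases c1 : bX i * 8 ^ d + r < 2 * n + 2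
    · have a2 := h.addrOk (a := aOrdX) (i := bX i * 8 ^ d + r) (by norm_num) (by norm_num)
        (by omega)
      have q2 := hX.ord_lt _ c1
      rw [if_pos (by simp [hui, hdu.bx, hpu.sz, hpu.el, c1])]
      refine ⟨by simp [hui, hdu.bx, hpu.sz, a2], by simp, ?_⟩
      by_cases c2 : oX (bX i * 8 ^ d + r) < n + 1
      · rw [if_pos (by simp [hui, hdu.bx, hdu.ox, hpu.sz, hpu.n1, c2])]
        exact skip _ (by simp) fun j hj _ hjj => by omega
      · rw [if_neg (by simp [hui, hdu.bx, hdu.ox, hpu.sz, hpu.n1]; omega)]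
        refine ⟨by simp [hui, hdu.bx, hdu.ox, hpu.sz, hpu.n1]; omega, ?_⟩
        refine (tri_visit h _ hdu.set.set.set.set (((hsu.set ?_).set ?_).set ?_ |>.set ?_)
          hZ (i := i) (j := oX (bX i * 8 ^ d + r) - (n + 1)) ?_ ?_ (by omega) (by omega)).mono ?_
        iterate 4 norm_num
        · simp [hui]
        · simp [hui, hdu.bx, hdu.ox, hpu.sz, hpu.n1]
        · intro v _ hv
          simp only [State.set_arr] at hv
          rw [hv]
          refine ⟨h3.update (hR i (by omega) _ (by omega)), fun q hq hq' j hj hjj => ?_⟩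
          by_cases hqr : q = r
          · subst hqr
            rw [hjj, Nat.add_sub_cancel_left, Function.update_self]
            exact le_max_right _ _
          · exact (h4 q (by omega) hq' j hj hjj).trans (le_update_max _ _ _ _)
    · rw [if_neg (by simp [hui, hdu.bx, hpu.sz, hpu.el]; omega)]
      exact skip _ (by simp) fun j hj h => absurd h c1
  · rw [hpt.sz]
    intro u _ ⟨h3, h4⟩
    refine ⟨fun k => ⟨(h1 k).1.trans (h3 k).1, (h3 k).2⟩, fun i' hi' j hj hij => ?_⟩
    by_cases hii : i' = i
    · subst hii
      obtain ⟨r, hr, hr1, hr2⟩ := hX.exists_pos (by positivity) (e := n + 1 + j) (by omega)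
      rw [← hij] at hr1 hr2
      exact h4 r hr hr1 j hj hr2
    · exact (h2 i' (by omega) j hj hij).trans (h3 _).1

/-- The result of `bestCmd`. -/
structure IsBest (n NB oU oV : ℕ) (bZ bX best : ℕ → ℕ) : Prop where
  le : ∀ k ≤ 2 * n, best k ≤ NB
  wit : ∀ k ≤ 2 * n, best k ≠ 0 → ∃ i ≤ n, ∃ j ≤ n, i + j = k ∧ bZ (oU + i) + 1 = best k ∧
    bX (oU + i) < bX (oV + j)
  ge : ∀ i ≤ n, ∀ j ≤ n, bX (oU + i) < bX (oV + j) → bZ (oU + i) + 1 ≤ best (i + j)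

/-- For each sum only one key bucket is scanned. Skewed buckets are not checked again, since the
value of any pair is an admissible lower bound. -/
theorem tri_search (h : Env W off n d N) (s : State) (hp : Par n d s)
    (hd : Data Z oZ bZ oX bX s) {X R : ℕ → ℕ} (hX : IsSorted (2 * n + 2) (8 ^ d) X oZ bZ)
    (hs : Side n oU oV fU fV s) (hZ : ∀ e < 2 * n + 2, Z e ≤ N)
    (hbest : ∀ k ≤ 2 * n, s.arr aBest k ≤ 2 * 2 ^ d)
    (hR : ∀ i ≤ n, ∀ j ≤ n, pairVal Z oU oV fU fV i j ≤ R (i + j))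
    (hC : ∀ k, s.arr aC k ≤ R k) :
    Tri W off searchCmd s fun t => Between (s.arr aC) (t.arr aC) R ∧
      ∀ i ≤ n, ∀ j ≤ n, bZ (oU + i) + 1 = s.arr aBest (i + j) →
        pairVal Z oU oV fU fV i j ≤ t.arr aC (i + j) := by
  have hf := h.facts
  have hb := block_count h.le
  have b1 := hs.ou_le
  have hpp := (pow_facts d).1
  refine Tri.loop (fun a t => Between (s.arr aC) (t.arr aC) R ∧
      ∀ i ≤ n, ∀ j ≤ n, i + j < a → bZ (oU + i) + 1 = s.arr aBest (i + j) →
        pairVal Z oU oV fU fV i j ≤ t.arr aC (i + j)) ⟨fun k => ⟨le_rfl, hC k⟩, by simp⟩ ?_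
      (by rw [hp.k2]; exact fun t _ ht => ⟨ht.1, fun i hi j hj => ht.2 i hi j hj (by omega)⟩)
  intro x hx t hS ⟨h1, h2⟩
  rw [hp.k2] at hx
  have hpt := (hp.same hS (by decide)).set (x := vX) (v := x) (by norm_num)
  have hbt : t.arr aBest = s.arr aBest := hS.arr _ (by decide)
  have a0 := h.addrOk (a := aBest) (i := x) (by norm_num) (by norm_num) (by omega)
  rw [tri_ifLt]
  refine ⟨by simp [a0]; omega, ?_⟩
  by_cases c0 : s.arr aBest x = 0
  · rw [if_neg (by simp [hbt, c0]), tri_skip]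
    refine ⟨h1, fun i hi j hj hij hbb => ?_⟩
    by_cases hix : i + j = x
    · rw [hix, c0] at hbb; omega
    · exact h2 i hi j hj (by omega) hbb
  rw [if_pos (by simp [hbt]; omega)]
  -- Bucket numbers are stored increased by one, 0 meaning that no pair was found.
  obtain ⟨b, hb0⟩ : ∃ b, s.arr aBest x = b + 1 := ⟨s.arr aBest x - 1, by omega⟩
  have hbNB : b < 2 * 2 ^ d := by have := hbest x (by omega); omega
  have hbS : b * 8 ^ d + 8 ^ d ≤ 2 * 16 ^ d := by
    rw [← hpp]; nlinarith [Nat.mul_le_mul_right (8 ^ d) hbNB]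
  refine Tri.loop (fun a u => Between (t.arr aC) (u.arr aC) R ∧
      ∀ r < a, b * 8 ^ d + r < 2 * n + 2 → ∀ i ≤ n, ∀ j ≤ n, i + j = x →
        oZ (b * 8 ^ d + r) = oU + i →
        pairVal Z oU oV fU fV i j ≤ u.arr aC (i + j))
        ⟨fun k => ⟨le_rfl, (h1 k).2⟩, by simp⟩ ?_ ?_
  · intro r hr u hSu ⟨h3, h4⟩
    rw [hpt.sz] at hr
    have hpu := hpt.same hSu (by decide)
    have hdu := ((hd.same hS (by decide)).set (x := vX) (v := x)).same hSu (by decide)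
    have hsu := ((hs.same hS (by decide)).set (x := vX) (v := x) (by norm_num)).same hSu (by decide)
    have hux : u.var vX = x := by rw [hSu.var _ (by decide)]; simp
    have hub : u.arr aBest x = b + 1 := by
      rw [hSu.arr _ (by decide)]; simp [hbt, hb0]
    simp only [tri_seq, tri_set, tri_ifLt, tri_skip]
    have skip : ∀ u' : State, u'.arr = u.arr → (∀ i ≤ n, ∀ j ≤ n, i + j = x →
        b * 8 ^ d + r < 2 * n + 2 →
        oZ (b * 8 ^ d + r) = oU + i → False) → Between (t.arr aC) (u'.arr aC) R ∧
        ∀ q < r + 1, b * 8 ^ d + q < 2 * n + 2 → ∀ i ≤ n, ∀ j ≤ n, i + j = x →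
        oZ (b * 8 ^ d + q) = oU + i →
        pairVal Z oU oV fU fV i j ≤ u'.arr aC (i + j) := by
      intro u' hu' hno
      rw [hu']
      refine ⟨h3, fun q hq hq' i hi j hj hij hjj => ?_⟩
      by_cases hqr : q = r
      · subst hqr; exact (hno i hi j hj hij hq' hjj).elim
      · exact h4 q (by omega) hq' i hi j hj hij hjj
    refine ⟨by simp [hux, hub, hpu.sz, a0]; omega, by simp, ?_⟩
    by_cases c1 : b * 8 ^ d + r < 2 * n + 2
    · have a2 := h.addrOk (a := aOrdZ) (i := b * 8 ^ d + r) (by norm_num) (by norm_num)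
        (by omega)
      have q2 := hX.ord_lt _ c1
      rw [if_pos (by simp [hux, hub, hpu.sz, hpu.el, c1])]
      refine ⟨by simp [hux, hub, hpu.sz, a2], by simp, ?_⟩
      by_cases c2 : oZ (b * 8 ^ d + r) < oU
      · rw [if_pos (by simp [hux, hub, hdu.oz, hpu.sz, hsu.ou, c2])]
        exact skip _ (by simp) fun i _ j hj _ _ hjj => by omega
      rw [if_neg (by simp [hux, hub, hdu.oz, hpu.sz, hsu.ou]; omega)]
      refine ⟨by simp [hpu.n1, hsu.ou]; omega, ?_⟩
      by_cases c3 : oZ (b * 8 ^ d + r) < oU + (n + 1)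
      swap
      · rw [if_neg (by simp [hux, hub, hdu.oz, hpu.sz, hpu.n1, hsu.ou]; omega)]
        exact skip _ (by simp) fun i _ j hj _ _ hjj => by omega
      rw [if_pos (by simp [hux, hub, hdu.oz, hpu.sz, hpu.n1, hsu.ou]; omega)]
      obtain ⟨i, hi⟩ : ∃ i, oZ (b * 8 ^ d + r) = oU + i := ⟨_, (Nat.add_sub_cancel' (by omega)).symm⟩
      refine ⟨by simp [hux, hub, hdu.oz, hpu.sz, hsu.ou, hi], by simp, ?_⟩
      by_cases c4 : x < i
      · rw [if_pos (by simp [hux, hub, hdu.oz, hpu.sz, hsu.ou, hi, c4])]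
        exact skip _ (by simp) fun i' _ j hj _ _ hjj => by omega
      rw [if_neg (by simp [hux, hub, hdu.oz, hpu.sz, hsu.ou, hi]; omega)]
      refine ⟨by simp [hux, hub, hdu.oz, hpu.sz, hsu.ou, hi]; omega, by simp, ?_⟩
      by_cases c5 : x - i < n + 1
      swap
      · rw [if_neg (by simp [hux, hub, hdu.oz, hpu.sz, hpu.n1, hsu.ou, hi]; omega)]
        exact skip _ (by simp) fun i' _ j hj _ _ hjj => by omega
      rw [if_pos (by simp [hux, hub, hdu.oz, hpu.sz, hpu.n1, hsu.ou, hi]; omega)]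
      refine (tri_visit h _ hdu.set.set.set.set.set ((((hsu.set ?_).set ?_).set ?_ |>.set ?_).set ?_)
          hZ (i := i) (j := x - i) ?_ ?_ (by omega) (by omega)).mono ?_
      iterate 5 norm_num
      · simp [hux, hub, hdu.oz, hpu.sz, hsu.ou, hi]
      · simp [hux, hub, hdu.oz, hpu.sz, hsu.ou, hi]
      · intro v _ hv
        simp only [State.set_arr] at hv
        rw [hv]
        refine ⟨h3.update (hR i (by omega) _ (by omega)), fun q hq hq' i' hi' j hj hij hjj => ?_⟩
        by_cases hqr : q = r
        · subst hqr
          obtain rfl : i' = i := by omega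
          obtain rfl : j = x - i' := by omega
          rw [Function.update_self]
          exact le_max_right _ _
        · exact (h4 q (by omega) hq' i' hi' j hj hij hjj).trans (le_update_max _ _ _ _)
    · rw [if_neg (by simp [hux, hub, hpu.sz, hpu.el]; omega)]
      exact skip _ (by simp) fun i _ j _ _ h => absurd h c1
  · rw [hpt.sz]
    intro u _ ⟨h3, h4⟩
    refine ⟨fun k => ⟨(h1 k).1.trans (h3 k).1, (h3 k).2⟩, fun i hi j hj hij hbb => ?_⟩
    by_cases hii : i + j = x
    · rw [hii, hb0] at hbb
      obtain ⟨r, hr, hr1, hr2⟩ := hX.exists_pos (by positivity) (e := oU + i) (by omega)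
      rw [show bZ (oU + i) = b by omega] at hr1 hr2
      exact h4 r hr hr1 i hi j hj hii hr2
    · exact (h2 i hi j hj (by omega) hbb).trans (h3 _).1

end

end SkewConv

namespace SkewConv

open WordRAM WordRAM.Expr WordRAM.Cmd

/-! ### The convolution -/

/-- The root of unity. -/
def root (d : ℕ) : ZMod (modulus d) := ((2 ^ d : ℕ) : ZMod (modulus d))

/-- Immediate from the form of the modulus: $(2^d)^{16}=2^{16d}\equiv-1$. -/
theorem root_pow (d : ℕ) : root d ^ 16 = -1 := by
  have h : ((2 ^ (16 * d) + 1 : ℕ) : ZMod (modulus d)) = 0 := ZMod.natCast_self (modulus d)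
  push_cast at h
  rw [root, eq_neg_iff_add_eq_zero]
  push_cast
  rw [← pow_mul, mul_comm d, h]

theorem Par.set_same {n d : ℕ} {s t : State} {c : Cmd} {x v : ℕ} (h : Par n d s)
    (hc : Same c (s.set x v) t) (hx : 10 < x) (hw : ∀ x ∈ c.wv, 10 < x) : Par n d t :=
  (h.set hx).same hc hw

theorem Tables.set {n d : ℕ} {s : State} (h : Tables n d s) {x v : ℕ} : Tables n d (s.set x v) :=
  ⟨h.psi, h.phin, h.root⟩

section

variable {W off n d N : ℕ}

/-- After `T` rounds the array holds the partial transform over the low `T` digits, by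
`partialDFT_succ`. Each round goes through the auxiliary array, because a new entry depends on 32
old ones. -/
theorem tri_dft {a : ℕ} (ha : a = aA ∨ a = aB) (h : Env W off n d N) (s : State)
    (hp : Par n d s) (ht : Tables n d s) (hs : ∀ x < 32 ^ d, s.arr a x < modulus d) :
    Tri W off (dftCmd a) s fun t => ∀ x < 32 ^ d, t.arr a x < modulus d ∧
      ((t.arr a x : ℕ) : ZMod (modulus d)) =
        ∑ y ∈ Finset.range (32 ^ d), ((s.arr a y : ℕ) : ZMod (modulus d)) *
          root d ^ ip d x y := by
  have hf := h.facts
  have hm := modulus_facts d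
  have ha1 : 0 < a := by omega
  have ha2 : a < 32 := by omega
  have ha3 : a ≠ aT := by omega
  have ha4 : aT ≠ a := by omega
  have ha5 : a ≠ aW := by omega
  set f : ℕ → ZMod (modulus d) := fun y => ((s.arr a y : ℕ) : ZMod (modulus d)) with hfdef
  unfold dftCmd
  rw [tri_seq, tri_set]
  refine ⟨by simp; omega, ?_⟩
  refine Tri.loop (fun T t => t.var vSt = 32 ^ T ∧ ∀ x < 32 ^ d, t.arr a x < modulus d ∧
      ((t.arr a x : ℕ) : ZMod (modulus d)) = partialDFT (root d) f T x) ?_ ?_ ?_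
  · refine ⟨by simp, fun x hx => ⟨hs x hx, ?_⟩⟩
    rw [partialDFT_zero]; rfl
  · intro T hT t hS ⟨h1, h2⟩
    have hpt := (hp.set_same hS (by norm_num) (by simp [Cmd.wv])).set (x := vT) (v := T)
      (by norm_num)
    have htt := (ht.set.same hS (by simp [Cmd.wa]; omega)).set (x := vT) (v := T)
    have hT : T < d := by simpa [hp.dim] using hT
    have hst : 32 ^ T * 32 ≤ 32 ^ d := by
      rw [← pow_succ]; exact Nat.pow_le_pow_right (by norm_num) hT
    refine Tri.seq (Tri.loop (fun i u => ∀ x < i, u.arr aT x < modulus d ∧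
      ((u.arr aT x : ℕ) : ZMod (modulus d)) = partialDFT (root d) f (T + 1) x) (by simp) ?_
      (Q := fun u => ∀ x < 32 ^ d, u.arr aT x < modulus d ∧
      ((u.arr aT x : ℕ) : ZMod (modulus d)) = partialDFT (root d) f (T + 1) x)
      (by rw [hpt.dd]; exact fun u _ hu => hu)) ?_
    · intro x hx u hSu hu
      rw [hpt.dd] at hx
      have hpu := hpt.same hSu (by simp [Cmd.wv])
      have htu := htt.same hSu (by simp [Cmd.wa])
      have ust : u.var vSt = 32 ^ T := by rw [hSu.var _ (by simp [Cmd.wv])]; simpa using h1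
      have uarr : u.arr a = t.arr a := by rw [hSu.arr _ (by simp [Cmd.wa, ha3])]; simp
      have hdg : x / 32 ^ T % 32 = dig T x := rfl
      have hdx := dig_mul_le T x
      have hdl := dig_lt T x
      rw [tri_seq, tri_set]
      refine ⟨by simp; omega, ?_⟩
      rw [tri_seq, tri_set]
      refine ⟨by simp; omega, ?_⟩
      refine Tri.seq (Tri.loop (fun i v => v.var vAcc < modulus d ∧
        ((v.var vAcc : ℕ) : ZMod (modulus d)) = ∑ z ∈ Finset.range i,
          partialDFT (root d) f T (x - dig T x * 32 ^ T + z * 32 ^ T) * root d ^ (z * dig T x))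
          ⟨by simp; omega, by simp⟩ ?_
          (Q := fun v => v.var vAcc < modulus d ∧
            ((v.var vAcc : ℕ) : ZMod (modulus d)) = partialDFT (root d) f (T + 1) x) ?_) ?_
      · intro i hi v hSv ⟨hv1, hv2⟩
        have hi : i < 32 := by simpa [hpu.c32] using hi
        have vx : v.var vX = x := by rw [hSv.var _ (by simp [Cmd.wv])]; simp
        have vdg : v.var vDg = dig T x := by rw [hSv.var _ (by simp [Cmd.wv])]; simp [ust, hdg]
        have vst : v.var vSt = 32 ^ T := by rw [hSv.var _ (by simp [Cmd.wv])]; simp [ust]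
        have vmo : v.var vMod = modulus d := by rw [hSv.var _ (by simp [Cmd.wv])]; simp [hpu.mo]
        have varr : v.arr a = t.arr a := by rw [hSv.arr _ (by simp [Cmd.wa])]; simp [uarr]
        have vW : v.arr aW = u.arr aW := by rw [hSv.arr _ (by simp [Cmd.wa])]; simp
        have hidx := sub_dig_lt hT hx hi
        have k1 := h.addrOk (a := a) ha1 ha2 (i := x - dig T x * 32 ^ T + i * 32 ^ T) (by omega)
        have k2 := h.addrOk (a := aW) (i := i * dig T x % 32) (by norm_num) (by norm_num)
          (by omega)
        have k3 := htu.root (i * dig T x % 32) (by omega)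
        have k4 : i * dig T x ≤ 31 * 31 := Nat.mul_le_mul (by omega) (by omega)
        have k5 : i * 32 ^ T ≤ 32 ^ T * 32 := by rw [mul_comm]; exact Nat.mul_le_mul_left _ hi.le
        have h3 := h2 _ hidx
        have k6 : (2 ^ d) ^ (i * dig T x % 32) % modulus d < modulus d := Nat.mod_lt _ (by omega)
        set r := (2 ^ d) ^ (i * dig T x % 32) % modulus d with hr
        set g := t.arr a (x - dig T x * 32 ^ T + i * 32 ^ T) with hg
        have k7 : g * r < W := h.mul_lt h3.1 k6
        -- With modulus $M+1$, the accumulator is at most $M$ and the product at most $M^2$, and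
        -- $M+M^2<(M+1)^2\le W$.
        have k8 : v.var vAcc + g * r < W := by
          have : g * r ≤ (modulus d - 1) * (modulus d - 1) :=
            Nat.mul_le_mul (by omega) (by omega)
          have := h.mod
          obtain ⟨M, hM⟩ : ∃ M, modulus d = M + 1 := ⟨modulus d - 1, by omega⟩
          rw [hM] at *
          nlinarith
        rw [tri_set]
        constructor
        · simp [vx, vdg, vst, varr, vW, k3, ← hg, k1, k2, k7, k8]
          omega
        · simp [vx, vdg, vst, varr, vW, k3, vmo, ← hg]
          refine ⟨Nat.mod_lt _ (by omega), ?_⟩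
          rw [hv2, h3.2, Finset.sum_range_succ]
          congr 2
          rw [hr, ZMod.natCast_mod, ← pow_mod_thirtyTwo (root_pow d) (i * dig T x), root]
          push_cast
          rfl
      · intro v _ hv
        rw [partialDFT_succ]
        simpa [hpu.c32] using hv
      · intro v hv ⟨hv1, hv2⟩
        have vx : v.var vX = x := by rw [hv.var _ (by simp [Cmd.wv])]; simp
        have k1 := h.addrOk (a := aT) (i := x) (by norm_num) (by norm_num) (by omega)
        have varr : v.arr aT = u.arr aT := by rw [hv.arr _ (by simp [Cmd.wa])]; simp
        rw [tri_put]
        refine ⟨by simp [vx, k1], fun y hy => ?_⟩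
        by_cases hyx : y = x
        · subst hyx
          simpa [vx] using ⟨hv1, hv2⟩
        · simpa [vx, Function.update_apply, hyx, varr] using hu y (by omega)
    · intro u hSu hu
      have hpu := hpt.same hSu (by simp [Cmd.wv])
      have ust : u.var vSt = 32 ^ T := by rw [hSu.var _ (by simp [Cmd.wv])]; simpa using h1
      refine Tri.seq (Tri.loop (fun i v => ∀ x < i, v.arr a x = u.arr aT x) (by simp) ?_
        (Q := fun v => ∀ x < 32 ^ d, v.arr a x = u.arr aT x)
        (by rw [hpu.dd]; exact fun u _ hu => hu)) ?_
      · intro i hi v hSv hv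
        rw [hpu.dd] at hi
        have k1 := h.addrOk (a := aT) (i := i) (by norm_num) (by norm_num) (by omega)
        have k2 := h.addrOk (a := a) (i := i) ha1 ha2 (by omega)
        have varr : v.arr aT = u.arr aT := hSv.arr _ (by simp [Cmd.wa, ha4])
        rw [tri_put]
        refine ⟨by simp [k1, k2], fun y hy => ?_⟩
        by_cases hyx : y = i
        · subst hyx
          simp [varr]
        · simpa [Function.update_apply, hyx] using hv y (by omega)
      · intro v hSv hv
        have vst : v.var vSt = 32 ^ T := by rw [hSv.var _ (by simp [Cmd.wv])]; exact ust
        rw [tri_set]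
        refine ⟨by simp [vst]; omega, by simp [vst, pow_succ], fun x hx => ?_⟩
        have := hu x hx
        rw [← hv x hx] at this
        exact this
  · intro t _ ⟨_, h2⟩
    have : (s.set vSt ((lit 1).val s)).var vDim = d := by simp [hp.dim]
    rw [this] at h2
    intro x hx
    refine ⟨(h2 x hx).1, ?_⟩
    rw [(h2 x hx).2, partialDFT_of_lt _ _ hx]

/-! ### Bucket indicators and the best bucket for each sum -/

variable {oU oV fU fV : ℕ} {Z oZ bZ oX bX : ℕ → ℕ}

/-- The language has only `<`, so each equality of buckets is tested by two comparisons with empty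
branches. -/
theorem tri_indicator (h : Env W off n d N) (s : State) (hp : Par n d s) (ht : Tables n d s)
    (hd : Data Z oZ bZ oX bX s) (hs : Side n oU oV fU fV s) {q p : ℕ}
    (hq : s.var vQ = q) (hpb : s.var vPb = p) :
    Tri W off indicatorCmd s fun t => ∀ x < 32 ^ d,
      t.arr aA x ≤ 1 ∧ t.arr aB x ≤ 1 ∧
      (0 < t.arr aA x ↔ ∃ i < n + 1, (bZ (oU + i) = q ∧ bX (oU + i) = p) ∧ psi i = x) ∧
      (0 < t.arr aB x ↔ ∃ i < n + 1, p < bX (oV + i) ∧ psi i = x) := by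
  have hf := h.facts
  have b1 := hs.ou_le
  have b2 := hs.ov_le
  refine Tri.seq (Tri.loop (fun i t => ∀ x < i, t.arr aA x = 0 ∧ t.arr aB x = 0) (by simp) ?_
    (Q := fun t => ∀ x < 32 ^ d, t.arr aA x = 0 ∧ t.arr aB x = 0)
    (by rw [hp.dd]; exact fun t _ ht => ht)) ?_
  · intro i hi t hS h1
    rw [hp.dd] at hi
    have k1 := h.addrOk (a := aA) (i := i) (by norm_num) (by norm_num) (by omega)
    have k2 := h.addrOk (a := aB) (i := i) (by norm_num) (by norm_num) (by omega)
    simp only [tri_seq, tri_put]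
    refine ⟨by simp [k1]; omega, by simp [k2]; omega, fun x hx => ?_⟩
    have := h1 x
    by_cases hxi : x = i
    · simp [hxi]
    · have := h1 x (by omega)
      simpa [Function.update_apply, hxi] using this
  · intro t hS h1
    have hpt := hp.same hS (by decide)
    refine Tri.loop (fun a t => ∀ x < 32 ^ d, t.arr aA x ≤ 1 ∧ t.arr aB x ≤ 1 ∧
      (0 < t.arr aA x ↔ ∃ i < a, (bZ (oU + i) = q ∧ bX (oU + i) = p) ∧ psi i = x) ∧
      (0 < t.arr aB x ↔ ∃ i < a, p < bX (oV + i) ∧ psi i = x)) (fun x hx => by simp [h1 x hx])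
      ?_ (by rw [hpt.n1]; exact fun t _ ht => ht)
    intro i hi u hSu hu
    rw [hpt.n1] at hi
    have hdu := (hd.same hS (by decide)).same hSu (by decide)
    have hsu := (hs.same hS (by decide)).same hSu (by decide)
    have htu := (ht.same hS (by decide)).same hSu (by decide)
    have huq : u.var vQ = q := by rw [hSu.var _ (by decide), hS.var _ (by decide), hq]
    have hup : u.var vPb = p := by rw [hSu.var _ (by decide), hS.var _ (by decide), hpb]
    have hpsi : psi i < 32 ^ d := psi_lt (by omega)
    have hpsi' := htu.psi i hi
    have k1 := h.addrOk (a := aBucZ) (i := oU + i) (by norm_num) (by norm_num) (by omega)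
    have k2 := h.addrOk (a := aBucX) (i := oU + i) (by norm_num) (by norm_num) (by omega)
    have k3 := h.addrOk (a := aBucX) (i := oV + i) (by norm_num) (by norm_num) (by omega)
    have k4 := h.addrOk (a := aPsi) (i := i) (by norm_num) (by norm_num) (by omega)
    have k5 := h.addrOk (a := aA) (i := psi i) (by norm_num) (by norm_num) (by omega)
    have k6 := h.addrOk (a := aB) (i := psi i) (by norm_num) (by norm_num) (by omega)
    have w1 : oU + i < W := by omega
    have w2 : oV + i < W := by omega
    have w3 : 1 < W := by omega
    rw [tri_seq]
    have first : Tri W off (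
        ifLt (get aBucZ (var vOU + var vI)) (var vQ) skip (
        ifLt (var vQ) (get aBucZ (var vOU + var vI)) skip (
        ifLt (get aBucX (var vOU + var vI)) (var vPb) skip (
        ifLt (var vPb) (get aBucX (var vOU + var vI)) skip (
          put aA (get aPsi (var vI)) (lit 1)))))) (u.set vI i) fun v =>
        v.arr aB = u.arr aB ∧ ∀ x < 32 ^ d, v.arr aA x ≤ 1 ∧ (0 < v.arr aA x ↔
          ∃ j < i + 1, (bZ (oU + j) = q ∧ bX (oU + j) = p) ∧ psi j = x) := by
      have no : ¬ (bZ (oU + i) = q ∧ bX (oU + i) = p) →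
          (u.set vI i).arr aB = u.arr aB ∧ ∀ x < 32 ^ d, (u.set vI i).arr aA x ≤ 1 ∧
          (0 < (u.set vI i).arr aA x ↔
          ∃ j < i + 1, (bZ (oU + j) = q ∧ bX (oU + j) = p) ∧ psi j = x) := by
        refine fun hno => ⟨rfl, fun x hx => ⟨(hu x hx).1, ?_⟩⟩
        rw [State.set_arr, (hu x hx).2.2.1]
        constructor
        · rintro ⟨j, hj, hh⟩; exact ⟨j, by omega, hh⟩
        · rintro ⟨j, hj, hh, hx⟩
          refine ⟨j, lt_of_le_of_ne (by omega) ?_, hh, hx⟩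
          rintro rfl; exact hno hh
      rw [tri_ifLt]
      refine ⟨by simp [hsu.ou, k1, w1], ?_⟩
      by_cases c1 : bZ (oU + i) < q
      · rw [if_pos (by simpa [hsu.ou, hdu.bz, huq] using c1)]
        exact tri_skip.2 (no (by omega))
      rw [if_neg (by simpa [hsu.ou, hdu.bz, huq] using c1), tri_ifLt]
      refine ⟨by simp [hsu.ou, k1, w1], ?_⟩
      by_cases c2 : q < bZ (oU + i)
      · rw [if_pos (by simpa [hsu.ou, hdu.bz, huq] using c2)]
        exact tri_skip.2 (no (by omega))
      rw [if_neg (by simpa [hsu.ou, hdu.bz, huq] using c2), tri_ifLt]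
      refine ⟨by simp [hsu.ou, k2, w1], ?_⟩
      by_cases c3 : bX (oU + i) < p
      · rw [if_pos (by simpa [hsu.ou, hdu.bx, hup] using c3)]
        exact tri_skip.2 (no (by omega))
      rw [if_neg (by simpa [hsu.ou, hdu.bx, hup] using c3), tri_ifLt]
      refine ⟨by simp [hsu.ou, k2, w1], ?_⟩
      by_cases c4 : p < bX (oU + i)
      · rw [if_pos (by simpa [hsu.ou, hdu.bx, hup] using c4)]
        exact tri_skip.2 (no (by omega))
      rw [if_neg (by simpa [hsu.ou, hdu.bx, hup] using c4), tri_put]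
      refine ⟨by simp [k4, k5, hpsi', w3], by simp, fun x hx => ?_⟩
      by_cases hxi : x = psi i
      · subst hxi
        simp [hpsi']
        exact ⟨i, by omega, by omega, rfl⟩
      · have := hu x hx
        simp [hpsi', hxi]
        refine ⟨this.1, ?_⟩
        rw [this.2.2.1]
        constructor
        · rintro ⟨j, hj, hh⟩; exact ⟨j, by omega, hh⟩
        · rintro ⟨j, hj, hh, hx⟩
          refine ⟨j, lt_of_le_of_ne (by omega) ?_, hh, hx⟩
          rintro rfl; exact hxi hx.symm
    refine first.mono fun v hv ⟨hvB, hvA⟩ => ?_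
    have e1 : v.var vI = i := by rw [hv.var _ (by decide)]; simp
    have e2 : v.var vOV = oV := by rw [hv.var _ (by decide)]; simp [hsu.ov]
    have e3 : v.var vPb = p := by rw [hv.var _ (by decide)]; simp [hup]
    have e4 : v.arr aBucX = bX := by rw [hv.arr _ (by decide)]; simp [hdu.bx]
    have e5 : v.arr aPsi i = psi i := by rw [hv.arr _ (by decide)]; simp [hpsi']
    rw [tri_ifLt]
    refine ⟨by simp [e1, e2, k3, w2], ?_⟩
    by_cases c1 : p < bX (oV + i)
    · rw [if_pos (by simp [e1, e2, e3, e4, c1]), tri_put]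
      refine ⟨by simp [e1, e5, k4, k6, w3], fun x hx => ?_⟩
      simp only [State.put_arr, Nat.reduceEqDiff, if_false]
      refine ⟨(hvA x hx).1, ?_, (hvA x hx).2, ?_⟩
      · simp [e1, e5, Function.update_apply, hvB]
        split_ifs
        · rfl
        · exact (hu x hx).2.1
      · by_cases hxi : x = psi i
        · subst hxi
          simp [e1, e5]
          exact ⟨i, by omega, c1, rfl⟩
        · simp [e1, e5, hvB, hxi]
          rw [(hu x hx).2.2.2]
          constructor
          · rintro ⟨j, hj, hh⟩; exact ⟨j, by omega, hh⟩
          · rintro ⟨j, hj, hh, hx⟩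
            refine ⟨j, lt_of_le_of_ne (by omega) ?_, hh, hx⟩
            rintro rfl; exact hxi hx.symm
    · rw [if_neg (by simp [e1, e2, e3, e4]; omega), tri_skip]
      refine fun x hx => ⟨(hvA x hx).1, by rw [hvB]; exact (hu x hx).2.1, (hvA x hx).2, ?_⟩
      rw [hvB, (hu x hx).2.2.2]
      constructor
      · rintro ⟨j, hj, hh⟩; exact ⟨j, by omega, hh⟩
      · rintro ⟨j, hj, hh, hx⟩
        refine ⟨j, lt_of_le_of_ne (by omega) ?_, hh, hx⟩
        rintro rfl; exact c1 hh

/-- By `dft_product` the final array is congruent to $32^d$ times the pair counts. Both sides lie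
below the modulus, so an entry is positive exactly when some pair cancels. -/
theorem tri_hit (h : Env W off n d N) (s : State) (hp : Par n d s) (ht : Tables n d s) {q : ℕ}
    (hq : s.var vQ = q) (hqd : q < 2 * 2 ^ d)
    (hA : ∀ x < 32 ^ d, s.arr aA x ≤ 1) (hB : ∀ x < 32 ^ d, s.arr aB x ≤ 1) :
    Tri W off hitCmd s fun t =>
      (∀ k, t.arr aBest k = s.arr aBest k ∨ (t.arr aBest k = q + 1 ∧ ∃ v < 32 ^ d, phin v = k ∧
        0 < cancelCount d (s.arr aA) (s.arr aB) v)) ∧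
      ∀ v < 32 ^ d, 0 < cancelCount d (s.arr aA) (s.arr aB) v → t.arr aBest (phin v) = q + 1 := by
  have hf := h.facts
  have hm := modulus_facts d
  unfold hitCmd
  refine Tri.seq (tri_dft (.inl rfl) h s hp ht fun x hx => by have := hA x hx; omega)
    fun t1 h1 r1 => ?_
  have p1 := hp.same h1 (by decide)
  have b1 : t1.arr aB = s.arr aB := h1.arr _ (by decide)
  refine Tri.seq (tri_dft (.inr rfl) h t1 p1 (ht.same h1 (by decide))
    fun x hx => by rw [b1]; have := hB x hx; omega) fun t2 h2 r2 => ?_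
  rw [b1] at r2
  have p2 := p1.same h2 (by decide)
  have a2 : t2.arr aA = t1.arr aA := h2.arr _ (by decide)
  refine Tri.seq (Tri.loop (fun i t => ∀ x < 32 ^ d, t.arr aA x =
    if x < i then t2.arr aA x * t2.arr aB x % modulus d else t2.arr aA x) (by simp) ?_
    (Q := fun t => ∀ x < 32 ^ d, t.arr aA x = t2.arr aA x * t2.arr aB x % modulus d) ?_)
    fun t3 h3 r3 => ?_
  · intro i hi t hS ht
    rw [p2.dd] at hi
    have hpt := p2.same hS (by decide)
    have k1 := h.addrOk (a := aA) (i := i) (by norm_num) (by norm_num) (by omega)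
    have k2 := h.addrOk (a := aB) (i := i) (by norm_num) (by norm_num) (by omega)
    have e1 : t.arr aB = t2.arr aB := hS.arr _ (by decide)
    have e2 := ht i hi
    simp only [lt_irrefl, if_false] at e2
    have k3 : t2.arr aA i * t2.arr aB i < W := by
      refine h.mul_lt ?_ (r2 i hi).1
      rw [a2]; exact (r1 i hi).1
    rw [tri_put]
    refine ⟨by simp [k1, k2, e1, e2, k3], fun x hx => ?_⟩
    by_cases hxi : x = i
    · subst hxi
      simp [e1, e2, hpt.mo]
    · have e3 : x < i + 1 ↔ x < i := by omega
      simp only [e3]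
      simpa [Function.update_apply, hxi] using ht x hx
  · rw [p2.dd]
    intro t _ ht x hx
    rw [ht x hx, if_pos hx]
  have p3 := p2.same h3 (by decide)
  have tt3 := ((ht.same h1 (by decide)).same h2 (by decide)).same h3 (by decide)
  refine Tri.seq (tri_dft (.inl rfl) h t3 p3 tt3
    fun x hx => by rw [r3 x hx]; exact Nat.mod_lt _ (by omega)) fun t4 h4 r4 => ?_
  have p4 := p3.same h4 (by decide)
  have tt4 := tt3.same h4 (by decide)
  set cc := cancelCount d (s.arr aA) (s.arr aB) with hcc
  have count : ∀ v < 32 ^ d, (0 < t4.arr aA v ↔ 0 < cc v) := by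
    intro v hv
    have e1 : ((t4.arr aA v : ℕ) : ZMod (modulus d)) = ((32 ^ d * cc v : ℕ) : ZMod (modulus d)) := by
      rw [(r4 v hv).2, hcc, ← dft_product (root_pow d) d (s.arr aA) (s.arr aB) v]
      refine Finset.sum_congr rfl fun x hx => ?_
      rw [Finset.mem_range] at hx
      rw [r3 x hx, ZMod.natCast_mod, Nat.cast_mul, a2, (r1 x hx).2, (r2 x hx).2]
    -- For 0/1 indicators the count is at most $32^{2d}$, so the scaled count is at most
    -- $2^{15d}\le2^{16d}$.
    have e2 : 32 ^ d * cc v < modulus d := by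
      have h5 : cc v ≤ 32 ^ d * 32 ^ d := cancelCount_le hA hB v
      have h6 : 32 ^ d * (32 ^ d * 32 ^ d) ≤ 2 ^ (16 * d) := by
        rw [← pow_add, ← pow_add, show 32 = 2 ^ 5 by norm_num, ← pow_mul]
        exact Nat.pow_le_pow_right (by norm_num) (by omega)
      have h7 := Nat.mul_le_mul_left (32 ^ d) h5
      unfold modulus
      omega
    rw [ZMod.natCast_eq_natCast_iff'] at e1
    rw [Nat.mod_eq_of_lt (r4 v hv).1, Nat.mod_eq_of_lt e2] at e1
    rw [e1]
    have : 0 < 32 ^ d := by positivity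
    constructor
    · exact fun h => Nat.pos_of_mul_pos_left h
    · exact fun h => Nat.mul_pos this h
  have best4 : t4.arr aBest = s.arr aBest := by
    rw [h4.arr _ (by decide), h3.arr _ (by decide), h2.arr _ (by decide), h1.arr _ (by decide)]
  have q4 : t4.var vQ = q := by
    rw [h4.var _ (by decide), h3.var _ (by decide), h2.var _ (by decide), h1.var _ (by decide), hq]
  refine Tri.loop (fun i t =>
      (∀ k, t.arr aBest k = s.arr aBest k ∨ (t.arr aBest k = q + 1 ∧ ∃ v < 32 ^ d, phin v = k ∧
        0 < cc v)) ∧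
      ∀ v < i, 0 < cc v → t.arr aBest (phin v) = q + 1)
      ⟨fun k => .inl (by rw [best4]), by simp⟩ ?_ (by rw [p4.dd]; exact fun t _ ht => ht)
  intro i hi t hS ⟨g1, g2⟩
  rw [p4.dd] at hi
  have e1 : t.arr aA = t4.arr aA := hS.arr _ (by decide)
  have e2 : t.var vQ = q := by rw [hS.var _ (by decide), q4]
  have e3 : t.arr aPhin i = phin i := (tt4.same hS (by decide)).phin i hi
  have e4 := phin_le hi
  have k1 := h.addrOk (a := aA) (i := i) (by norm_num) (by norm_num) (by omega)
  have k2 := h.addrOk (a := aPhin) (i := i) (by norm_num) (by norm_num) (by omega)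
  have k3 := h.addrOk (a := aBest) (i := phin i) (by norm_num) (by norm_num) (by omega)
  rw [tri_ifLt]
  refine ⟨by simp [k1]; omega, ?_⟩
  by_cases c1 : 0 < cc i
  · rw [if_pos (by simpa [e1, count i hi] using c1), tri_put]
    refine ⟨by simp [k2, k3, e2, e3]; omega, fun k => ?_, fun v hv hcv => ?_⟩
    · by_cases hk : k = phin i
      · subst hk
        simp [e2, e3]
        exact .inr ⟨i, hi, rfl, c1⟩
      · simpa [e3, Function.update_apply, hk] using g1 k
    · by_cases hk : phin v = phin i
      · simp [e2, e3, hk]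
      · have hvi : v ≠ i := by rintro rfl; exact hk rfl
        simpa [e3, Function.update_apply, hk] using g2 v (by omega) hcv
  · rw [if_neg (by simpa [e1, count i hi] using c1), tri_skip]
    refine ⟨by simpa using g1, fun v hv hcv => ?_⟩
    have hvi : v ≠ i := by rintro rfl; exact c1 hcv
    simpa using g2 v (by omega) hcv

/-- Translates cancelling digit vectors back to indices: `phin_eq_add` identifies the recorded
position with the sum, and `exists_cancel` shows that every pair is recorded. -/
theorem tri_pass (h : Env W off n d N) (s : State) (hp : Par n d s) (ht : Tables n d s)
    (hd : Data Z oZ bZ oX bX s) (hs : Side n oU oV fU fV s) {q p : ℕ}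
    (hq : s.var vQ = q) (hqd : q < 2 * 2 ^ d) (hpb : s.var vPb = p) :
    Tri W off (indicatorCmd ;; hitCmd) s fun t =>
      (∀ k, t.arr aBest k = s.arr aBest k ∨ (t.arr aBest k = q + 1 ∧ ∃ i ≤ n, ∃ j ≤ n, i + j = k ∧
        bZ (oU + i) = q ∧ bX (oU + i) = p ∧ p < bX (oV + j))) ∧
      ∀ i ≤ n, ∀ j ≤ n, bZ (oU + i) = q → bX (oU + i) = p → p < bX (oV + j) →
        t.arr aBest (i + j) = q + 1 := by
  have hle := h.le
  refine Tri.seq (tri_indicator h s hp ht hd hs hq hpb) fun u hu r => ?_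
  have hbest : u.arr aBest = s.arr aBest := hu.arr _ (by decide)
  refine (tri_hit h u (hp.same hu (by decide)) (ht.same hu (by decide))
    (by rw [hu.var _ (by decide), hq]) hqd (fun x hx => (r x hx).1) (fun x hx => (r x hx).2.1)).mono
    fun t _ ⟨g1, g2⟩ => ?_
  rw [hbest] at g1
  refine ⟨fun k => ?_, fun i hi j hj hi1 hi2 hj1 => ?_⟩
  · rcases g1 k with e1 | ⟨e1, v, hv, hvk, hc⟩
    · exact .inl e1
    obtain ⟨y, hy, z, hz, hcan, ha, hb⟩ := cancelCount_pos.1 hc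
    obtain ⟨i, hi, ⟨hi1, hi2⟩, rfl⟩ := (r y hy).2.2.1.1 ha
    obtain ⟨j, hj, hj1, rfl⟩ := (r z hz).2.2.2.1 hb
    refine .inr ⟨e1, i, by omega, j, by omega, ?_, hi1, hi2, hj1⟩
    rw [← hvk, phin_eq_add (by omega) (by omega) hv hcan]
  · have p1 : psi i < 32 ^ d := psi_lt (by omega)
    have p2 : psi j < 32 ^ d := psi_lt (by omega)
    obtain ⟨v, hv, hcan⟩ := exists_cancel d (psi i) (psi j)
    rw [← phin_eq_add (by omega) (by omega) hv hcan]
    refine g2 v hv (cancelCount_pos.2 ⟨_, p1, _, p2, hcan, ?_, ?_⟩)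
    · exact (r _ p1).2.2.1.2 ⟨i, by omega, ⟨hi1, hi2⟩, rfl⟩
    · exact (r _ p2).2.2.2.2 ⟨j, by omega, hj1, rfl⟩

theorem tri_best (h : Env W off n d N) (s : State) (hp : Par n d s) (ht : Tables n d s)
    (hd : Data Z oZ bZ oX bX s) (hs : Side n oU oV fU fV s)
    (hZ : ∀ e < 2 * n + 2, bZ e < 2 * 2 ^ d) (hX : ∀ e < 2 * n + 2, bX e < 2 * 2 ^ d) :
    Tri W off bestCmd s fun t => IsBest n (2 * 2 ^ d) oU oV bZ bX (t.arr aBest) := by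
  have hf := h.facts
  have b1 := hs.ou_le
  refine Tri.seq (Tri.loop (fun i t => ∀ k < i, t.arr aBest k = 0) (by simp) ?_
    (Q := fun t => ∀ k ≤ 2 * n, t.arr aBest k = 0)
    (by rw [hp.k2]; exact fun t _ ht k hk => ht k (by omega))) fun u hu r => ?_
  · intro i hi t hS h1
    rw [hp.k2] at hi
    have k1 := h.addrOk (a := aBest) (i := i) (by norm_num) (by norm_num) (by omega)
    rw [tri_put]
    refine ⟨by simp [k1]; omega, fun k hk => ?_⟩
    by_cases hki : k = i
    · simp [hki]
    · simpa [Function.update_apply, hki] using h1 k (by omega)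
  have hpu := hp.same hu (by decide)
  have htu := ht.same hu (by decide)
  have hdu := hd.same hu (by decide)
  have hsu := hs.same hu (by decide)
  -- The state before pass `(q, p)`. Key buckets are processed in increasing order, so overwriting
  -- with `q + 1` never lowers an entry and the last value written is the largest.
  let I : ℕ → ℕ → State → Prop := fun q p t =>
    (∀ k ≤ 2 * n, t.arr aBest k ≤ q + 1) ∧
    (∀ k ≤ 2 * n, t.arr aBest k ≠ 0 → ∃ i ≤ n, ∃ j ≤ n, i + j = k ∧
      bZ (oU + i) + 1 = t.arr aBest k ∧ bX (oU + i) < bX (oV + j)) ∧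
    ∀ i ≤ n, ∀ j ≤ n, bX (oU + i) < bX (oV + j) →
      (bZ (oU + i) < q ∨ (bZ (oU + i) = q ∧ bX (oU + i) < p)) →
      bZ (oU + i) + 1 ≤ t.arr aBest (i + j)
  refine Tri.loop (fun q t => (∀ k ≤ 2 * n, t.arr aBest k ≤ q) ∧ I q 0 t)
    ⟨fun k hk => (r k hk).le, fun k hk => by rw [r k hk]; omega,
      fun k hk hk0 => absurd (r k hk) hk0, fun i _ j _ _ hh => by omega⟩ ?_ ?_
  · intro q hq t hS ⟨h0, hI⟩
    rw [hpu.nb] at hq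
    have hpt := (hpu.same hS (by decide)).set (x := vQ) (v := q) (by norm_num)
    have htt := (htu.same hS (by decide)).set (x := vQ) (v := q)
    have hdt := (hdu.same hS (by decide)).set (x := vQ) (v := q)
    have hst := (hsu.same hS (by decide)).set (x := vQ) (v := q) (by norm_num)
    refine Tri.loop (I q) (by exact hI) ?_ ?_
    · intro p hpp v hSv ⟨g1, g2, g3⟩
      have hqv : v.var vQ = q := by rw [hSv.var _ (by decide)]; simp
      refine (tri_pass (p := p) h (v.set vPb p) ((hpt.same hSv (by decide)).set (by norm_num))
        (htt.same hSv (by decide)).set (hdt.same hSv (by decide)).set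
        ((hst.same hSv (by decide)).set (by norm_num)) (by simp [hqv]) hq (by simp)).mono
        fun z _ ⟨f1, f2⟩ => ?_
      simp only [State.set_arr] at f1
      refine ⟨fun k hk => ?_, fun k hk hk0 => ?_, fun i hi j hj hij hh => ?_⟩
      · have := g1 k hk
        rcases f1 k with e | ⟨e, -⟩ <;> omega
      · rcases f1 k with e | ⟨e, i, hi, j, hj, hij, e1, e2, e3⟩
        · rw [e] at hk0 ⊢
          exact g2 k hk hk0
        · exact ⟨i, hi, j, hj, hij, by omega, by omega⟩
      · by_cases c : bZ (oU + i) = q ∧ bX (oU + i) = p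
        · rw [f2 i hi j hj c.1 c.2 (by omega)]; omega
        · have := g3 i hi j hj hij (by omega)
          rcases f1 (i + j) with e | ⟨e, -⟩ <;> omega
    · rw [hpt.nb]
      intro v _ ⟨g1, g2, g3⟩
      refine ⟨g1, fun k hk => (g1 k hk).trans (by omega), g2, fun i hi j hj hij hh => ?_⟩
      have := hX (oU + i) (by omega)
      exact g3 i hi j hj hij (by omega)
  · rw [hpu.nb]
    intro t _ ⟨g0, _, g2, g3⟩
    refine ⟨g0, g2, fun i hi j hj hij => g3 i hi j hj hij (.inl (hZ _ (by omega)))⟩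

end

end SkewConv

namespace SkewConv

open WordRAM WordRAM.Expr WordRAM.Cmd

/-! ### The main part -/

section

variable {W off n d N oU oV fU fV : ℕ} {Z oZ bZ oX bX : ℕ → ℕ}

/-- Covers the pairs whose first element has the strictly smaller skewed bucket. By `hrel` their
value is decided by the first element alone. -/
theorem tri_side (h : Env W off n d N) (s : State) (hp : Par n d s) (ht : Tables n d s)
    (hd : Data Z oZ bZ oX bX s) {X R : ℕ → ℕ} (hsZ : IsSorted (2 * n + 2) (8 ^ d) Z oZ bZ)
    (hsX : IsSorted (2 * n + 2) (8 ^ d) X oX bX)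
    (hs : Side n oU oV fU fV s) (hZ : ∀ e < 2 * n + 2, Z e ≤ N)
    (hrel : ∀ i ≤ n, ∀ j ≤ n, X (oU + i) ≤ X (oV + j) →
      Z (oU + i) + (i + j) * fU ≤ Z (oV + j) + (i + j) * fV)
    (hR : ∀ i ≤ n, ∀ j ≤ n, pairVal Z oU oV fU fV i j ≤ R (i + j))
    (hC : ∀ k, s.arr aC k ≤ R k) :
    Tri W off sideCmd s fun t => Between (s.arr aC) (t.arr aC) R ∧
      ∀ i ≤ n, ∀ j ≤ n, bX (oU + i) < bX (oV + j) →
        pairVal Z oU oV fU fV i j ≤ t.arr aC (i + j) := by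
  have b1 := hs.ou_le
  have b2 := hs.ov_le
  have hb := block_count h.le
  refine Tri.seq (tri_best h s hp ht hd hs (fun e he => (hsZ.buc_lt hb he).1)
    fun e he => (hsX.buc_lt hb he).1) fun u hu r => ?_
  have hC' : u.arr aC = s.arr aC := hu.arr _ (by decide)
  refine (tri_search h u (hp.same hu (by decide)) (hd.same hu (by decide)) hsZ
    (hs.same hu (by decide)) hZ r.le hR (by rw [hC']; exact hC)).mono fun t _ ⟨g1, g2⟩ => ?_
  rw [hC'] at g1
  refine ⟨g1, fun i hi j hj hij => ?_⟩
  have h1 := r.ge i hi j hj hij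
  by_cases he : bZ (oU + i) + 1 = u.arr aBest (i + j)
  · exact g2 i hi j hj he
  -- The pair misses the best bucket, so a witness with the same sum lies in a strictly higher key
  -- bucket. Its key is at least as large and its minimum is on the first side, so its value
  -- dominates.
  · obtain ⟨i', hi', j', hj', hk, hb1, hb2⟩ := r.wit (i + j) (by omega) (by omega)
    have h2 := g2 i' hi' j' hj' (by rw [hk]; exact hb1)
    have h3 := hrel i' hi' j' hj' (hsX.key_le (by omega) (by omega) hb2)
    have h4 : Z (oU + i) ≤ Z (oU + i') := hsZ.key_le (by omega) (by omega) (by omega)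
    rw [hk] at h2
    unfold pairVal at h2 ⊢
    rw [hk] at h2 h3
    omega

theorem tri_out (h : Env W off n d N) (s : State) (hp : Par n d s) :
    Tri W off outCmd s fun t => ∀ k ≤ 2 * n, t.arr aRaw k = s.arr aC k := by
  have hf := h.facts
  refine Tri.loop (fun i t => ∀ k < i, t.arr aRaw k = s.arr aC k) (by simp) ?_
    (by rw [hp.k2]; exact fun t _ ht k hk => ht k (by omega))
  intro i hi t hS ht
  rw [hp.k2] at hi
  have e1 : t.arr aC = s.arr aC := hS.arr _ (by decide)
  have k1 := h.addrOk (a := aC) (i := i) (by norm_num) (by norm_num) (by omega)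
  have k2 : AddrOk W off 0 i := by unfold AddrOk; simp; omega
  rw [tri_put]
  refine ⟨by simp [k1, k2], fun k hk => ?_⟩
  by_cases hki : k = i
  · simp [hki, e1]
  · simpa [Function.update_apply, hki] using ht k (by omega)

/-- `R` is any upper bound for all pair values; soundness is carried through the three searches as
an inequality with `R`, completeness as a lower bound for each pair. -/
theorem tri_main (h : Env W off n d N) (s : State) (hp : Par n d s)
    (hraw : ∀ e, s.arr aRaw e ≤ N) (h0 : ∀ a i, 0 < a → s.arr a i = 0) {R : ℕ → ℕ}
    (hR : ∀ i ≤ n, ∀ j ≤ n,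
      min (s.arr aRaw (i + 1)) (s.arr aRaw (n + 1 + j + 1) + (i + j)) ≤ R (i + j)) :
    Tri W off mainCmd s fun t => ∀ k ≤ 2 * n, t.arr aRaw k ≤ R k ∧ ∀ i ≤ n, ∀ j ≤ n, i + j = k →
      min (s.arr aRaw (i + 1)) (s.arr aRaw (n + 1 + j + 1) + (i + j)) ≤ t.arr aRaw k := by
  have hf := h.facts
  have hpow := (pow_facts d).1
  have hNS : 2 * 2 ^ d * 8 ^ d = 2 * 16 ^ d := by rw [← hpow]; ring
  have hb := block_count h.le
  unfold mainCmd
  refine Tri.seq (tri_keys h s hp hraw) fun s1 h1 ⟨k1, k1'⟩ => ?_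
  have p1 := hp.same h1 (by decide)
  refine Tri.seq (tri_tables h s1 p1 (by rw [h1.arr _ (by decide), h0 _ _ (by norm_num)])
    (by rw [h1.arr _ (by decide), h0 _ _ (by norm_num)])) fun s2 h2 tt2 => ?_
  have p2 := p1.same h2 (by decide)
  have z2 : s2.arr aZ = s1.arr aZ := h2.arr _ (by decide)
  have x2 : s2.arr aX = s1.arr aX := h2.arr _ (by decide)
  set Z := s1.arr aZ with hZdef
  set X := s1.arr aX with hXdef
  have hZ : ∀ e < 2 * n + 2, Z e ≤ N := fun e he => by rw [k1 e he]; exact hraw _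
  refine Tri.seq (tri_sort (B := N) (m := 2 * n + 2) (S := 8 ^ d) (NB := 2 * 2 ^ d) s2
    ⟨by decide, by decide, by decide, by decide⟩ p2.el p2.nb p2.sz hb (by omega)
    (by rw [z2]; exact hZ) (fun e _ => by
      rw [h2.arr _ (by decide), h1.arr _ (by decide), h0 _ _ (by norm_num)])) fun s3 h3 ⟨r3, r3'⟩ => ?_
  rw [z2] at r3
  have p3 := p2.same h3 (by decide)
  have tt3 := tt2.same h3 (by decide)
  have x3 : s3.arr aX = X := by rw [h3.arr _ (by decide), x2]
  -- Skewing adds at most `2 * n` to an entry, hence the larger key bound.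
  refine Tri.seq (tri_sort (B := N + 2 * n + 1) (m := 2 * n + 2) (S := 8 ^ d) (NB := 2 * 2 ^ d) s3
    ⟨by decide, by decide, by decide, by decide⟩ p3.el p3.nb p3.sz hb (by omega)
    (by
      rw [x3]
      intro e he
      rw [k1' e he]
      have := hraw (e + 1)
      split_ifs <;> omega) r3') fun s4 h4 ⟨r4, _⟩ => ?_
  rw [x3] at r4
  have p4 := p3.same h4 (by decide)
  have tt4 := tt3.same h4 (by decide)
  have d4 : Data Z (s3.arr aOrdZ) (s3.arr aBucZ) (s4.arr aOrdX) (s4.arr aBucX) s4 :=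
    ⟨by rw [h4.arr _ (by decide), h3.arr _ (by decide), z2], h4.arr _ (by decide),
      h4.arr _ (by decide), rfl, rfl⟩
  set oZ := s3.arr aOrdZ
  set bZ := s3.arr aBucZ
  set oX := s4.arr aOrdX
  set bX := s4.arr aBucX
  have c4 : s4.arr aC = fun _ => 0 := by
    funext i
    rw [h4.arr _ (by decide), h3.arr _ (by decide), h2.arr _ (by decide), h1.arr _ (by decide),
      h0 _ _ (by norm_num)]
  set s5 : State := (((s4.set vOU 0).set vOV (n + 1)).set vFU 0).set vFV 1 with hs5
  rw [tri_seq, tri_set]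
  refine ⟨by simp; omega, ?_⟩
  rw [tri_seq, tri_set]
  refine ⟨by simp, ?_⟩
  rw [tri_seq, tri_set]
  refine ⟨by simp; omega, ?_⟩
  rw [tri_seq, tri_set]
  refine ⟨by simp; omega, ?_⟩
  have e5 : (((s4.set vOU ((lit 0).val s4)).set vOV
      ((var vN1).val (s4.set vOU ((lit 0).val s4)))).set vFU 0).set vFV 1 = s5 := by
    simp [hs5, p4.n1]
  change Tri W off _ ((((s4.set vOU ((lit 0).val s4)).set vOV
      ((var vN1).val (s4.set vOU ((lit 0).val s4)))).set vFU 0).set vFV 1) _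
  rw [e5]
  have p5 : Par n d s5 := (((p4.set (by norm_num)).set (by norm_num)).set (by norm_num)).set
    (by norm_num)
  have tt5 : Tables n d s5 := tt4.set.set.set.set
  have d5 : Data Z oZ bZ oX bX s5 := d4.set.set.set.set
  have sd5 : Side n 0 (n + 1) 0 1 s5 := by
    refine ⟨?_, ?_, ?_, ?_, by omega, by omega, by omega, by omega⟩ <;> simp [hs5]
  have pv : ∀ i ≤ n, ∀ j ≤ n, pairVal Z 0 (n + 1) 0 1 i j =
      min (s.arr aRaw (i + 1)) (s.arr aRaw (n + 1 + j + 1) + (i + j)) := by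
    intro i hi j hj
    rw [pairVal, k1 _ (by omega), k1 _ (by omega)]
    simp
  have pv' : ∀ i ≤ n, ∀ j ≤ n, pairVal Z (n + 1) 0 1 0 j i =
      min (s.arr aRaw (i + 1)) (s.arr aRaw (n + 1 + j + 1) + (i + j)) := by
    intro i hi j hj
    rw [pairVal, k1 _ (by omega), k1 _ (by omega), min_comm]
    simp [add_comm]
  have hR5 : ∀ i ≤ n, ∀ j ≤ n, pairVal Z 0 (n + 1) 0 1 i j ≤ R (i + j) := fun i hi j hj => by
    rw [pv i hi j hj]; exact hR i hi j hj
  have hR7 : ∀ i ≤ n, ∀ j ≤ n, pairVal Z (n + 1) 0 1 0 i j ≤ R (i + j) := fun i hi j hj => by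
    rw [pv' j hj i hi, add_comm i j]; exact hR j hj i hi
  have xu : ∀ i ≤ n, X i = Z i + (n - i) := fun i hi => by
    rw [k1' i (by omega), k1 i (by omega), if_pos (by omega)]
  have xv : ∀ j ≤ n, X (n + 1 + j) = Z (n + 1 + j) + (n + j) := fun j hj => by
    rw [k1' _ (by omega), k1 _ (by omega), if_neg (by omega)]; omega
  refine Tri.seq (tri_same h s5 p5 d5 r4 sd5 hZ hR5
    (fun k => by simp [hs5, c4])) fun s6 h6 ⟨g6, g6'⟩ => ?_
  refine Tri.seq (tri_side h s6 (p5.same h6 (by decide)) (tt5.same h6 (by decide))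
    (d5.same h6 (by decide)) r3 r4 (sd5.same h6 (by decide)) hZ ?_ hR5 (fun k => (g6 k).2))
    fun s7 h7 ⟨g7, g7'⟩ => ?_
  · intro i hi j hj hij
    rw [xv j hj, zero_add, xu i hi] at hij
    simp only [zero_add, mul_zero, add_zero, mul_one]
    omega
  have p7 := (p5.same h6 (by decide)).same h7 (by decide)
  have tt7 := (tt5.same h6 (by decide)).same h7 (by decide)
  have d7 := (d5.same h6 (by decide)).same h7 (by decide)
  set s8 : State := (((s7.set vOU (n + 1)).set vOV 0).set vFU 1).set vFV 0 with hs8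
  rw [tri_seq, tri_set]
  refine ⟨by simp, ?_⟩
  rw [tri_seq, tri_set]
  refine ⟨by simp; omega, ?_⟩
  rw [tri_seq, tri_set]
  refine ⟨by simp; omega, ?_⟩
  rw [tri_seq, tri_set]
  refine ⟨by simp; omega, ?_⟩
  have e8 : (((s7.set vOU ((var vN1).val s7)).set vOV 0).set vFU 1).set vFV 0 = s8 := by
    simp [hs8, p7.n1]
  change Tri W off _ ((((s7.set vOU ((var vN1).val s7)).set vOV 0).set vFU 1).set vFV 0) _
  rw [e8]
  have p8 : Par n d s8 := (((p7.set (by norm_num)).set (by norm_num)).set (by norm_num)).set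
    (by norm_num)
  have tt8 : Tables n d s8 := tt7.set.set.set.set
  have d8 : Data Z oZ bZ oX bX s8 := d7.set.set.set.set
  have sd8 : Side n (n + 1) 0 1 0 s8 := by
    refine ⟨?_, ?_, ?_, ?_, by omega, by omega, by omega, by omega⟩ <;> simp [hs8]
  refine Tri.seq (tri_side h s8 p8 tt8 d8 r3 r4 sd8 hZ ?_ hR7
    (fun k => by simpa [hs8] using (g7 k).2)) fun s9 h9 ⟨g9, g9'⟩ => ?_
  · intro j hj i hi hij
    rw [xv j hj, zero_add, xu i hi] at hij
    simp only [zero_add, mul_zero, add_zero, mul_one]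
    omega
  refine (tri_out h s9 (p8.same h9 (by decide))).mono fun t _ ht k hk => ?_
  rw [ht k hk]
  refine ⟨(g9 k).2, fun i hi j hj hij => ?_⟩
  subst hij
  have m9 : s7.arr aC (i + j) ≤ s9.arr aC (i + j) := by simpa [hs8] using (g9 (i + j)).1
  have m7 := (g7 (i + j)).1
  -- Each pair is handled by exactly one search: the first side, the common bucket, or the second
  -- side with the roles of `A` and `B` exchanged.
  rcases lt_trichotomy (bX i) (bX (n + 1 + j)) with hlt | heq | hgt
  · rw [← pv i hi j hj]
    exact (g7' i hi j hj (by simpa using hlt)).trans m9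
  · rw [← pv i hi j hj]
    exact ((g6' i hi j hj heq).trans m7).trans m9
  · rw [← pv' i hi j hj, add_comm i j]
    exact g9' j hj i hi (by simpa using hgt)

end

/-! ### The running time -/

/-- The numbers of iterations of the loops. -/
def iters (n d b : ℕ) : ℕ :=
  if b = vN1 then n + 1 else if b = vEl then 2 * n + 2 else if b = vDim then d
  else if b = vDD then 32 ^ d else if b = vSz then 8 ^ d else if b = vNB then 2 * 2 ^ d
  else if b = v32 then 32 else if b = vK2 then 2 * n + 1 else 0

/-- The exponents of `2 ^ d` in the numbers of iterations. -/
def iterDeg (b : ℕ) : ℕ :=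
  if b = vN1 then 4 else if b = vEl then 4 else if b = vDD then 5 else if b = vSz then 3
  else if b = vNB then 1 else if b = vK2 then 4 else 0

/-- The exponent of `2 ^ d` in the running time. -/
def deg : Cmd → ℕ
  | .skip => 0
  | .set _ _ => 0
  | .put _ _ _ => 0
  | .seq c c' => max (deg c) (deg c')
  | .ifLt _ _ c c' => max (deg c) (deg c')
  | .loop _ b c => iterDeg b + deg c

/-- The exponent of `d + 1` in the running time. -/
def logDeg : Cmd → ℕ
  | .skip => 0
  | .set _ _ => 0
  | .put _ _ _ => 0
  | .seq c c' => max (logDeg c) (logDeg c')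
  | .ifLt _ _ c c' => max (logDeg c) (logDeg c')
  | .loop _ b c => (if b = vDim then 1 else 0) + logDeg c

theorem iters_le {n d : ℕ} (h : n + 1 ≤ 16 ^ d) (b : ℕ) :
    iters n d b ≤ 32 * ((2 ^ d) ^ iterDeg b * (d + 1) ^ (if b = vDim then 1 else 0)) := by
  have e4 : 16 ^ d = (2 ^ d) ^ 4 := by rw [← pow_mul, mul_comm, pow_mul]; norm_num
  have e5 : 32 ^ d = (2 ^ d) ^ 5 := by rw [← pow_mul, mul_comm, pow_mul]; norm_num
  have e3 : 8 ^ d = (2 ^ d) ^ 3 := by rw [← pow_mul, mul_comm, pow_mul]; norm_num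
  rw [e4] at h
  unfold iters iterDeg
  split_ifs <;> first | omega | (simp only [pow_zero, pow_one, mul_one, one_mul]; omega)

/-- Sequencing and branching take the maximum of the exponents and nesting adds them. The constant
depends on the command only, not on `n` and `d`. -/
theorem time_le (c : Cmd) : ∃ K, ∀ n d, n + 1 ≤ 16 ^ d →
    c.time (iters n d) ≤ K * ((2 ^ d) ^ deg c * (d + 1) ^ logDeg c) := by
  have mono : ∀ {d a b a' b' : ℕ}, a ≤ a' → b ≤ b' →
      (2 ^ d) ^ a * (d + 1) ^ b ≤ (2 ^ d) ^ a' * (d + 1) ^ b' := fun ha hb =>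
    Nat.mul_le_mul (Nat.pow_le_pow_right (by positivity) ha) (Nat.pow_le_pow_right (by omega) hb)
  have pos : ∀ {d a b : ℕ}, 1 ≤ (2 ^ d) ^ a * (d + 1) ^ b := fun {d a b} =>
    Nat.one_le_iff_ne_zero.2 (by positivity)
  induction c with
  | skip => exact ⟨0, fun n d _ => by simp [Cmd.time]⟩
  | set x e => exact ⟨e.size + 1, fun n d _ => by simp [Cmd.time, deg, logDeg]⟩
  | put a e f => exact ⟨_, fun n d _ => by simp [Cmd.time, deg, logDeg]; exact le_rfl⟩
  | seq c c' hc hc' =>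
    obtain ⟨K, hK⟩ := hc
    obtain ⟨K', hK'⟩ := hc'
    refine ⟨K + K', fun n d h => ?_⟩
    rw [Cmd.time, deg, logDeg, add_mul]
    exact Nat.add_le_add
      ((hK n d h).trans (Nat.mul_le_mul_left _ (mono (le_max_left _ _) (le_max_left _ _))))
      ((hK' n d h).trans (Nat.mul_le_mul_left _ (mono (le_max_right _ _) (le_max_right _ _))))
  | ifLt e f c c' hc hc' =>
    obtain ⟨K, hK⟩ := hc
    obtain ⟨K', hK'⟩ := hc'
    refine ⟨e.size + (f.size + (2 + (K + K'))), fun n d h => ?_⟩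
    rw [Cmd.time, deg, logDeg]
    set g := (2 ^ d) ^ max (deg c) (deg c') * (d + 1) ^ max (logDeg c) (logDeg c') with hg
    have h1 : c.time (iters n d) ≤ K * g :=
      (hK n d h).trans (Nat.mul_le_mul_left _ (mono (le_max_left _ _) (le_max_left _ _)))
    have h2 : c'.time (iters n d) ≤ K' * g :=
      (hK' n d h).trans (Nat.mul_le_mul_left _ (mono (le_max_right _ _) (le_max_right _ _)))
    have h3 : 1 ≤ g := pos
    have h4 : max (c.time (iters n d)) (c'.time (iters n d)) ≤ K * g + K' * g := by omega
    calc _ ≤ e.size * g + (f.size * g + (2 * g + (K * g + K' * g))) := by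
          gcongr
          · exact Nat.le_mul_of_pos_right _ h3
          · exact Nat.le_mul_of_pos_right _ h3
          · exact Nat.le_mul_of_pos_right _ h3
      _ = _ := by ring
  | loop x b c hc =>
    obtain ⟨K, hK⟩ := hc
    refine ⟨4 + 32 * (K + 5), fun n d h => ?_⟩
    rw [Cmd.time, deg, logDeg]
    set l := if b = vDim then 1 else 0
    set g := (2 ^ d) ^ deg c * (d + 1) ^ logDeg c with hg
    have h1 : c.time (iters n d) ≤ K * g := hK n d h
    have h2 := iters_le h b
    have h3 : 1 ≤ g := pos
    have h4 : 1 ≤ (2 ^ d) ^ iterDeg b * (d + 1) ^ l := pos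
    set g' := (2 ^ d) ^ iterDeg b * (d + 1) ^ l with hg'
    have h5 : (2 ^ d) ^ (iterDeg b + deg c) * (d + 1) ^ (l + logDeg c) = g' * g := by
      rw [hg, hg']; ring
    rw [h5]
    calc _ ≤ 4 * (g' * g) + (32 * g') * ((K + 5) * g) := by
          gcongr
          · exact Nat.le_mul_of_pos_right _ (Nat.mul_pos h4 h3)
          · rw [add_mul]
            linarith
      _ = _ := by ring

theorem deg_param : deg paramCmd = 4 := by decide

theorem logDeg_param : logDeg paramCmd = 0 := by decide

/-- The choice of bucket size balances the costs: sorting, the common buckets and the search each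
contribute $4+3$, the transforms $1+1+5$. -/
theorem deg_main : deg mainCmd = 7 := by decide

theorem logDeg_main : logDeg mainCmd = 1 := by decide

end SkewConv

namespace SkewConv

open WordRAM WordRAM.Expr WordRAM.Cmd

/-! ### The machine program -/

/-- Compute the offset of the arrays. -/
def prelude : List Instr :=
  [.load (rt 0) (rt 0), .arith .add (rt 0) (rt 0) (rt 0), .const (rt 1) 3,
    .arith .add (rt 0) (rt 0) (rt 1)]

/-- The program. -/
def program : Program :=
  prelude ++ (readCmd.code 4 1 ++ (paramCmd.code (4 + readCmd.size) 1 ++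
    mainCmd.code (4 + readCmd.size + paramCmd.size) 1))

/-- The input occupies exactly the cells below $2n+3$, so this offset leaves it to array `0`, and
all other arrays start out zero. -/
theorem reach_prelude {w n : ℕ} (hw : 2 * n + 3 < 2 ^ w) (mem : ℕ → ℕ) (h0 : mem 0 = n)
    (hmem : ∀ a, mem a < 2 ^ w) (hmem' : ∀ a, 2 * n + 3 ≤ a → mem a = 0) :
    Reach w program 4 (start mem) fun m => m.pc = 4 ∧
      Rel w (2 * n + 3) ⟨fun _ => 0, fun a i => if a = 0 then mem i else 0⟩ m := by
  have hc : CodeAt program 0 (prelude ++ (readCmd.code 4 1 ++ (paramCmd.code (4 + readCmd.size) 1 ++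
    mainCmd.code (4 + readCmd.size + paramCmd.size) 1))) := fun i _ => by
      rw [zero_add]; rfl
  rw [codeAt_append, prelude] at hc
  simp only [codeAt_cons] at hc
  obtain ⟨⟨c1, c2, c3, c4, -⟩, -⟩ := hc
  have e3 : 3 % 2 ^ w = 3 := Nat.mod_eq_of_lt (by omega)
  have e1 : (n + n) % 2 ^ w = n + n := Nat.mod_eq_of_lt (by omega)
  have e2 : (n + n + 3) % 2 ^ w = n + n + 3 := Nat.mod_eq_of_lt (by omega)
  refine Reach.step c1 rfl (Reach.step (by simpa [start] using c2) rfl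
    (Reach.step (by simpa [start] using c3) rfl (Reach.step (by simpa [start] using c4) rfl
    (Reach.done ⟨by simp [start], ⟨fun x => ?_, ?_, fun a i ha => ?_, fun x => ?_,
      fun a i => ?_⟩⟩))))
  · simp [setReg_reg, rv_ne_rt, start]
  · simp [setReg_reg, start, Op.eval, h0, e1, e2, e3]
    omega
  · simp only [setReg_mem, start, addr]
    split_ifs with h
    · rfl
    · exact hmem' _ (by omega)
  · exact Nat.two_pow_pos w
  · simp only
    split_ifs
    · exact hmem i
    · exact Nat.two_pow_pos w

/-! ### Sufficient word length and correctness of the program -/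

theorem sixteen_pow_clog_le (n : ℕ) : 16 ^ Nat.clog 16 (n + 1) ≤ 16 * (n + 1) := by
  rcases Nat.eq_zero_or_pos (Nat.clog 16 (n + 1)) with h | h
  · rw [h]; omega
  · have h1 : 16 ^ (Nat.clog 16 (n + 1) - 1) < n + 1 :=
      Nat.pow_lt_of_lt_clog (by omega)
    have h2 : 16 ^ Nat.clog 16 (n + 1) = 16 * 16 ^ (Nat.clog 16 (n + 1) - 1) := by
      rw [← pow_succ']; congr 1; omega
    omega

/-- With $L=N+2\ge2$: $16^d\le16(n+1)\le L^5$, so the modulus $(16^d)^4+1$ is at most $L^{21}$. Its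
square gives the exponent 42, which leaves ample room for addresses and keys. -/
theorem env_of_le {n N w : ℕ} (hn : n ≤ N) (hw : (N + 2) ^ 42 ≤ 2 ^ w) :
    Env (2 ^ w) (2 * n + 3) n (Nat.clog 16 (n + 1)) N := by
  set d := Nat.clog 16 (n + 1) with hd
  set L := N + 2 with hL
  have hL2 : 2 ≤ L := by omega
  have h1 : 16 ≤ L ^ 4 := by
    calc 16 = 2 ^ 4 := by norm_num
      _ ≤ L ^ 4 := Nat.pow_le_pow_left hL2 4
  have h2 : 16 ^ d ≤ L ^ 5 := by
    calc 16 ^ d ≤ 16 * (n + 1) := sixteen_pow_clog_le n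
      _ ≤ L ^ 4 * L := Nat.mul_le_mul h1 (by omega)
      _ = L ^ 5 := by ring
  have h3 : 32 ^ d ≤ L ^ 10 := by
    calc 32 ^ d ≤ (16 * 16) ^ d := Nat.pow_le_pow_left (by norm_num) d
      _ = 16 ^ d * 16 ^ d := mul_pow _ _ _
      _ ≤ L ^ 5 * L ^ 5 := Nat.mul_le_mul h2 h2
      _ = L ^ 10 := by ring
  refine ⟨rfl, Nat.le_pow_clog (by norm_num) _, ?_, ?_⟩
  · refine le_trans ?_ hw
    have h4 : L ≤ L ^ 10 := Nat.le_self_pow (by norm_num) L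
    calc 2000 * (32 ^ d + N + 1) ≤ 2 ^ 12 * L ^ 10 := by omega
      _ ≤ L ^ 12 * L ^ 10 := Nat.mul_le_mul_right _ (Nat.pow_le_pow_left hL2 12)
      _ = L ^ 22 := by ring
      _ ≤ L ^ 42 := Nat.pow_le_pow_right (by omega) (by norm_num)
  · refine le_trans ?_ hw
    have h4 : modulus d ≤ L ^ 21 := by
      have h5 : 2 ^ (16 * d) ≤ L ^ 20 := by
        calc 2 ^ (16 * d) = (16 ^ d) ^ 4 := by
              rw [show (16 : ℕ) ^ d = 2 ^ (4 * d) by rw [pow_mul]; norm_num, ← pow_mul]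
              ring_nf
          _ ≤ (L ^ 5) ^ 4 := Nat.pow_le_pow_left h2 4
          _ = L ^ 20 := by ring
      have h6 : 1 ≤ L ^ 20 := Nat.one_le_pow _ _ (by omega)
      unfold modulus
      calc 2 ^ (16 * d) + 1 ≤ L ^ 20 * 2 := by omega
        _ ≤ L ^ 20 * L := Nat.mul_le_mul_left _ hL2
        _ = L ^ 21 := by ring
    calc _ ≤ L ^ 21 * L ^ 21 := Nat.mul_le_mul h4 h4
      _ = L ^ 42 := by ring

theorem iters_eq {n d : ℕ} {s : State} (hp : Par n d s) {c : Cmd}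
    (hc : ∀ b ∈ c.bv, b ∈ [vN1, vEl, vDim, vDD, vSz, vNB, v32, vK2]) :
    ∀ b ∈ c.bv, s.var b = iters n d b := by
  intro b hb
  have := hc b hb
  simp only [List.mem_cons, List.not_mem_nil, or_false] at this
  rcases this with rfl | rfl | rfl | rfl | rfl | rfl | rfl | rfl
  · exact hp.n1
  · exact hp.el
  · exact hp.dim
  · exact hp.dd
  · exact hp.sz
  · exact hp.nb
  · exact hp.c32
  · exact hp.k2

/-- A bound for the number of steps. -/
def steps (n : ℕ) : ℕ :=
  4 + (readCmd.time (iters n (Nat.clog 16 (n + 1))) +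
    (paramCmd.time (iters n (Nat.clog 16 (n + 1))) + mainCmd.time (iters n (Nat.clog 16 (n + 1)))))

theorem program_solves : SolvesSkewedConvIn program steps := by
  refine ⟨42, fun n A B N w hn hA hB hw => ?_⟩
  set d := Nat.clog 16 (n + 1) with hd
  have h := env_of_le hn hw
  rw [← hd] at h
  have hf := h.facts
  have hmem : ∀ a, inputMem A B a ≤ N := by
    intro a
    unfold inputMem
    split_ifs
    · exact hn
    · exact hA _
    · exact hB _
    · exact Nat.zero_le _
  have hw1 : 1 < 2 ^ w := by omega
  set s0 : State := ⟨fun _ => 0, fun a i => if a = 0 then inputMem A B i else 0⟩ with hs0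
  have hc : CodeAt program 0 (prelude ++ (readCmd.code 4 1 ++ (paramCmd.code (4 + readCmd.size) 1 ++
    mainCmd.code (4 + readCmd.size + paramCmd.size) 1))) := fun i _ => by
      rw [zero_add]; rfl
  rw [codeAt_append, codeAt_append, codeAt_append, Cmd.length_code, Cmd.length_code] at hc
  obtain ⟨-, c1, c2, c3⟩ := hc
  have t1 := tri_read h s0 (by simp [hs0, inputMem])
  set s1 := readCmd.run s0 with hs1
  have t2 := tri_param h hd s1 t1.2
  set s2 := paramCmd.run s1 with hs2
  have a2 : s2.arr = s0.arr := by
    funext a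
    rw [(same_run paramCmd s1).arr a (by simp [paramCmd, Cmd.wa]),
      (same_run readCmd s0).arr a (by simp [readCmd, Cmd.wa])]
  set R : ℕ → ℕ := fun k => if hk : k < 2 * n + 1 then skewedConv A B ⟨k, hk⟩ else 0 with hR
  have raw : s2.arr aRaw = inputMem A B := by rw [a2]; rfl
  have inA : ∀ i (hi : i ≤ n), inputMem A B (i + 1) = A ⟨i, by omega⟩ := by
    intro i hi
    simp [inputMem, hi]
  have inB : ∀ j (hj : j ≤ n), inputMem A B (n + 1 + j + 1) = B ⟨j, by omega⟩ := by
    intro j hj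
    have e1 : ¬ n + 1 + j + 1 - 1 < n + 1 := by omega
    have e2 : n + 1 + j + 1 - (n + 2) = j := by omega
    unfold inputMem
    rw [if_neg (by omega), dif_neg e1, dif_pos (by omega)]
    congr 2
  have t3 := tri_main h s2 t2.2 (by rw [raw]; exact hmem)
    (fun a i ha => by rw [a2]; simp [hs0]; omega) (R := R) (by
      intro i hi j hj
      rw [raw, inA i hi, inB j hj]
      have hk : i + j < 2 * n + 1 := by omega
      simp only [hR, hk, dif_pos]
      refine Finset.le_sup' (fun p : Fin (n + 1) × Fin (n + 1) => min (A p.1) (B p.2 + (i + j)))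
        (b := (⟨i, by omega⟩, ⟨j, by omega⟩)) ?_
      simp [indexPairs])
  have par2 : Par n d s2 := t2.2
  have reach : Reach w program (steps n) (start (inputMem A B)) fun m =>
      m.pc = 4 + readCmd.size + paramCmd.size + mainCmd.size ∧
      Rel (w := w) (2 * n + 3) (mainCmd.run s2) m := by
    refine (reach_prelude (n := n) (by omega) (inputMem A B) (by simp [inputMem])
      (fun a => lt_of_le_of_lt (hmem a) (by omega)) fun a ha => ?_).bind fun m1 ⟨p1, r1⟩ => ?_
    · unfold inputMem
      rw [if_neg (by omega), dif_neg (by omega), dif_neg (by omega)]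
    refine (reach_cmd (iters n d) hw1 readCmd 4 1 (by norm_num) s0 m1 p1 r1 t1.1 c1 (by decide)
      (by simp [readCmd, Cmd.bv])).bind fun m2 ⟨p2, r2, _⟩ => ?_
    refine (reach_cmd (iters n d) hw1 paramCmd _ 1 (by norm_num) s1 m2 p2 r2 t2.1 c2 (by decide)
      ?_).bind fun m3 ⟨p3, r3, _⟩ => ?_
    · have hb : ∀ b ∈ paramCmd.bv, b = vN1 := by decide
      intro b hbb
      rw [hb b hbb]
      exact t1.2
    refine (reach_cmd (iters n d) hw1 mainCmd _ 1 (by norm_num) s2 m3 p3 r3 t3.1 c3 (by decide)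
      (iters_eq par2 (by decide))).mono le_rfl fun m4 ⟨p4, r4, _⟩ => ⟨p4, r4⟩
  obtain ⟨t, ht, m, hrun, hpc, hrel⟩ := reach
  refine ⟨m, ⟨t, ht, hrun, ?_⟩, fun k => ?_⟩
  · have hlen : program[m.pc]? = none := by
      rw [List.getElem?_eq_none_iff, hpc]
      simp [program, prelude]
      omega
    simp [step, hlen]
  · have hk : (k : ℕ) ≤ 2 * n := by omega
    have hm : m.mem k = (mainCmd.run s2).arr aRaw k :=
      hrel.mem 0 k (by unfold AddrOk; simp; omega)
    have t3k := t3.2 k hk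
    rw [hm]
    refine le_antisymm ?_ ?_
    · have := t3k.1
      simpa [hR, hk] using this
    · refine Finset.sup'_le _ _ fun p hp => ?_
      have hp' : (p.1 : ℕ) + p.2 = k := by simpa [indexPairs] using hp
      have := t3k.2 p.1 (by omega) p.2 (by omega) hp'
      rw [raw, inA _ (by omega), inB _ (by omega), hp'] at this
      exact this

/-! ### The asymptotic bound -/

theorem steps_le : ∃ K, ∀ n, steps n ≤
    K * ((2 ^ Nat.clog 16 (n + 1)) ^ 7 * (Nat.clog 16 (n + 1) + 1)) := by
  obtain ⟨K1, h1⟩ := time_le readCmd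
  obtain ⟨K2, h2⟩ := time_le paramCmd
  obtain ⟨K3, h3⟩ := time_le mainCmd
  rw [deg_param, logDeg_param] at h2
  rw [deg_main, logDeg_main] at h3
  refine ⟨4 + K1 + K2 + K3, fun n => ?_⟩
  have hn : n + 1 ≤ 16 ^ Nat.clog 16 (n + 1) := Nat.le_pow_clog (by norm_num) _
  unfold steps
  set d := Nat.clog 16 (n + 1)
  have h1 := h1 n d hn
  have h2 := h2 n d hn
  have h3 := h3 n d hn
  simp only [readCmd, deg, logDeg, pow_zero, mul_one] at h1
  simp only [pow_zero, mul_one, pow_one] at h2 h3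
  have g1 : 1 ≤ (2 ^ d) ^ 7 * (d + 1) := Nat.one_le_iff_ne_zero.2 (by positivity)
  have g2 : (2 ^ d) ^ 4 ≤ (2 ^ d) ^ 7 * (d + 1) :=
    (Nat.pow_le_pow_right (by positivity) (by norm_num)).trans (Nat.le_mul_of_pos_right _ (by omega))
  set g := (2 ^ d) ^ 7 * (d + 1)
  calc _ ≤ 4 * g + (K1 * g + (K2 * g + K3 * g)) := by
        refine Nat.add_le_add (Nat.le_mul_of_pos_right _ g1) (Nat.add_le_add ?_
          (Nat.add_le_add (h2.trans (Nat.mul_le_mul_left _ g2)) h3))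
        exact h1.trans (Nat.le_mul_of_pos_right _ g1)
    _ = _ := by ring

/-- With ceiling logarithm $e+1$ one has $16^e\le n$, so $2^{7e}\le n^{7/4}$. The shift by one costs
$2^7=128$, and $e+2\le4\log n$ for $n\ge3$. -/
theorem isSoftO_of_le_clog {T : ℕ → ℕ} {K : ℕ} (hK : ∀ n, T n ≤
    K * ((2 ^ Nat.clog 16 (n + 1)) ^ 7 * (Nat.clog 16 (n + 1) + 1))) :
    IsSoftO (fun n => (T n : ℝ)) (fun n => (n : ℝ) ^ (7 / 4 : ℝ)) := by
  refine ⟨1, Asymptotics.IsBigO.of_bound (K * (128 * 4)) ?_⟩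
  filter_upwards [Filter.eventually_ge_atTop 3] with n hn
  have hd : 0 < Nat.clog 16 (n + 1) := Nat.clog_pos (by norm_num) (by omega)
  have hpow : 16 ^ (Nat.clog 16 (n + 1) - 1) ≤ n := by
    have : 16 ^ (Nat.clog 16 (n + 1) - 1) < n + 1 := Nat.pow_lt_of_lt_clog (by omega)
    omega
  have hs := hK n
  obtain ⟨e, he⟩ : ∃ e, Nat.clog 16 (n + 1) = e + 1 := ⟨_, (Nat.sub_add_cancel hd).symm⟩
  rw [he, Nat.add_sub_cancel] at hpow
  rw [he] at hs
  have hnpos : (0 : ℝ) < n := by exact_mod_cast (by omega : 0 < n)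
  have hlog : 1 ≤ Real.log n := by
    rw [Real.le_log_iff_exp_le hnpos]
    have h1 := Real.exp_one_lt_d9
    have h2 : (3 : ℝ) ≤ n := by exact_mod_cast hn
    linarith
  have hpow' : ((2 : ℝ) ^ e) ^ 4 ≤ n := by
    have : ((16 : ℕ) : ℝ) ^ e ≤ n := by exact_mod_cast hpow
    rw [← pow_mul, mul_comm, pow_mul]
    norm_num at this ⊢
    exact this
  have h1 : ((2 : ℝ) ^ e) ^ 7 ≤ (n : ℝ) ^ (7 / 4 : ℝ) := by
    have h2 : (((2 : ℝ) ^ e) ^ 4) ^ (7 / 4 : ℝ) = ((2 : ℝ) ^ e) ^ 7 := by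
      rw [← Real.rpow_natCast, ← Real.rpow_mul (by positivity), ← Real.rpow_natCast]
      norm_num
    rw [← h2]
    exact Real.rpow_le_rpow (by positivity) hpow' (by norm_num)
  have h3 : (e : ℝ) ≤ 2 * Real.log n := by
    have h4 : (2 : ℝ) ^ e ≤ n := by
      refine le_trans ?_ hpow'
      exact le_self_pow₀ (one_le_pow₀ (by norm_num)) (by norm_num)
    have h5 := Real.log_le_log (by positivity) h4
    rw [Real.log_pow] at h5
    have h6 := Real.log_two_gt_d9
    have h7 : (0 : ℝ) ≤ e := Nat.cast_nonneg e
    nlinarith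
  have h8 : (T n : ℝ) ≤ K * (((2 : ℝ) ^ (e + 1)) ^ 7 * ((e : ℝ) + 1 + 1)) := by
    have := (Nat.cast_le (α := ℝ)).2 hs
    push_cast at this
    exact this
  rw [Real.norm_of_nonneg (by positivity), Real.norm_of_nonneg (by positivity)]
  have h9 : (e : ℝ) + 1 + 1 ≤ 4 * Real.log n := by linarith
  calc (T n : ℝ) ≤ K * (((2 : ℝ) ^ (e + 1)) ^ 7 * ((e : ℝ) + 1 + 1)) := h8
    _ = K * (128 * ((2 : ℝ) ^ e) ^ 7 * ((e : ℝ) + 1 + 1)) := by ring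
    _ ≤ K * (128 * (n : ℝ) ^ (7 / 4 : ℝ) * (4 * Real.log n)) := by gcongr
    _ = _ := by ring

theorem isSoftO_steps : IsSoftO (fun n => (steps n : ℝ)) (fun n => (n : ℝ) ^ (7 / 4 : ℝ)) :=
  let ⟨_, h⟩ := steps_le
  isSoftO_of_le_clog h

end SkewConv

theorem theorem5 :
    ∃ (P : WordRAM.Program) (T : ℕ → ℕ),
      SolvesSkewedConvIn P T ∧
      IsSoftO (fun n => (T n : ℝ)) (fun n => (n : ℝ) ^ (7 / 4 : ℝ)) :=
  ⟨SkewConv.program, SkewConv.steps, SkewConv.program_solves, SkewConv.isSoftO_steps⟩
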